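/- **Setting.** Let $\mathrm{IS}=(\mathrm{KGen},P,V)$ be an identification scheme (public keys of polynomial length). It is *secure* against a class of adversaries if every efficient adversary of the class that first runs polynomially many sessions with the honest prover $P(\mathsf{sk},\mathsf{pk})$, one after the other and playing the verifier arbitrarily, and then plays the prover once against $V(\mathsf{pk})$, makes $V$ accept with negligible probability only. Efficient adversaries are polynomial-time probabilistic algorithms (classical), or polynomial-time quantum algorithms (quantum); both may be taken uniform, or non-uniform (with classical advice of polynomial length). Let $\alpha\ge 1$ be a constant, and let $\ell,r:\mathbb N\to\mathbb N$ be such that $1^{\ell(n)}$ and $1^{r(n)}$ are computable in polynomial time from $1^n$, $r(n)/\log n\to\infty$, and $6\log_2(2\alpha)\le \ell(n)\le\log_2 n$ for all large $n$ (the lower bound holds in particular whenever $\ell(n)\to\infty$, e.g. for $\ell(n)=\lfloor\log_2 n\rfloor$). **The protocol $\mathrm{IS}^*$.** Let $H$ be a random oracle: all values $H(k,M)\in\{0,1\}^n$, for $k,M\in\{0,1\}^*$, are independent and uniform. The secret key is $\mathsf{sk}$ and the public key is $(\mathsf{pk},\ell(n))$. The collision stage has $r(n)$ rounds. In each round the verifier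 $V^*$ sends a fresh uniform key $k\in\{0,1\}^n$, and the prover replies once with a pair $(M,M')$. The round is won if $M\ne M'$, the leading $\ell(n)$ bits of $H(k,M)$ and $H(k,M')$ agree, and the reply comes within the time of $\lceil\sqrt[3]{2^{\ell(n)}}\,\rceil$ sequential hash evaluations. The honest prover computes its replies by any fixed polynomial-time classical oracle algorithm that does not use $\mathsf{sk}$. In the identification stage the parties then run $\mathrm{IS}$. At the end $V^*$ accepts if $V$ accepts or at least $r(n)/4$ rounds were won. **Timing assumptions.** Computation other than hash evaluation, and communication, take no time; one hash evaluation takes unit time on every (classical or quantum) machine; and parallelism speeds up an adversary by a factor of at most $\alpha$. So an adversary that makes $q$ hash evaluations between receiving $k$ and replying needs time $q/\alpha$. Security of $\mathrm{IS}^*$ in the (classical) random oracle model is defined in the same way as that of $\mathrm{IS}$, where all parties have classical access to $H$, the timing assumptions hold, and the probability is also over $H$. **Lemma.** For uniform as well as for non-uniform adversaries: 1. If $\mathrm{IS}$ is secure against efficient classical adversaries, then $\mathrm{IS}^*$ is secure in the random oracle model against efficient classical adversaries. 2. If $\mathrm{IS}$ is secure against efficient quantum adversaries, then $\mathrm{IS}^*$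 is secure in the random oracle model against efficient quantum adversaries, whose access to $H$ is classical. -/

import Mathlib

open scoped ENNReal NNReal
open MeasureTheory

noncomputable section

namespace TimedId

/-! ### Bit strings, pairing, negligible functions -/

/-- The unary number `1^m`. -/
def unary (m : ℕ) : List Bool := List.replicate m true

/-- Self-delimiting encoding of two bit strings by one: every bit of `x` is preceded by the
marker `1`, and the marker `0` announces `y`. -/
def pair (x y : List Bool) : List Bool :=
  (x.flatMap fun b => [true, b]) ++ false :: y

/-- Decoding of `pair`; total, with an arbitrary value on strings that are not pairs. -/
def unpair : List Bool → List Bool × List Bool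
  | [] => ([], [])
  | [true] => ([], [])
  | false :: y => ([], y)
  | true :: b :: l => (b :: (unpair l).1, (unpair l).2)

theorem unpair_pair (x y : List Bool) : unpair (pair x y) = (x, y) := by
  induction x with
  | nil => simp [pair, unpair]
  | cons b x ih =>
    have h : pair (b :: x) y = true :: b :: pair x y := by simp [pair]
    rw [h, unpair, ih]

/-- A function of the security parameter is negligible if it is eventually below the inverse of
every polynomial. -/
def Negligible (ε : ℕ → ℝ≥0∞) : Prop :=
  ∀ c : ℕ, ∀ᶠ n : ℕ in Filter.atTop, ε n < ((n : ℝ≥0∞) ^ c)⁻¹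

/-! ### Quantum memory

The memory has one qubit for every natural number. A computational basis state with finitely many
ones is the finite set of the qubits that are `1`; a state is a finite superposition of these. -/

/-- Superpositions of basis states. -/
abbrev QState : Type := Finset ℕ →₀ ℂ

/-- The basis state `|s⟩`. -/
def ket (s : Finset ℕ) : QState := Finsupp.single s 1

/-- The basis state `s` with qubit `i` set to `b`. -/
def setQubit (i : ℕ) (b : Bool) (s : Finset ℕ) : Finset ℕ :=
  if b then insert i s else s.erase i

/-- A universal set of gates. -/
inductive Gate
  | hadamard
  | phase
  | piOverEight
  | cnot

/-- The action on basis states. One-qubit gates act on qubit `i`; `cnot` has control `i` and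
target `j` (and does nothing if `i = j`). -/
def Gate.onBasis (g : Gate) (i j : ℕ) (s : Finset ℕ) : QState :=
  match g with
  | .hadamard =>
      ((Real.sqrt 2 : ℂ)⁻¹) •
        (ket (setQubit i false s) + (if i ∈ s then (-1 : ℂ) else 1) • ket (setQubit i true s))
  | .phase => (if i ∈ s then Complex.I else 1) • ket s
  | .piOverEight => (if i ∈ s then Complex.exp (Complex.I * (Real.pi / 4 : ℂ)) else 1) • ket s
  | .cnot => if i ∈ s ∧ i ≠ j then ket (setQubit j (decide (j ∉ s)) s) else ket s

/-- The linear extension of `Gate.onBasis`. -/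
def Gate.apply (g : Gate) (i j : ℕ) (ψ : QState) : QState :=
  ψ.sum fun s a => a • g.onBasis i j s

/-- The part of `ψ` in which qubit `i` has the value `b`. -/
def project (i : ℕ) (b : Bool) (ψ : QState) : QState :=
  ψ.filter fun s => decide (i ∈ s) = b

/-- The squared Euclidean norm. -/
def weight (ψ : QState) : ℝ≥0 := ∑ s ∈ ψ.support, ‖ψ s‖₊ ^ 2

/-- The probability that measuring qubit `i` yields `1`. -/
def measProb (i : ℕ) (ψ : QState) : ℝ≥0 :=
  weight (project i true ψ) / (weight (project i false ψ) + weight (project i true ψ))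

theorem measProb_le_one (i : ℕ) (ψ : QState) : measProb i ψ ≤ 1 :=
  div_le_one_of_le₀ le_add_self zero_le

/-- The outcome of measuring qubit `i` in the computational basis. -/
def measOutcome (i : ℕ) (ψ : QState) : PMF Bool :=
  PMF.ofFintype (fun b => if b then (measProb i ψ : ℝ≥0∞) else 1 - (measProb i ψ : ℝ≥0∞)) (by
    have h : (measProb i ψ : ℝ≥0∞) ≤ 1 := by exact_mod_cast measProb_le_one i ψ
    simp [add_tsub_cancel_of_le h])

/-- The normalized state after the outcome `b`. -/
def collapse (i : ℕ) (b : Bool) (ψ : QState) : QState :=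
  ((Real.sqrt (weight (project i b ψ)) : ℂ)⁻¹) • project i b ψ

/-! ### Programs

Algorithms are programs of a small imperative language. Classical registers, indexed by `ℕ`, hold
bit strings; there are coin tosses, instructions that act on the quantum memory, and instructions
that ask the environment. Every operation is charged the lengths of all strings involved. -/

/-- Expressions over the classical registers. `first` is the one-bit initial segment, `eq` returns
the string `1` or the empty string. -/
inductive Expr
  | reg (i : ℕ)
  | empty
  | push (b : Bool) (e : Expr)
  | first (e : Expr)
  | tail (e : Expr)
  | eq (e d : Expr)
  | pair (e d : Expr)
  | fst (e : Expr)
  | snd (e : Expr)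

/-- Contents of the classical registers. -/
abbrev Mem : Type := ℕ → List Bool

def Expr.eval (μ : Mem) : Expr → List Bool
  | .reg i => μ i
  | .empty => []
  | .push b e => b :: e.eval μ
  | .first e => (e.eval μ).take 1
  | .tail e => (e.eval μ).drop 1
  | .eq e d => if e.eval μ = d.eval μ then [true] else []
  | .pair e d => TimedId.pair (e.eval μ) (d.eval μ)
  | .fst e => (unpair (e.eval μ)).1
  | .snd e => (unpair (e.eval μ)).2

/-- The time for evaluating an expression: one plus the length of its value, added up over all
its subexpressions. -/
def Expr.cost (μ : Mem) : Expr → ℕ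
  | .reg i => 1 + (μ i).length
  | .empty => 1
  | .push b e => e.cost μ + (1 + ((Expr.push b e).eval μ).length)
  | .first e => e.cost μ + (1 + ((Expr.first e).eval μ).length)
  | .tail e => e.cost μ + (1 + ((Expr.tail e).eval μ).length)
  | .eq e d => e.cost μ + d.cost μ + (1 + ((Expr.eq e d).eval μ).length)
  | .pair e d => e.cost μ + d.cost μ + (1 + ((Expr.pair e d).eval μ).length)
  | .fst e => e.cost μ + (1 + ((Expr.fst e).eval μ).length)
  | .snd e => e.cost μ + (1 + ((Expr.snd e).eval μ).length)

/-- What a program can ask the environment: a hash value of the (encoded) pair of a key and a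
message; a fresh session with the honest prover; the honest prover's reply to a message; the
verifier's reply to a message. -/
inductive Port
  | hash
  | session
  | prover
  | verifier

/-- Programs. `ask i p e` sends the value of `e` to port `p` and stores the reply in register `i`.
`gate g e d` acts on the qubits whose numbers are the lengths of `e` and `d`; `measure i e` stores
the measured bit in register `i`. A test succeeds if the string is not empty. -/
inductive Cmd
  | skip
  | assign (i : ℕ) (e : Expr)
  | coin (i : ℕ)
  | ask (i : ℕ) (p : Port) (e : Expr)
  | gate (g : Gate) (e d : Expr)
  | measure (i : ℕ) (e : Expr)
  | seq (c d : Cmd)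
  | cond (e : Expr) (c d : Cmd)
  | loop (e : Expr) (c : Cmd)

/-- Programs without quantum instructions. -/
def Cmd.IsClassical : Cmd → Prop
  | .gate _ _ _ => False
  | .measure _ _ => False
  | .seq c d => c.IsClassical ∧ d.IsClassical
  | .cond _ c d => c.IsClassical ∧ d.IsClassical
  | .loop _ c => c.IsClassical
  | _ => True

/-- A running program: the commands still to be executed, the memories, the state of the
environment, and the time spent so far. -/
structure Config (E : Type) where
  todo : List Cmd
  mem : Mem
  qmem : QState
  env : E
  time : ℕ

/-- An environment with states `E`. -/
abbrev Handler (E : Type) : Type := Port → List Bool → E → PMF (List Bool × E)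

/-- One step of a program. -/
def step {E : Type} (h : Handler E) (c : Config E) : PMF (Config E) :=
  match c.todo with
  | [] => PMF.pure c
  | .skip :: K => PMF.pure { c with todo := K, time := c.time + 1 }
  | .assign i e :: K =>
      PMF.pure { c with
        todo := K
        mem := Function.update c.mem i (e.eval c.mem)
        time := c.time + 1 + e.cost c.mem }
  | .coin i :: K =>
      (PMF.uniformOfFintype Bool).map fun b =>
        { c with todo := K, mem := Function.update c.mem i [b], time := c.time + 1 }
  | .ask i p e :: K =>
      (h p (e.eval c.mem) c.env).map fun a =>
        { c with
          todo := K
          mem := Function.update c.mem i a.1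
          env := a.2
          time := c.time + 1 + e.cost c.mem + a.1.length }
  | .gate g e d :: K =>
      PMF.pure { c with
        todo := K
        qmem := g.apply (e.eval c.mem).length (d.eval c.mem).length c.qmem
        time := c.time + 1 + e.cost c.mem + d.cost c.mem }
  | .measure i e :: K =>
      (measOutcome (e.eval c.mem).length c.qmem).map fun b =>
        { c with
          todo := K
          mem := Function.update c.mem i [b]
          qmem := collapse (e.eval c.mem).length b c.qmem
          time := c.time + 1 + e.cost c.mem }
  | .seq a b :: K => PMF.pure { c with todo := a :: b :: K, time := c.time + 1 }
  | .cond e a b :: K =>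
      PMF.pure { c with
        todo := (if e.eval c.mem = [] then b else a) :: K
        time := c.time + 1 + e.cost c.mem }
  | .loop e a :: K =>
      PMF.pure { c with
        todo := if e.eval c.mem = [] then K else a :: .loop e a :: K
        time := c.time + 1 + e.cost c.mem }

/-- At most `m` steps, none of which starts at time `B` or later. -/
def runSteps {E : Type} (h : Handler E) (B : ℕ) : ℕ → Config E → PMF (Config E)
  | 0, c => PMF.pure c
  | m + 1, c =>
      open Classical in
      if c.todo = [] ∨ B ≤ c.time then PMF.pure c else (step h c).bind (runSteps h B m)

/-- Run the program `p` on the given registers, all qubits being `0`, until it halts or the time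
`B` is used up. Every step takes time at least one, so that `B` steps suffice. -/
def run {E : Type} (h : Handler E) (B : ℕ) (p : Cmd) (μ : Mem) (e : E) : PMF (Config E) :=
  runSteps h B B { todo := [p], mem := μ, qmem := ket ∅, env := e, time := 0 }

/-- Registers `0`, `1`, `2` hold the inputs, all others are empty. -/
def inputs (x y z : List Bool) : Mem := fun i =>
  match i with
  | 0 => x
  | 1 => y
  | 2 => z
  | _ => []

/-! ### Hash functions and random oracles -/

/-- A keyed hash function, `H k M`. -/
abbrev Hash : Type := List Bool → List Bool → List Bool

/-- The environment that offers nothing but the hash function. -/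
def hashHandler (H : Hash) : Handler Unit := fun p x u =>
  match p with
  | .hash => PMF.pure (H (unpair x).1 (unpair x).2, u)
  | _ => PMF.pure ([], u)

/-- The absent oracle: every query is answered by the empty string. -/
def noOracle : Hash := fun _ _ => []

/-- A table of `n`-bit digests for all pairs of a key and a message. -/
abbrev Table (n : ℕ) : Type := List Bool × List Bool → (Fin n → Bool)

def Table.hash {n : ℕ} (ω : Table n) : Hash := fun k M => List.ofFn (ω (k, M))

/-- The law of the random oracle: the digests of all pairs are independent and uniform. -/
def randomOracle (n : ℕ) : Measure (Table n) :=
  Measure.infinitePi fun _ => (PMF.uniformOfFintype (Fin n → Bool)).toMeasure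

/-! ### Identification schemes -/

/-- An identification scheme. `keyGen n` returns the secret and the public key. Prover and verifier
are interactive probabilistic machines; the prover speaks first (possibly with the empty message,
its own first input being empty too), and the verifier answers each message either with a message
or with its decision bit. -/
structure IdScheme where
  PState : Type
  VState : Type
  keyGen : ℕ → PMF (List Bool × List Bool)
  pk_poly : ∃ p : Polynomial ℕ, ∀ n, ∀ k ∈ (keyGen n).support, k.2.length ≤ p.eval n
  proverInit : ℕ → List Bool → List Bool → PMF PState
  proverStep : PState → List Bool → PMF (PState × List Bool)
  verifierInit : ℕ → List Bool → PMF VState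
  verifierStep : VState → List Bool → PMF (VState × (List Bool ⊕ Bool))

/-- An identification scheme whose parties have access to a hash function and whose verifier has a
clock: with each message it is told the time since its own last message, in units of the time of
one hash evaluation. -/
structure TimedIdScheme where
  PState : Type
  VState : Type
  keyGen : ℕ → PMF (List Bool × List Bool)
  proverInit : ℕ → List Bool → List Bool → PMF PState
  proverStep : Hash → PState → List Bool → PMF (PState × List Bool)
  verifierInit : ℕ → List Bool → PMF VState
  verifierStep : Hash → VState → ℝ → List Bool → PMF (VState × (List Bool ⊕ Bool))

/-- An ordinary scheme uses neither the hash function nor the clock. -/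
def IdScheme.toTimed (S : IdScheme) : TimedIdScheme where
  PState := S.PState
  VState := S.VState
  keyGen := S.keyGen
  proverInit := S.proverInit
  proverStep := fun _ => S.proverStep
  verifierInit := S.verifierInit
  verifierStep := fun _ s _ => S.verifierStep s

/-! ### The impersonation game -/

/-- What has become of the verifier: not yet contacted, active, or finished with a decision. -/
inductive VStatus (V : Type)
  | idle
  | active (s : V)
  | done (b : Bool)

def VStatus.accepted {V : Type} : VStatus V → Bool
  | .done b => b
  | _ => false

/-- `queries` counts the adversary's hash evaluations since the verifier's last message. -/
structure GameState (S : TimedIdScheme) where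
  session : Option S.PState
  verifier : VStatus S.VState
  queries : ℕ

/-- The adversary's message `m` reaches the active verifier. On a machine with parallel speed-up
`α`, `q` hash evaluations take time `q / α`; nothing else takes time. -/
def askVerifier (S : TimedIdScheme) (α : ℝ) (H : Hash) (g : GameState S) (s : S.VState)
    (m : List Bool) : PMF (List Bool × GameState S) :=
  (S.verifierStep H s ((g.queries : ℝ) / α) m).map fun a =>
    match a.2 with
    | .inl reply => (reply, { g with verifier := .active a.1, queries := 0 })
    | .inr b => ([b], { g with verifier := .done b, queries := 0 })

/-- The environment of an adversary. As long as it has not contacted the verifier, the adversary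
can run sessions with the honest prover, as many as it likes one after the other, playing the
verifier in an arbitrary way. Its first message to the verifier ends this phase and starts the
only impersonation attempt. -/
def gameHandler (S : TimedIdScheme) (α : ℝ) (n : ℕ) (sk pk : List Bool) (H : Hash) :
    Handler (GameState S) := fun p x g =>
  match p with
  | .hash => PMF.pure (H (unpair x).1 (unpair x).2, { g with queries := g.queries + 1 })
  | .session =>
      match g.verifier with
      | .idle => (S.proverInit n sk pk).map fun s => ([], { g with session := some s })
      | _ => PMF.pure ([], g)
  | .prover =>
      match g.verifier, g.session with
      | .idle, some s => (S.proverStep H s x).map fun a => (a.2, { g with session := some a.1 })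
      | _, _ => PMF.pure ([], g)
  | .verifier =>
      match g.verifier with
      | .idle => (S.verifierInit n pk).bind fun s => askVerifier S α H g s x
      | .active s => askVerifier S α H g s x
      | .done _ => PMF.pure ([], g)

/-- An efficient adversary: a program, a polynomial time bound after which it is stopped, and
advice of polynomial length. -/
structure Adversary where
  prog : Cmd
  time : Polynomial ℕ
  advice : ℕ → List Bool
  advice_poly : ∃ p : Polynomial ℕ, ∀ n, (advice n).length ≤ p.eval n

/-- The computational power of adversaries: with or without quantum memory, and with or without
advice (non-uniform or uniform adversaries). -/
structure Power where
  quantum : Bool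
  nonuniform : Bool

def Adversary.HasPower (A : Adversary) (P : Power) : Prop :=
  (P.quantum = false → A.prog.IsClassical) ∧ (P.nonuniform = false → ∀ n, A.advice n = [])

/-- The probability that `A`, on input `1^n`, the public key, and its advice, makes the verifier
accept, for a fixed hash function. -/
def TimedIdScheme.advantage (S : TimedIdScheme) (α : ℝ) (A : Adversary) (n : ℕ) (H : Hash) :
    ℝ≥0∞ :=
  (((S.keyGen n).bind fun k =>
    run (gameHandler S α n k.1 k.2 H) (A.time.eval n) A.prog (inputs (unary n) k.2 (A.advice n))
      { session := none, verifier := .idle, queries := 0 }).map fun c => c.env.verifier.accepted) true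

/-- Security of an ordinary identification scheme (without any oracle). -/
def IdScheme.Secure (S : IdScheme) (P : Power) : Prop :=
  ∀ A : Adversary, A.HasPower P → Negligible fun n => S.toTimed.advantage 1 A n noOracle

/-- Security in the random oracle model, with classical access to the oracle, against adversaries
whose parallel speed-up is at most `α`. -/
def TimedIdScheme.SecureInROM (S : TimedIdScheme) (α : ℝ) (P : Power) : Prop :=
  ∀ A : Adversary, A.HasPower P →
    Negligible fun n => ∫⁻ ω, S.advantage α A n ω.hash ∂(randomOracle n)

/-! ### The augmented protocol -/

/-- `1^n ↦ 1^(f n)` is computable in polynomial time. -/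
def PolyTimeComputable (f : ℕ → ℕ) : Prop :=
  ∃ (p : Cmd) (t : Polynomial ℕ), p.IsClassical ∧
    ∀ n, ∀ c ∈ (run (hashHandler noOracle) (t.eval n) p (inputs (unary n) [] []) ()).support,
      c.todo = [] ∧ c.mem 0 = unary (f n)

/-- The strategy of the honest prover in a collision round: any classical program with access to
the hash function that halts in polynomial time. Its inputs are `1^n`, the public key and the
round key, its output is in register `0`. -/
structure Searcher where
  prog : Cmd
  classical : prog.IsClassical
  time : Polynomial ℕ
  halts : ∀ (n : ℕ) (ω : Table n) (pk k : List Bool),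
    ∀ c ∈ (run (hashHandler ω.hash) (time.eval (n + pk.length + k.length)) prog
      (inputs (unary n) pk k) ()).support, c.todo = []

def Searcher.respond (F : Searcher) (H : Hash) (n : ℕ) (pk k : List Bool) : PMF (List Bool) :=
  (run (hashHandler H) (F.time.eval (n + pk.length + k.length)) F.prog
    (inputs (unary n) pk k) ()).map fun c => c.mem 0

/-- The verifier's time limit for one round: it evaluates the hash function
`⌈(2^ℓ)^(1/3)⌉` times. -/
def timeLimit (ℓ : ℕ) : ℕ := ⌈((2 : ℝ) ^ ℓ) ^ (1 / 3 : ℝ)⌉₊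

/-- A response in time with two distinct messages whose digests under the round key `k` agree in
the leading `ℓ` bits. -/
def RoundWon (ℓ : ℕ) (H : Hash) (k : List Bool) (elapsed : ℝ) (m : List Bool) : Prop :=
  (unpair m).1 ≠ (unpair m).2 ∧
    (H k (unpair m).1).take ℓ = (H k (unpair m).2).take ℓ ∧ elapsed ≤ timeLimit ℓ

/-- `round` is the number of messages sent so far, up to `r + 1`. -/
structure AugPState (P : Type) where
  n : ℕ
  pk : List Bool
  round : ℕ
  inner : P

/-- `round` is the number of messages sent so far, up to `r + 1`; `key` is the current round key;
`collCount` is the number of rounds won by the prover; `inner` is the state of the given scheme's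
verifier once it has been started. -/
structure AugVState (V : Type) where
  n : ℕ
  pk : List Bool
  round : ℕ
  key : List Bool
  collCount : ℕ
  inner : Option V

/-- The augmented scheme. The public key is `(pk, ℓ)`. After an empty opening message of the prover
there are `r` rounds, in each of which the verifier sends a fresh uniform `n`-bit key and gets one
response; the verifier answers the last response by an empty message. Then the given scheme is run,
and the verifier accepts if it accepts there or if at least `r / 4` rounds have been won. The
verifier's hash evaluations for timekeeping have no effect besides the time limit. -/
def IdScheme.augment (S : IdScheme) (F : Searcher) (ℓ r : ℕ → ℕ) : TimedIdScheme where
  PState := AugPState S.PState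
  VState := AugVState S.VState
  keyGen := fun n => (S.keyGen n).map fun k => (k.1, pair k.2 (unary (ℓ n)))
  proverInit := fun n sk pk =>
    (S.proverInit n sk (unpair pk).1).map fun s => { n := n, pk := pk, round := 0, inner := s }
  proverStep := fun H s m =>
    if s.round = 0 then PMF.pure ({ s with round := 1 }, [])
    else if s.round ≤ r s.n then
      (F.respond H s.n s.pk m).map fun a => ({ s with round := s.round + 1 }, a)
    else
      (S.proverStep s.inner m).map fun a => ({ s with inner := a.1 }, a.2)
  verifierInit := fun n pk =>
    PMF.pure { n := n, pk := pk, round := 0, key := [], collCount := 0, inner := none }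
  verifierStep := fun H s elapsed m =>
    open Classical in
    if s.round ≤ r s.n then
      let count :=
        if 0 < s.round ∧ RoundWon (ℓ s.n) H s.key elapsed m then s.collCount + 1 else s.collCount
      if s.round < r s.n then
        (PMF.uniformOfFintype (Fin s.n → Bool)).map fun v =>
          ({ s with round := s.round + 1, key := List.ofFn v, collCount := count },
            .inl (List.ofFn v))
      else PMF.pure ({ s with round := s.round + 1, collCount := count }, .inl [])
    else
      let start : PMF S.VState :=
        match s.inner with
        | some v => PMF.pure v
        | none => S.verifierInit s.n (unpair s.pk).1
      (start.bind fun v => S.verifierStep v m).map fun a =>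
        ({ s with inner := some a.1 },
          match a.2 with
          | .inl reply => .inl reply
          | .inr b => .inr (b || decide (r s.n ≤ 4 * s.collCount)))

end TimedId

end

/-!
An impersonator of the augmented scheme must be accepted by the given scheme's verifier or win a
quarter of the collision rounds. `lintegral_advantage_le` splits its chance accordingly, and the two
parts are bounded separately. Both bounds are about the game in which the random oracle is sampled
lazily: digests are drawn when they are first needed and kept in a `Cache`, which has the same
effect as drawing the whole table in advance (`OComp.lintegral_eval`).

*The collision stage.* Within the time limit, about `2 ^ (ℓ / 3)`, an adversary with speed-up `α`
makes at most `Q`, about `α * 2 ^ (ℓ / 3)`, hash evaluations between receiving a round key and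
replying. Old digests are of no use unless the key was guessed, which has probability about
`2 ^ (-n)` per digest. By the birthday bound a round is won with probability at most
`(1 + Q (Q - 1) / 2) / 2 ^ ℓ`, and this is at most `27 / 128` because `2 ^ (ℓ / 6) ≥ 2 α`
(`winBound_le_const`). Since rounds depend on each other through the adversary and the cache, the
Chernoff bound is proved with an exponential potential that no request of the adversary increases in
expectation (`expect_potential_le`). As each round is won with probability at most
`27 / 128 + 1 / 128 < 1 / 4`, winning a quarter of the `r` rounds has probability exponentially small
in `r` (`value_collisionAccepted_le`), which is negligible since `r` grows faster than `log n`.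

*The given scheme's part.* An adversary against the augmented scheme is turned into one against the
given scheme. It computes the parameters `ℓ` and `r`, runs the adversary's program, samples the
random oracle lazily, plays the honest prover in collision rounds by running its program (which does
not need the secret key), plays the verifier's collision stage, and forwards everything else. That
stage has no influence on the decision of the given scheme's verifier, hence the reduction
succeeds with the same chance (`exists_reduction`). The reduction uses quantum instructions only
where the adversary does, and its advice is the adversary's. Its work consists in compiling programs
into programs: `expect_runSteps_le_value_compile` says that a program whose requests are replaced by
programs that answer them equally well does at least as well as the original one, within a time
bound. It is used for the adversary, for the honest prover, and for the programs that compute the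
parameters. `value h B f c` is the expected value of `f` in the environment after running the
configuration `c` for time `B`, and the lemmas `le_value_*` are rules for bounding it from below
command by command.
-/

noncomputable section

namespace TimedId

/-! ### Expectations over discrete distributions -/

/-- The expectation of a nonnegative function under a discrete distribution. -/
def expect {β : Type} (p : PMF β) (f : β → ℝ≥0∞) : ℝ≥0∞ := ∑' a, p a * f a

section Expect

variable {β γ : Type}

theorem expect_pure (a : β) (f : β → ℝ≥0∞) : expect (PMF.pure a) f = f a := by
  classical
  unfold expect
  rw [tsum_eq_single a]
  · simp
  · intro b hb
    simp [PMF.pure_apply, hb]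

theorem expect_bind (p : PMF β) (k : β → PMF γ) (f : γ → ℝ≥0∞) :
    expect (p.bind k) f = expect p fun a => expect (k a) f := by
  unfold expect
  simp only [PMF.bind_apply, ← ENNReal.tsum_mul_right, ← ENNReal.tsum_mul_left]
  rw [ENNReal.tsum_comm]
  simp only [mul_assoc]

theorem expect_map (p : PMF β) (g : β → γ) (f : γ → ℝ≥0∞) :
    expect (p.map g) f = expect p fun a => f (g a) := by
  rw [PMF.map, expect_bind]
  simp only [Function.comp, expect_pure]

theorem expect_mono {p : PMF β} {f g : β → ℝ≥0∞} (h : ∀ a ∈ p.support, f a ≤ g a) :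
    expect p f ≤ expect p g := by
  refine ENNReal.tsum_le_tsum fun a => ?_
  by_cases ha : p a = 0
  · simp [ha]
  · exact mul_le_mul_right (h a ((PMF.mem_support_iff _ _).2 ha)) _

theorem expect_congr {p : PMF β} {f g : β → ℝ≥0∞} (h : ∀ a ∈ p.support, f a = g a) :
    expect p f = expect p g :=
  le_antisymm (expect_mono fun a ha => (h a ha).le) (expect_mono fun a ha => (h a ha).ge)

open Classical in
theorem expect_eq_ite (p : PMF β) (f : β → ℝ≥0∞) :
    expect p f = expect p fun a => if a ∈ p.support then f a else 0 :=
  expect_congr fun _ ha => (if_pos ha).symm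

theorem expect_const (p : PMF β) (c : ℝ≥0∞) : expect p (fun _ => c) = c := by
  unfold expect
  rw [ENNReal.tsum_mul_right, p.tsum_coe, one_mul]

theorem expect_le {p : PMF β} {f : β → ℝ≥0∞} {c : ℝ≥0∞} (h : ∀ a ∈ p.support, f a ≤ c) :
    expect p f ≤ c :=
  (expect_mono h).trans (expect_const p c).le

theorem le_expect {p : PMF β} {f : β → ℝ≥0∞} {c : ℝ≥0∞} (h : ∀ a ∈ p.support, c ≤ f a) :
    c ≤ expect p f :=
  (expect_const p c).ge.trans (expect_mono h)

theorem expect_add (p : PMF β) (f g : β → ℝ≥0∞) :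
    expect p (fun a => f a + g a) = expect p f + expect p g := by
  unfold expect
  simp only [mul_add, ENNReal.tsum_add]

theorem expect_const_mul (p : PMF β) (c : ℝ≥0∞) (f : β → ℝ≥0∞) :
    expect p (fun a => c * f a) = c * expect p f := by
  unfold expect
  rw [← ENNReal.tsum_mul_left]
  exact tsum_congr fun a => mul_left_comm _ _ _

theorem expect_uniform [Fintype β] [Nonempty β] (f : β → ℝ≥0∞) :
    expect (PMF.uniformOfFintype β) f = (Fintype.card β : ℝ≥0∞)⁻¹ * ∑ a, f a := by
  unfold expect
  simp only [PMF.uniformOfFintype_apply, tsum_fintype, Finset.mul_sum]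

theorem expect_ite_eq_map_apply (p : PMF β) (a : β → Bool) :
    (p.map a) true = expect p fun x => if a x then 1 else 0 := by
  unfold expect
  rw [PMF.map_apply]
  refine tsum_congr fun x => ?_
  cases h : a x <;> simp [h]

end Expect

/-! ### Running a program -/

section Running

variable {E : Type}

theorem step_time_lt (h : Handler E) (c : Config E) (hc : c.todo ≠ []) :
    ∀ c' ∈ (step h c).support, c.time + 1 ≤ c'.time := by
  intro c' hc'
  obtain ⟨todo, μ, ψ, e, t⟩ := c
  cases todo with
  | nil => exact absurd rfl hc
  | cons p K =>
    cases p <;> simp only [step, PMF.support_pure, Set.mem_singleton_iff, PMF.mem_support_map_iff]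
      at hc'
    case ask =>
      obtain ⟨a, _, rfl⟩ := hc'
      simp only
      omega
    case coin =>
      obtain ⟨a, _, rfl⟩ := hc'
      simp only
      omega
    case measure =>
      obtain ⟨a, _, rfl⟩ := hc'
      simp only
      omega
    all_goals
      subst hc'
      simp only
      omega

theorem runSteps_of_todo_nil (h : Handler E) (B m : ℕ) (c : Config E) (hc : c.todo = []) :
    runSteps h B m c = PMF.pure c := by
  cases m <;> simp [runSteps, hc]

theorem runSteps_of_le_time (h : Handler E) (B m : ℕ) (c : Config E) (hc : B ≤ c.time) :
    runSteps h B m c = PMF.pure c := by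
  cases m <;> simp [runSteps, hc]

theorem runSteps_succ (h : Handler E) (B m : ℕ) (c : Config E) (h1 : c.todo ≠ [])
    (h2 : c.time < B) : runSteps h B (m + 1) c = (step h c).bind (runSteps h B m) := by
  rw [runSteps, if_neg]
  rintro (h' | h')
  · exact h1 h'
  · omega

/-- Since every step takes time, the number of steps allowed is irrelevant once it covers the
remaining time. -/
theorem runSteps_saturated (h : Handler E) (B m : ℕ) (c : Config E) (hm : B ≤ m + c.time) :
    runSteps h B (m + 1) c = runSteps h B m c := by
  induction m generalizing c with
  | zero =>
    rw [runSteps_of_le_time _ _ _ _ (by omega), runSteps_of_le_time _ _ _ _ (by omega)]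
  | succ m ih =>
    by_cases h1 : c.todo = []
    · rw [runSteps_of_todo_nil _ _ _ _ h1, runSteps_of_todo_nil _ _ _ _ h1]
    by_cases h2 : B ≤ c.time
    · rw [runSteps_of_le_time _ _ _ _ h2, runSteps_of_le_time _ _ _ _ h2]
    rw [runSteps_succ _ _ _ _ h1 (by omega), runSteps_succ _ _ _ _ h1 (by omega)]
    ext x
    rw [PMF.bind_apply, PMF.bind_apply]
    refine tsum_congr fun c' => ?_
    by_cases hc' : c' ∈ (step h c).support
    · rw [ih c' (by have := step_time_lt h c h1 c' hc'; omega)]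
    · rw [(PMF.apply_eq_zero_iff _ _).2 hc', zero_mul, zero_mul]

/-- The expectation of `f` of the final state of the environment, for a program that is stopped at
time `B`. -/
def value (h : Handler E) (B : ℕ) (f : E → ℝ≥0∞) (c : Config E) : ℝ≥0∞ :=
  expect (runSteps h B B c) fun c => f c.env

variable {h : Handler E} {B : ℕ} {f : E → ℝ≥0∞}

theorem value_step {c : Config E} (h1 : c.todo ≠ []) (h2 : c.time < B) :
    value h B f c = expect (step h c) (value h B f) := by
  obtain ⟨b, rfl⟩ : ∃ b, B = b + 1 := ⟨B - 1, by omega⟩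
  unfold value
  rw [runSteps_succ _ _ _ _ h1 h2, expect_bind]
  refine expect_congr fun c' hc' => ?_
  rw [runSteps_saturated _ _ _ _ (by have := step_time_lt h c h1 c' hc'; omega)]

section Rules

variable {X : ℝ≥0∞} {K : List Cmd} {μ : Mem} {ψ : QState} {e : E} {t : ℕ}

theorem le_value_skip (hB : t < B) (H : X ≤ value h B f ⟨K, μ, ψ, e, t + 1⟩) :
    X ≤ value h B f ⟨.skip :: K, μ, ψ, e, t⟩ := by
  rw [value_step (by simp) hB]
  simpa only [step, expect_pure] using H

theorem le_value_assign {i : ℕ} {x : Expr} (C : ℕ) (hC : x.cost μ ≤ C) (hB : t < B)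
    (H : ∀ t' ≤ t + 1 + C, X ≤ value h B f ⟨K, Function.update μ i (x.eval μ), ψ, e, t'⟩) :
    X ≤ value h B f ⟨.assign i x :: K, μ, ψ, e, t⟩ := by
  rw [value_step (by simp) hB]
  simpa only [step, expect_pure] using H _ (by omega)

theorem le_value_coin {i : ℕ} (hB : t < B) {g : Bool → ℝ≥0∞}
    (H : ∀ b, g b ≤ value h B f ⟨K, Function.update μ i [b], ψ, e, t + 1⟩) :
    expect (PMF.uniformOfFintype Bool) g ≤ value h B f ⟨.coin i :: K, μ, ψ, e, t⟩ := by
  rw [value_step (by simp) hB]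
  simp only [step, expect_map]
  exact expect_mono fun b _ => H b

theorem value_ask {i : ℕ} {p : Port} {x : Expr} (hB : t < B) :
    value h B f ⟨.ask i p x :: K, μ, ψ, e, t⟩ = expect (h p (x.eval μ) e) fun a =>
      value h B f ⟨K, Function.update μ i a.1, ψ, a.2, t + 1 + x.cost μ + a.1.length⟩ := by
  rw [value_step (by simp) hB]
  simp only [step, expect_map]

theorem le_value_gate {g : Gate} {x y : Expr} (C : ℕ) (hC : x.cost μ + y.cost μ ≤ C) (hB : t < B)
    (H : ∀ t' ≤ t + 1 + C,
      X ≤ value h B f ⟨K, μ, g.apply (x.eval μ).length (y.eval μ).length ψ, e, t'⟩) :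
    X ≤ value h B f ⟨.gate g x y :: K, μ, ψ, e, t⟩ := by
  rw [value_step (by simp) hB]
  simpa only [step, expect_pure] using H _ (by omega)

theorem le_value_measure {i : ℕ} {x : Expr} (C : ℕ) (hC : x.cost μ ≤ C) (hB : t < B)
    {g : Bool → ℝ≥0∞}
    (H : ∀ b ∈ (measOutcome (x.eval μ).length ψ).support, ∀ t' ≤ t + 1 + C, g b ≤ value h B f
      ⟨K, Function.update μ i [b], collapse (x.eval μ).length b ψ, e, t'⟩) :
    expect (measOutcome (x.eval μ).length ψ) g ≤ value h B f ⟨.measure i x :: K, μ, ψ, e, t⟩ := by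
  rw [value_step (by simp) hB]
  simp only [step, expect_map]
  exact expect_mono fun b hb => H b hb _ (by omega)

theorem le_value_seq {a b : Cmd} (hB : t < B)
    (H : X ≤ value h B f ⟨a :: b :: K, μ, ψ, e, t + 1⟩) :
    X ≤ value h B f ⟨.seq a b :: K, μ, ψ, e, t⟩ := by
  rw [value_step (by simp) hB]
  simpa only [step, expect_pure] using H

theorem le_value_cond {x : Expr} {a b : Cmd} (C : ℕ) (hC : x.cost μ ≤ C) (hB : t < B)
    (H : ∀ t' ≤ t + 1 + C,
      X ≤ value h B f ⟨(if x.eval μ = [] then b else a) :: K, μ, ψ, e, t'⟩) :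
    X ≤ value h B f ⟨.cond x a b :: K, μ, ψ, e, t⟩ := by
  rw [value_step (by simp) hB]
  simpa only [step, expect_pure] using H _ (by omega)

theorem le_value_loop {x : Expr} {a : Cmd} (C : ℕ) (hC : x.cost μ ≤ C) (hB : t < B)
    (H : ∀ t' ≤ t + 1 + C,
      X ≤ value h B f ⟨if x.eval μ = [] then K else a :: .loop x a :: K, μ, ψ, e, t'⟩) :
    X ≤ value h B f ⟨.loop x a :: K, μ, ψ, e, t⟩ := by
  rw [value_step (by simp) hB]
  simpa only [step, expect_pure] using H _ (by omega)

end Rules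

/-! ### Invariants of runs -/

theorem step_env_invariant {P : E → Prop} (hP : ∀ p x e, P e → ∀ a ∈ (h p x e).support, P a.2)
    (c : Config E) (hc : P c.env) : ∀ c' ∈ (step h c).support, P c'.env := by
  intro c' hc'
  obtain ⟨todo, μ, ψ, e, t⟩ := c
  cases todo with
  | nil =>
    simp only [step, PMF.support_pure, Set.mem_singleton_iff] at hc'
    subst hc'
    exact hc
  | cons p K =>
    cases p <;> simp only [step, PMF.support_pure, Set.mem_singleton_iff, PMF.mem_support_map_iff]
      at hc'
    case ask i p x =>
      obtain ⟨a, ha, rfl⟩ := hc'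
      exact hP _ _ _ hc a ha
    case coin =>
      obtain ⟨a, _, rfl⟩ := hc'
      exact hc
    case measure =>
      obtain ⟨a, _, rfl⟩ := hc'
      exact hc
    all_goals
      subst hc'
      exact hc

/-- A property preserved by every step holds at the end of the run. -/
theorem runSteps_induction {P : Config E → Prop}
    (hP : ∀ c, P c → c.todo ≠ [] → c.time < B → ∀ c' ∈ (step h c).support, P c') (m : ℕ)
    (c : Config E) (hc : P c) : ∀ c' ∈ (runSteps h B m c).support, P c' := by
  induction m generalizing c with
  | zero =>
    intro c' hc'
    simp only [runSteps, PMF.support_pure, Set.mem_singleton_iff] at hc'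
    exact hc' ▸ hc
  | succ m ih =>
    by_cases h1 : c.todo = []
    · rw [runSteps_of_todo_nil _ _ _ _ h1]
      intro c' hc'
      simp only [PMF.support_pure, Set.mem_singleton_iff] at hc'
      exact hc' ▸ hc
    by_cases h2 : B ≤ c.time
    · rw [runSteps_of_le_time _ _ _ _ h2]
      intro c' hc'
      simp only [PMF.support_pure, Set.mem_singleton_iff] at hc'
      exact hc' ▸ hc
    rw [runSteps_succ _ _ _ _ h1 (by omega)]
    intro c' hc'
    obtain ⟨c₁, h₁, h₂⟩ := (PMF.mem_support_bind_iff _ _ _).1 hc'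
    exact ih c₁ (hP c hc h1 (by omega) c₁ h₁) c' h₂

theorem runSteps_env_invariant {P : E → Prop}
    (hP : ∀ p x e, P e → ∀ a ∈ (h p x e).support, P a.2) (m : ℕ) (c : Config E) (hc : P c.env) :
    ∀ c' ∈ (runSteps h B m c).support, P c'.env :=
  runSteps_induction (P := fun c => P c.env) (fun c hc _ _ => step_env_invariant hP c hc) m c hc

end Running

/-! ### Random oracle computations and lazy sampling -/

/-- A randomized computation with access to an oracle that maps a key and a message to an `n`-bit
digest. -/
inductive OComp (n : ℕ) (β : Type) : Type 1
  | ret (b : β)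
  | query (x : List Bool × List Bool) (k : (Fin n → Bool) → OComp n β)
  | samp (γ : Type) (p : PMF γ) (k : γ → OComp n β)

/-- The digests sampled so far; the first entry for a key and a message counts. -/
abbrev Cache (n : ℕ) : Type := List ((List Bool × List Bool) × (Fin n → Bool))

/-- The table `ω`, corrected at the entries of the cache. -/
def Cache.override {n : ℕ} (T : Cache n) (ω : Table n) : Table n :=
  fun x => (T.lookup x).getD (ω x)

/-- An environment that uses the oracle. -/
abbrev OHandler (n : ℕ) (E : Type) : Type 1 := Port → List Bool → E → OComp n (List Bool × E)

/-- The configuration with the state of the environment replaced by its image. -/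
def Config.mapEnv {E E' : Type} (φ : E → E') (c : Config E) : Config E' :=
  ⟨c.todo, c.mem, c.qmem, φ c.env, c.time⟩

namespace OComp

variable {n : ℕ} {β γ : Type}

/-- Sequential composition. -/
def bind : OComp n β → (β → OComp n γ) → OComp n γ
  | ret b, f => f b
  | query x k, f => query x fun v => (k v).bind f
  | samp δ p k, f => samp δ p fun a => (k a).bind f

/-- The distribution of the result for a given oracle. -/
def eval (ω : Table n) : OComp n β → PMF β
  | ret b => PMF.pure b
  | query x k => (k (ω x)).eval ω
  | samp _ p k => p.bind fun a => (k a).eval ω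

/-- The joint distribution of the result and the final cache if the digests are sampled when they
are asked for the first time. -/
def lazy : OComp n β → Cache n → PMF (β × Cache n)
  | ret b, T => PMF.pure (b, T)
  | query x k, T =>
    match T.lookup x with
    | some v => (k v).lazy T
    | none => (PMF.uniformOfFintype (Fin n → Bool)).bind fun v => (k v).lazy ((x, v) :: T)
  | samp _ p k, T => p.bind fun a => (k a).lazy T

theorem eval_bind (ω : Table n) (t : OComp n β) (f : β → OComp n γ) :
    (t.bind f).eval ω = (t.eval ω).bind fun b => (f b).eval ω := by
  induction t with
  | ret b => simp [bind, eval, PMF.pure_bind]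
  | query x k ih => simp [bind, eval, ih]
  | samp δ p k ih => simp [bind, eval, ih, PMF.bind_bind]

theorem lazy_bind (t : OComp n β) (f : β → OComp n γ) (T : Cache n) :
    (t.bind f).lazy T = (t.lazy T).bind fun a => (f a.1).lazy a.2 := by
  induction t generalizing T with
  | ret b => simp [bind, lazy, PMF.pure_bind]
  | query x k ih =>
    simp only [bind, lazy]
    split
    · exact ih _ _
    · simp only [ih, PMF.bind_bind]
  | samp δ p k ih => simp [bind, lazy, ih, PMF.bind_bind]

theorem lazy_query (x : List Bool × List Bool)
    (k : (Fin n → Bool) → OComp n β) (T : Cache n) :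
    (OComp.query x k).lazy T =
      ((OComp.query x fun v => OComp.ret v).lazy T).bind fun a => (k a.1).lazy a.2 :=
  lazy_bind (OComp.query x fun v => OComp.ret v) k T

/-- Lazy sampling extends the cache, and its results are possible for every table that agrees with
the final cache. -/
theorem lazy_support (t : OComp n β) (T : Cache n) :
    ∀ a ∈ (t.lazy T).support, (∀ x v, T.lookup x = some v → a.2.lookup x = some v) ∧
      ∀ ω, a.1 ∈ (t.eval (a.2.override ω)).support := by
  induction t generalizing T with
  | ret b =>
    intro a ha
    simp only [lazy, PMF.support_pure, Set.mem_singleton_iff] at ha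
    subst ha
    exact ⟨fun _ _ h => h, fun ω => by simp [eval]⟩
  | query x k ih =>
    intro a ha
    simp only [lazy] at ha
    split at ha
    · next v hv =>
      obtain ⟨h1, h2⟩ := ih _ _ a ha
      refine ⟨h1, fun ω => ?_⟩
      have : a.2.override ω x = v := by simp [Cache.override, h1 x v hv]
      simpa only [eval, this] using h2 ω
    · next hx =>
      obtain ⟨v, _, hv⟩ := (PMF.mem_support_bind_iff _ _ _).1 ha
      obtain ⟨h1, h2⟩ := ih _ _ a hv
      refine ⟨fun y w hy => h1 y w ?_, fun ω => ?_⟩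
      · have hne : y ≠ x := fun h => by simp [h, hx] at hy
        rw [List.lookup_cons, beq_false_of_ne hne]
        exact hy
      · have : a.2.override ω x = v := by simp [Cache.override, h1 x v (by simp)]
        simpa only [eval, this] using h2 ω
  | samp δ p k ih =>
    intro a ha
    obtain ⟨b, hb, hb'⟩ := (PMF.mem_support_bind_iff _ _ _).1 ha
    obtain ⟨h1, h2⟩ := ih b _ a hb'
    exact ⟨h1, fun ω => (PMF.mem_support_bind_iff _ _ _).2 ⟨b, hb, h2 ω⟩⟩

theorem measurable_expect_eval (t : OComp n β) (f : β → ℝ≥0∞) :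
    Measurable fun ω : Table n => expect (t.eval ω) f := by
  induction t with
  | ret b => simp [eval, expect_pure]
  | query x k ih =>
    have : (fun ω : Table n => expect ((query x k).eval ω) f) =
        fun ω => ∑ v, if ω x = v then expect ((k v).eval ω) f else 0 := by
      funext ω
      simp [eval]
    rw [this]
    refine Finset.measurable_sum _ fun v _ => Measurable.ite ?_ (ih v) measurable_const
    exact (measurable_pi_apply (X := fun _ : List Bool × List Bool => Fin n → Bool) x)
      (MeasurableSet.singleton v)
  | samp δ p k ih =>
    have : (fun ω : Table n => expect ((samp δ p k).eval ω) f) =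
        fun ω => ∑' a : p.support, p a * expect ((k a).eval ω) f := by
      funext ω
      rw [eval, expect_bind, expect]
      refine (tsum_subtype_eq_of_support_subset ?_).symm
      intro a ha
      exact fun h => ha (by simp [h])
    rw [this]
    have : Countable p.support := p.support_countable.to_subtype
    exact Measurable.tsum fun a => (ih a).const_mul _

end OComp

/-- Resampling one digest does not change the law of the random oracle. -/
theorem lintegral_randomOracle_update {n : ℕ} (x : List Bool × List Bool)
    {F : Table n → ℝ≥0∞} (hF : Measurable F) :
    ∫⁻ ω, F ω ∂randomOracle n = expect (PMF.uniformOfFintype (Fin n → Bool))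
      fun v => ∫⁻ ω, F (Function.update ω x v) ∂randomOracle n := by
  classical
  set p := PMF.uniformOfFintype (Fin n → Bool)
  have hupd : ∀ v, Measurable fun ω : Table n => Function.update ω x v :=
    fun v => measurable_update_left
  have key : ∑ v, p v • (randomOracle n).map (fun ω => Function.update ω x v)
      = randomOracle n := by
    refine Measure.eq_infinitePi _ fun s t ht => ?_
    have hm : MeasurableSet (Set.pi (s : Set (List Bool × List Bool)) t) :=
      MeasurableSet.pi s.countable_toSet fun i _ => ht i
    have hbox : ∀ v, (randomOracle n).map (fun ω => Function.update ω x v) (Set.pi s t) =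
        (if x ∈ s → v ∈ t x then 1 else 0) * ∏ i ∈ s.erase x, p.toMeasure (t i) := by
      intro v
      rw [Measure.map_apply (hupd v) hm]
      have hpre : (fun ω : Table n => Function.update ω x v) ⁻¹' (Set.pi s t) =
          if x ∈ s → v ∈ t x then Set.pi (s.erase x) t else ∅ := by
        ext ω
        simp only [Set.mem_preimage, Set.mem_pi, Finset.mem_coe]
        split_ifs with h
        · simp only [Set.mem_pi, Finset.mem_coe, Finset.mem_erase]
          refine ⟨fun H i hi => ?_, fun H i hi => ?_⟩
          · simpa [hi.1] using H i hi.2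
          · by_cases hix : i = x
            · subst hix
              simpa using h hi
            · simpa [hix] using H i ⟨hix, hi⟩
        · push Not at h
          simp only [Set.mem_empty_iff_false, iff_false]
          intro H
          exact h.2 (by simpa using H x h.1)
      rw [hpre]
      split_ifs with h
      · rw [randomOracle, Measure.infinitePi_pi _ fun i _ => ht i, one_mul]
      · simp
    simp only [Measure.coe_finsetSum, Finset.sum_apply, Measure.smul_apply, hbox, smul_eq_mul]
    simp only [← mul_assoc, ← Finset.sum_mul]
    by_cases hx : x ∈ s
    · rw [← Finset.mul_prod_erase s _ hx]
      congr 1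
      refine Eq.trans ?_ (PMF.toMeasure_apply_fintype p (t x)).symm
      simp [hx, Set.indicator_apply]
    · have h1 : ∑ v, p v = 1 := by rw [← tsum_fintype (L := .unconditional _), p.tsum_coe]
      simp only [hx, IsEmpty.forall_iff, if_true, mul_one, h1, one_mul, not_false_eq_true,
        Finset.erase_eq_of_notMem]
      rfl
  conv_lhs => rw [← key]
  rw [lintegral_finsetSum_measure, expect, tsum_fintype]
  refine Finset.sum_congr rfl fun v _ => ?_
  rw [lintegral_smul_measure, lintegral_map hF (hupd v), smul_eq_mul]

theorem Cache.measurable_override {n : ℕ} (T : Cache n) : Measurable T.override := by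
  refine measurable_pi_lambda _ fun x => ?_
  cases h : T.lookup x with
  | none => simpa [Cache.override, h] using measurable_pi_apply x
  | some v => simp [Cache.override, h]

theorem Cache.override_update {n : ℕ} {T : Cache n} {x : List Bool × List Bool}
    (hx : T.lookup x = none) (ω : Table n) (v : Fin n → Bool) :
    T.override (Function.update ω x v) = Cache.override ((x, v) :: T) ω := by
  funext y
  by_cases hy : y = x
  · subst hy
    simp [Cache.override, hx]
  · simp [Cache.override, List.lookup_cons, beq_false_of_ne hy, hy]

/-- Lazy sampling has the same effect as choosing the whole table in advance. -/
theorem OComp.lintegral_eval {n : ℕ} {β : Type} (t : OComp n β) (T : Cache n) (f : β → ℝ≥0∞) :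
    ∫⁻ ω, expect (t.eval (T.override ω)) f ∂randomOracle n =
      expect (t.lazy T) fun a => f a.1 := by
  have : IsProbabilityMeasure (randomOracle n) := by
    unfold randomOracle
    infer_instance
  induction t generalizing T with
  | ret b => simp [eval, lazy, expect_pure]
  | query x k ih =>
    cases hx : T.lookup x with
    | some v =>
      simp only [eval, lazy, hx, ← ih]
      simp [Cache.override, hx]
    | none =>
      have hm : Measurable fun ω => expect ((query x k).eval (T.override ω)) f :=
        (measurable_expect_eval (query x k) f).comp T.measurable_override
      rw [lintegral_randomOracle_update x hm]
      simp only [lazy, hx, expect_bind, Cache.override_update hx, ← ih, eval]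
      simp [Cache.override]
  | samp δ p k ih =>
    simp only [eval, lazy, expect_bind, ← ih]
    have hc : Countable p.support := p.support_countable.to_subtype
    have hs : ∀ g : δ → ℝ≥0∞, expect p g = ∑' a : p.support, p a * g a := fun g => by
      refine (tsum_subtype_eq_of_support_subset (f := fun a => p a * g a) ?_).symm
      intro a ha
      exact fun h => ha (by simp [h])
    have hm : ∀ a, Measurable fun ω => expect ((k a).eval (T.override ω)) f := fun a =>
      (measurable_expect_eval (k a) f).comp T.measurable_override
    simp only [hs]
    rw [lintegral_tsum fun a : p.support => ((hm a).const_mul _).aemeasurable]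
    exact tsum_congr fun a => lintegral_const_mul _ (hm a)

/-! ### Runs of programs with access to the oracle -/

section Runs

variable {n : ℕ} {E E' : Type}

/-- `step` as an oracle computation: only requests to the environment `oh` use the oracle. -/
def stepO (oh : OHandler n E) (c : Config E) : OComp n (Config E) :=
  match c.todo with
  | .ask i p e :: K =>
      (oh p (e.eval c.mem) c.env).bind fun a =>
        .ret { c with
          todo := K
          mem := Function.update c.mem i a.1
          env := a.2
          time := c.time + 1 + e.cost c.mem + a.1.length }
  | _ => .samp _ (step (fun _ _ e => PMF.pure ([], e)) c) .ret

/-- `runSteps` as an oracle computation. -/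
def runStepsO (oh : OHandler n E) (B : ℕ) : ℕ → Config E → OComp n (Config E)
  | 0, c => .ret c
  | m + 1, c =>
      open Classical in
      if c.todo = [] ∨ B ≤ c.time then .ret c else (stepO oh c).bind (runStepsO oh B m)

/-- The environment whose state includes the cache of a lazily sampled oracle. -/
def lazyHandler (oh : OHandler n E) : Handler (E × Cache n) := fun p x s =>
  ((oh p x s.1).lazy s.2).map fun a => (a.1.1, (a.1.2, a.2))

theorem eval_stepO (oh : OHandler n E) (ω : Table n) (c : Config E) :
    (stepO oh c).eval ω = step (fun p x e => (oh p x e).eval ω) c := by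
  obtain ⟨todo, μ, ψ, e, t⟩ := c
  cases todo with
  | nil => simp [stepO, OComp.eval, step]
  | cons p K =>
    cases p <;> simp [stepO, OComp.eval, OComp.eval_bind, step, PMF.map]
    rfl

theorem eval_runStepsO (oh : OHandler n E) (ω : Table n) (B m : ℕ) (c : Config E) :
    (runStepsO oh B m c).eval ω = runSteps (fun p x e => (oh p x e).eval ω) B m c := by
  induction m generalizing c with
  | zero => simp [runStepsO, runSteps, OComp.eval]
  | succ m ih =>
    rw [runStepsO, runSteps]
    split_ifs
    · rfl
    · rw [OComp.eval_bind, eval_stepO]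
      exact congrArg _ (funext ih)

theorem lazy_stepO (oh : OHandler n E) (T : Cache n) (c : Config E) :
    (stepO oh c).lazy T = (step (lazyHandler oh) (c.mapEnv fun e => (e, T))).map
      fun c => (c.mapEnv Prod.fst, c.env.2) := by
  obtain ⟨todo, μ, ψ, e, t⟩ := c
  cases todo with
  | nil =>
    simp [stepO, OComp.lazy, step, PMF.pure_bind, Config.mapEnv, PMF.pure_map]
  | cons p K =>
    cases p <;> simp [stepO, OComp.lazy, OComp.lazy_bind, step, PMF.pure_bind, PMF.map,
      PMF.bind_bind, lazyHandler, Config.mapEnv, Function.comp_def]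
    all_goals congr!

theorem lazy_runStepsO (oh : OHandler n E) (B m : ℕ) (T : Cache n) (c : Config E) :
    (runStepsO oh B m c).lazy T = (runSteps (lazyHandler oh) B m (c.mapEnv fun e => (e, T))).map
      fun c => (c.mapEnv Prod.fst, c.env.2) := by
  induction m generalizing c T with
  | zero => simp [runStepsO, runSteps, OComp.lazy, Config.mapEnv, PMF.pure_map]
  | succ m ih =>
    rw [runStepsO, runSteps]
    by_cases hc : c.todo = [] ∨ B ≤ c.time
    · rw [if_pos hc, if_pos (by simpa [Config.mapEnv] using hc)]
      simp [OComp.lazy, Config.mapEnv, PMF.pure_map]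
    · rw [if_neg hc, if_neg (by simpa [Config.mapEnv] using hc)]
      rw [OComp.lazy_bind, lazy_stepO, PMF.map_bind, PMF.bind_map]
      congr 1
      funext c'
      simp only [Function.comp, ih]
      simp [Config.mapEnv]

/-- If one environment is the image of another one, then so are the runs of a program in them. -/
theorem step_mapEnv {h : Handler E} {h' : Handler E'} {φ : E → E'}
    (hφ : ∀ p x e, h' p x (φ e) = (h p x e).map fun a => (a.1, φ a.2)) (c : Config E) :
    step h' (c.mapEnv φ) = (step h c).map (Config.mapEnv φ) := by
  obtain ⟨todo, μ, ψ, e, t⟩ := c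
  cases todo with
  | nil => simp [step, Config.mapEnv, PMF.pure_map]
  | cons p K =>
    cases p <;> simp [step, PMF.map_comp, hφ, Config.mapEnv, PMF.pure_map, Function.comp_def]
    all_goals congr!

theorem runSteps_mapEnv {h : Handler E} {h' : Handler E'} {φ : E → E'}
    (hφ : ∀ p x e, h' p x (φ e) = (h p x e).map fun a => (a.1, φ a.2)) (B m : ℕ) (c : Config E) :
    runSteps h' B m (c.mapEnv φ) = (runSteps h B m c).map (Config.mapEnv φ) := by
  induction m generalizing c with
  | zero => simp [runSteps, PMF.pure_map]
  | succ m ih =>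
    rw [runSteps, runSteps]
    by_cases hc : c.todo = [] ∨ B ≤ c.time
    · rw [if_pos hc, if_pos (by simpa [Config.mapEnv] using hc), PMF.pure_map]
    · rw [if_neg hc, if_neg (by simpa [Config.mapEnv] using hc), step_mapEnv hφ, PMF.bind_map,
        PMF.map_bind]
      exact congrArg _ (funext ih)

end Runs

/-! ### The impersonation game with separate records of the two stages -/

/-- The state of the verifier of the augmented scheme. Unlike `VStatus`, a finished verifier keeps
the decision of the given scheme's verifier and the number of rounds won apart. -/
inductive GhostVerifier (V : Type)
  | idle
  | active (round : ℕ) (key : List Bool) (count : ℕ) (inner : Option V)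
  | done (b : Bool) (count : ℕ)

/-- The state of the impersonation game against the augmented scheme. A session is given by the
number of messages that the prover has sent and by the state of the given scheme's prover. -/
structure GhostState (S : IdScheme) where
  session : Option (ℕ × S.PState)
  verifier : GhostVerifier S.VState
  queries : ℕ

/-- The environment that offers nothing but the random oracle. -/
def oracleOnly (n : ℕ) : OHandler n Unit := fun p x u =>
  match p with
  | .hash => .query (unpair x) fun v => .ret (List.ofFn v, u)
  | _ => .ret ([], u)

theorem eval_oracleOnly {n : ℕ} (ω : Table n) :
    (fun p x u => (oracleOnly n p x u).eval ω) = hashHandler ω.hash := by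
  funext p x u
  cases p <;> rfl

/-- `Searcher.respond` as an oracle computation. -/
def Searcher.respondO (F : Searcher) (n : ℕ) (pk k : List Bool) : OComp n (List Bool) :=
  (runStepsO (oracleOnly n) (F.time.eval (n + pk.length + k.length))
    (F.time.eval (n + pk.length + k.length))
    ⟨[F.prog], inputs (unary n) pk k, ket ∅, (), 0⟩).bind fun c => .ret (c.mem 0)

theorem Searcher.eval_respondO (F : Searcher) {n : ℕ} (ω : Table n) (pk k : List Bool) :
    (F.respondO n pk k).eval ω = F.respond ω.hash n pk k := by
  rw [respondO, OComp.eval_bind, eval_runStepsO, eval_oracleOnly]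
  rfl

/-- `RoundWon` in terms of the two digests `v` and `v'`, with `q` hash evaluations of the
adversary. -/
def Wins (α : ℝ) (l n : ℕ) (q : ℕ) (m : List Bool) (v v' : Fin n → Bool) : Prop :=
  (unpair m).1 ≠ (unpair m).2 ∧ (List.ofFn v).take l = (List.ofFn v').take l ∧
    (q : ℝ) / α ≤ timeLimit l

/-- The reaction of the active verifier of the augmented scheme to the message `m`; `R` is the
number of rounds. -/
def ghostVerify (S : IdScheme) (α : ℝ) (l R n : ℕ) (pk : List Bool) (g : GhostState S)
    (round : ℕ) (key : List Bool) (count : ℕ) (inner : Option S.VState) (m : List Bool) :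
    OComp n (List Bool × GhostState S) :=
  open Classical in
  if round ≤ R then
    .query (key, (unpair m).1) fun v => .query (key, (unpair m).2) fun v' =>
      let count' := if 0 < round ∧ Wins α l n g.queries m v v' then count + 1 else count
      if round < R then
        .samp _ (PMF.uniformOfFintype (Fin n → Bool)) fun k =>
          .ret (List.ofFn k, ⟨g.session, .active (round + 1) (List.ofFn k) count' inner, 0⟩)
      else .ret ([], ⟨g.session, .active (round + 1) key count' inner, 0⟩)
  else
    .samp _ ((match inner with
        | some v => PMF.pure v
        | none => S.verifierInit n pk).bind fun v => S.verifierStep v m) fun a =>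
      match a.2 with
      | .inl reply => .ret (reply, ⟨g.session, .active round key count (some a.1), 0⟩)
      | .inr b => .ret ([b || decide (R ≤ 4 * count)], ⟨g.session, .done b count, 0⟩)

/-- The environment of an adversary against the augmented scheme; `pk` is the public key of the
given scheme. -/
def ghostHandler (S : IdScheme) (F : Searcher) (α : ℝ) (l R n : ℕ) (sk pk : List Bool) :
    OHandler n (GhostState S) := fun p x g =>
  match p with
  | .hash => .query (unpair x) fun v => .ret (List.ofFn v, { g with queries := g.queries + 1 })
  | .session =>
      match g.verifier with
      | .idle => .samp _ (S.proverInit n sk pk) fun s => .ret ([], { g with session := some (0, s) })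
      | _ => .ret ([], g)
  | .prover =>
      match g.verifier, g.session with
      | .idle, some s =>
          if s.1 = 0 then .ret ([], { g with session := some (1, s.2) })
          else if s.1 ≤ R then
            (F.respondO n (pair pk (unary l)) x).bind fun a =>
              .ret (a, { g with session := some (s.1 + 1, s.2) })
          else
            .samp _ (S.proverStep s.2 x) fun a =>
              .ret (a.2, { g with session := some (s.1, a.1) })
      | _, _ => .ret ([], g)
  | .verifier =>
      match g.verifier with
      | .idle => ghostVerify S α l R n pk g 0 [] 0 none x
      | .active round key count inner => ghostVerify S α l R n pk g round key count inner x
      | .done _ _ => .ret ([], g)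

section Projection

variable (S : IdScheme) (F : Searcher) (ℓ r : ℕ → ℕ) (n : ℕ) (pk : List Bool)

/-- The state of the game against the augmented scheme that a `GhostState` stands for. -/
def GhostState.toGame (g : GhostState S) : GameState (S.augment F ℓ r) where
  session := g.session.map fun s =>
    ({ n := n, pk := pair pk (unary (ℓ n)), round := s.1, inner := s.2 } : AugPState S.PState)
  verifier :=
    match g.verifier with
    | .idle => .idle
    | .active round key count inner => .active
        ({ n := n, pk := pair pk (unary (ℓ n)), round := round, key := key, collCount := count,
           inner := inner } : AugVState S.VState)
    | .done b count => .done (b || decide (r n ≤ 4 * count))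
  queries := g.queries

variable {S F ℓ r n pk}

theorem askVerifier_eq_ghostVerify (α : ℝ) (ω : Table n) (g : GhostState S)
    (round : ℕ) (key : List Bool) (count : ℕ) (inner : Option S.VState) (m : List Bool) :
    askVerifier (S.augment F ℓ r) α ω.hash (g.toGame S F ℓ r n pk)
      (⟨n, pair pk (unary (ℓ n)), round, key, count, inner⟩ : AugVState S.VState) m =
    ((ghostVerify S α (ℓ n) (r n) n pk g round key count inner m).eval ω).map
      fun a => (a.1, a.2.toGame S F ℓ r n pk) := by
  classical
  unfold askVerifier ghostVerify IdScheme.augment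
  by_cases h1 : round ≤ r n
  · by_cases h2 : round < r n
    · simp only [h1, h2, if_true, OComp.eval, PMF.map_bind, PMF.pure_map, PMF.map_comp]
      rfl
    · simp only [h1, h2, if_true, if_false, OComp.eval, PMF.pure_map]
      rfl
  · simp only [h1, if_false, OComp.eval, PMF.bind_bind, PMF.map, unpair_pair]
    congr! 2 with v
    refine congrArg _ (funext fun a => ?_)
    obtain ⟨a, reply | b⟩ := a <;> simp [OComp.eval, PMF.pure_bind, GhostState.toGame] <;> rfl

theorem gameHandler_toGame (α : ℝ) (sk : List Bool) (ω : Table n) (p : Port) (x : List Bool)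
    (g : GhostState S) :
    gameHandler (S.augment F ℓ r) α n sk (pair pk (unary (ℓ n))) ω.hash p x
        (g.toGame S F ℓ r n pk) =
      ((ghostHandler S F α (ℓ n) (r n) n sk pk p x g).eval ω).map
        fun a => (a.1, a.2.toGame S F ℓ r n pk) := by
  classical
  obtain ⟨ses, ver, q⟩ := g
  cases p with
  | hash => simp only [gameHandler, ghostHandler, OComp.eval, PMF.pure_map]; rfl
  | session =>
    cases ver <;> simp only [gameHandler, ghostHandler, GhostState.toGame, OComp.eval, PMF.pure_map]
    simp only [IdScheme.augment, unpair_pair, PMF.map_comp, PMF.map_bind, PMF.pure_map]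
    rfl
  | prover =>
    cases ver
    case idle =>
      cases ses with
      | none =>
        simp only [gameHandler, ghostHandler, GhostState.toGame, OComp.eval, PMF.pure_map,
          Option.map]
      | some s =>
        obtain ⟨rd, s⟩ := s
        simp only [gameHandler, ghostHandler, GhostState.toGame, Option.map]
        by_cases h0 : rd = 0
        · simp [h0, IdScheme.augment, OComp.eval, PMF.pure_map]
        by_cases h1 : rd ≤ r n
        · simp [h0, h1, IdScheme.augment, OComp.eval, OComp.eval_bind,
            Searcher.eval_respondO, PMF.map]
        · simp [h0, h1, IdScheme.augment, OComp.eval, PMF.map, PMF.bind_bind, PMF.pure_bind,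
            Function.comp_def]
    all_goals
      simp only [gameHandler, ghostHandler, GhostState.toGame, OComp.eval, PMF.pure_map]
  | verifier =>
    cases ver with
    | idle =>
      have := askVerifier_eq_ghostVerify (F := F) (ℓ := ℓ) (r := r) (pk := pk) α ω
        (⟨ses, .idle, q⟩ : GhostState S) 0 [] 0 none x
      exact (PMF.pure_bind _ _).trans this
    | active round key count inner =>
      exact askVerifier_eq_ghostVerify α ω _ round key count inner x
    | done b count =>
      simp only [gameHandler, ghostHandler, GhostState.toGame, OComp.eval, PMF.pure_map]

/-- The given scheme's verifier has accepted. -/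
def GhostState.innerAccepted (g : GhostState S) : ℝ≥0∞ :=
  match g.verifier with
  | .done true _ => 1
  | _ => 0

/-- The verifier has finished, and at least a quarter of the `R` rounds were won. -/
def GhostState.collisionAccepted (R : ℕ) (g : GhostState S) : ℝ≥0∞ :=
  match g.verifier with
  | .done _ count => if R ≤ 4 * count then 1 else 0
  | _ => 0

theorem GhostState.accepted_toGame_le (g : GhostState S) :
    (if (g.toGame S F ℓ r n pk).verifier.accepted then 1 else 0) ≤
      g.innerAccepted + g.collisionAccepted (r n) := by
  obtain ⟨ses, ver, q⟩ := g
  cases ver with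
  | idle => simp [toGame, VStatus.accepted]
  | active => simp [toGame, VStatus.accepted]
  | done b count =>
    cases b <;> simp [toGame, VStatus.accepted, innerAccepted, collisionAccepted]

/-- The start of the game in the world with lazy sampling. -/
def lazyStart (S : IdScheme) (A : Adversary) (n l : ℕ) (pk : List Bool) :
    Config (GhostState S × Cache n) :=
  ⟨[A.prog], inputs (unary n) (pair pk (unary l)) (A.advice n), ket ∅,
    (⟨none, .idle, 0⟩, []), 0⟩

variable (S F ℓ r n)

/-- The impersonator's chance is at most its chance in the given scheme's part plus its chance in
the collision stage, both in the world with lazy sampling. -/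
theorem lintegral_advantage_le (α : ℝ) (A : Adversary) :
    ∫⁻ ω, (S.augment F ℓ r).advantage α A n ω.hash ∂randomOracle n ≤
      (expect (S.keyGen n) fun k =>
        value (lazyHandler (ghostHandler S F α (ℓ n) (r n) n k.1 k.2)) (A.time.eval n)
          (fun s => s.1.innerAccepted) (lazyStart S A n (ℓ n) k.2)) +
      expect (S.keyGen n) fun k =>
        value (lazyHandler (ghostHandler S F α (ℓ n) (r n) n k.1 k.2)) (A.time.eval n)
          (fun s => s.1.collisionAccepted (r n)) (lazyStart S A n (ℓ n) k.2) := by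
  set tree : OComp n (GhostState S) := .samp _ (S.keyGen n) fun k =>
    (runStepsO (ghostHandler S F α (ℓ n) (r n) n k.1 k.2) (A.time.eval n) (A.time.eval n)
      ⟨[A.prog], inputs (unary n) (pair k.2 (unary (ℓ n))) (A.advice n), ket ∅,
        ⟨none, .idle, 0⟩, 0⟩).bind fun c => .ret c.env with htree
  have h1 : ∀ ω : Table n, (S.augment F ℓ r).advantage α A n ω.hash ≤
      expect (tree.eval ω) fun g => g.innerAccepted + g.collisionAccepted (r n) := by
    intro ω
    rw [TimedIdScheme.advantage, expect_ite_eq_map_apply, expect_bind, htree, OComp.eval,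
      expect_bind]
    conv_lhs => enter [1]; simp only [IdScheme.augment]
    rw [expect_map]
    refine expect_mono fun k _ => ?_
    rw [OComp.eval_bind, eval_runStepsO, expect_bind]
    have hrun := runSteps_mapEnv (h' := gameHandler (S.augment F ℓ r) α n k.1
      (pair k.2 (unary (ℓ n))) ω.hash) (φ := GhostState.toGame S F ℓ r n k.2)
      (fun p x g => gameHandler_toGame α k.1 ω p x g) (A.time.eval n) (A.time.eval n)
      ⟨[A.prog], inputs (unary n) (pair k.2 (unary (ℓ n))) (A.advice n), ket ∅,
        ⟨none, .idle, 0⟩, 0⟩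
    refine le_of_eq_of_le (congrArg (fun p => expect p _) (show _ = _ from hrun)) ?_
    rw [expect_map]
    refine expect_mono fun c _ => ?_
    rw [OComp.eval, expect_pure]
    exact GhostState.accepted_toGame_le c.env
  refine (lintegral_mono h1).trans ?_
  have h2 := OComp.lintegral_eval tree [] fun g => g.innerAccepted + g.collisionAccepted (r n)
  have h3 : ∀ ω : Table n, Cache.override [] ω = ω := fun ω => by
    funext x
    simp [Cache.override]
  simp only [h3] at h2
  rw [h2, htree]
  simp only [OComp.lazy, expect_bind, OComp.lazy_bind, lazy_runStepsO, expect_map, expect_pure,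
    expect_add]
  exact le_rfl

end Projection

/-! ### Bounds on lengths and costs -/

theorem length_pair (x y : List Bool) : (pair x y).length = 2 * x.length + 1 + y.length := by
  induction x with
  | nil => simp [pair]; omega
  | cons b x ih =>
    have h : pair (b :: x) y = true :: b :: pair x y := by simp [pair]
    rw [h]
    simp only [List.length_cons, ih]
    omega

theorem length_unpair_le (x : List Bool) :
    (unpair x).1.length + (unpair x).2.length ≤ x.length := by
  induction x using unpair.induct with
  | case1 => simp [unpair]
  | case2 => simp [unpair]
  | case3 y => simp [unpair]
  | case4 b l ih => simp only [unpair, List.length_cons]; omega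

theorem length_unary (m : ℕ) : (unary m).length = m := by simp [unary]

theorem tail_unary (k : ℕ) : (unary k).drop 1 = unary (k - 1) := by
  simp [unary]

theorem unary_eq_nil {k : ℕ} : unary k = [] ↔ k = 0 := by
  simp [unary]

/-- A number that exceeds all registers in the expression and also bounds the growth of its cost
with the lengths of the registers. -/
def Expr.size : Expr → ℕ
  | .reg i => i + 1
  | .empty => 1
  | .push _ e => 2 * e.size + 1
  | .first e => 2 * e.size
  | .tail e => 2 * e.size
  | .eq e d => e.size + d.size + 2
  | .pair e d => 3 * e.size + 2 * d.size
  | .fst e => 2 * e.size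
  | .snd e => 2 * e.size

theorem Expr.length_eval_lt_cost (μ : Mem) (e : Expr) : (e.eval μ).length < e.cost μ := by
  cases e <;> simp only [Expr.eval, Expr.cost, List.length_nil] <;> omega

theorem Expr.cost_le (μ : Mem) (L : ℕ) (e : Expr) (hL : ∀ i < e.size, (μ i).length ≤ L) :
    e.cost μ ≤ e.size * (L + 1) := by
  induction e with
  | reg i =>
    have := hL i (by simp [size])
    simp only [cost, size]
    nlinarith
  | empty => simp [cost, size]
  | push b e ih =>
    have := ih fun i hi => hL i (by simp only [size]; omega)
    have h := e.length_eval_lt_cost μ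
    simp only [cost, size, eval, List.length_cons]
    nlinarith
  | first e ih =>
    have := ih fun i hi => hL i (by simp only [size]; omega)
    have h := e.length_eval_lt_cost μ
    have : ((e.eval μ).take 1).length ≤ (e.eval μ).length := by simp
    simp only [cost, size, eval]
    nlinarith
  | tail e ih =>
    have := ih fun i hi => hL i (by simp only [size]; omega)
    have h := e.length_eval_lt_cost μ
    have : ((e.eval μ).drop 1).length ≤ (e.eval μ).length := by simp
    simp only [cost, size, eval]
    nlinarith
  | eq e d ihe ihd =>
    have h1 := ihe fun i hi => hL i (by simp only [size]; omega)
    have h2 := ihd fun i hi => hL i (by simp only [size]; omega)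
    have : (Expr.eval μ (.eq e d)).length ≤ 1 := by
      simp only [eval]
      split_ifs <;> simp
    simp only [cost, size]
    nlinarith
  | pair e d ihe ihd =>
    have h1 := ihe fun i hi => hL i (by simp only [size]; omega)
    have h2 := ihd fun i hi => hL i (by simp only [size]; omega)
    have h3 := e.length_eval_lt_cost μ
    have h4 := d.length_eval_lt_cost μ
    simp only [cost, size, eval, length_pair]
    nlinarith
  | fst e ih =>
    have := ih fun i hi => hL i (by simp only [size]; omega)
    have h := e.length_eval_lt_cost μ
    have := length_unpair_le (e.eval μ)
    simp only [cost, size, eval]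
    nlinarith
  | snd e ih =>
    have := ih fun i hi => hL i (by simp only [size]; omega)
    have h := e.length_eval_lt_cost μ
    have := length_unpair_le (e.eval μ)
    simp only [cost, size, eval]
    nlinarith

/-- A number that exceeds all registers in the program and the sizes of all its expressions. -/
def Cmd.size : Cmd → ℕ
  | .skip => 0
  | .assign i e => i + 1 + e.size
  | .coin i => i + 1
  | .ask i _ e => i + 1 + e.size
  | .gate _ e d => e.size + d.size
  | .measure i e => i + 1 + e.size
  | .seq c d => c.size + d.size
  | .cond e c d => e.size + c.size + d.size
  | .loop e c => e.size + c.size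

/-- The registers hold no more than the initial length and the elapsed time allow, and all
commands have size at most `w`. -/
structure Config.Bounded {E : Type} (L w : ℕ) (c : Config E) : Prop where
  length_le : ∀ i, (c.mem i).length ≤ L + c.time
  size_le : ∀ p ∈ c.todo, p.size ≤ w

section Bounded

variable {E : Type} {h : Handler E} {L w B : ℕ}

theorem Config.Bounded.step {c : Config E} (hc : c.Bounded L w) :
    ∀ c' ∈ (step h c).support, c'.Bounded L w := by
  intro c' hc'
  obtain ⟨hl, hs⟩ := hc
  obtain ⟨todo, μ, ψ, e, t⟩ := c
  have hupd : ∀ (i : ℕ) (x : List Bool) (t' : ℕ), t + x.length ≤ t' →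
      ∀ j, (Function.update μ i x j).length ≤ L + t' := by
    intro i x t' ht j
    have := hl j
    rw [Function.update_apply]
    split_ifs <;> simp only at this ⊢ <;> omega
  have hmem : ∀ t', t ≤ t' → ∀ j, (μ j).length ≤ L + t' := by
    intro t' ht j
    have := hl j
    simp only at this
    omega
  cases todo with
  | nil =>
    simp only [TimedId.step, PMF.support_pure, Set.mem_singleton_iff] at hc'
    subst hc'
    exact ⟨hl, hs⟩
  | cons p K =>
    simp only [List.mem_cons, forall_eq_or_imp] at hs
    cases p <;> simp only [TimedId.step, PMF.support_pure, Set.mem_singleton_iff,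
      PMF.mem_support_map_iff] at hc'
    case ask =>
      obtain ⟨a, _, rfl⟩ := hc'
      exact ⟨hupd _ _ _ (by simp only; omega), hs.2⟩
    case coin =>
      obtain ⟨a, _, rfl⟩ := hc'
      exact ⟨hupd _ _ _ (by simp), hs.2⟩
    case measure =>
      obtain ⟨a, _, rfl⟩ := hc'
      exact ⟨hupd _ _ _ (by simp), hs.2⟩
    case assign i e =>
      subst hc'
      have := e.length_eval_lt_cost μ
      exact ⟨hupd _ _ _ (by simp only; omega), hs.2⟩
    case seq a b =>
      subst hc'
      refine ⟨hmem _ (by simp), ?_⟩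
      simp only [Cmd.size] at hs
      simp only [List.mem_cons, forall_eq_or_imp]
      exact ⟨by omega, by omega, hs.2⟩
    case cond x a b =>
      subst hc'
      refine ⟨hmem _ (by simp only; omega), ?_⟩
      simp only [Cmd.size] at hs
      simp only [List.mem_cons, forall_eq_or_imp]
      refine ⟨?_, hs.2⟩
      split_ifs <;> omega
    case loop x a =>
      subst hc'
      refine ⟨hmem _ (by simp only; omega), ?_⟩
      simp only
      split_ifs
      · exact hs.2
      · simp only [List.mem_cons, forall_eq_or_imp]
        refine ⟨?_, hs⟩
        simp only [Cmd.size] at hs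
        omega
    case skip =>
      subst hc'
      exact ⟨hmem _ (by simp), hs.2⟩
    case gate =>
      subst hc'
      exact ⟨hmem _ (by simp only; omega), hs.2⟩

theorem Config.Bounded.cost_le {c : Config E} (hc : c.Bounded L w) (ht : c.time < B) (e : Expr)
    (he : e.size ≤ w) : e.cost c.mem ≤ w * (L + B + 1) := by
  refine (Expr.cost_le c.mem (L + B) e fun i _ => (hc.length_le i).trans (by omega)).trans ?_
  exact Nat.mul_le_mul_right _ he

/-- If no request of bounded length increases the expectation of `Φ`, then neither does the run of
a program. -/
theorem expect_runSteps_le {Φ : ℕ → E → ℝ≥0∞} {f : E → ℝ≥0∞} (hf : ∀ k e, f e ≤ Φ k e)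
    (hmono : ∀ k e, Φ k e ≤ Φ (k + 1) e)
    (hask : ∀ k p x e, x.length ≤ w * (L + B + 1) →
      expect (h p x e) (fun a => Φ k a.2) ≤ Φ (k + 1) e)
    (m : ℕ) (c : Config E) (hc : c.Bounded L w) :
    expect (runSteps h B m c) (fun c => f c.env) ≤ Φ m c.env := by
  induction m generalizing c with
  | zero => simpa [runSteps, expect_pure] using hf 0 c.env
  | succ m ih =>
    by_cases h1 : c.todo = []
    · rw [runSteps_of_todo_nil _ _ _ _ h1, expect_pure]
      exact hf _ _
    by_cases h2 : B ≤ c.time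
    · rw [runSteps_of_le_time _ _ _ _ h2, expect_pure]
      exact hf _ _
    rw [runSteps_succ _ _ _ _ h1 (by omega), expect_bind]
    refine (expect_mono fun c' hc' => ih c' (hc.step c' hc')).trans ?_
    have hcost := hc.cost_le (B := B) (by omega)
    obtain ⟨todo, μ, ψ, e, t⟩ := c
    obtain ⟨p, K, rfl⟩ := List.exists_cons_of_ne_nil h1
    cases p <;> simp only [TimedId.step, expect_pure, expect_map]
    case ask i p x =>
      refine hask _ _ _ _ ?_
      have hs := hc.size_le _ List.mem_cons_self
      simp only [Cmd.size] at hs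
      exact (x.length_eval_lt_cost μ).le.trans (hcost x (by omega))
    case coin => rw [expect_const]; exact hmono _ _
    case measure => rw [expect_const]; exact hmono _ _
    all_goals exact hmono _ _

end Bounded

/-! ### The chance of winning a collision round -/

section Collision

variable {n : ℕ}

theorem card_take_ofFn_eq_le {l : ℕ} (hl : l ≤ n) (y : List Bool) :
    (Finset.univ.filter fun v : Fin n → Bool => (List.ofFn v).take l = y).card ≤ 2 ^ (n - l) := by
  have hcard : (Finset.univ : Finset (Fin (n - l) → Bool)).card = 2 ^ (n - l) := by simp
  rw [← hcard]
  refine Finset.card_le_card_of_injOn (fun v i => v ⟨l + i, by omega⟩) (by simp) ?_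
  intro v hv v' hv' hvv'
  simp only [Finset.coe_filter, Finset.mem_univ, true_and, Set.mem_ofPred_eq] at hv hv'
  funext ⟨i, hi⟩
  by_cases hil : i < l
  · have h : (List.ofFn v).take l = (List.ofFn v').take l := hv.trans hv'.symm
    have h' : ((List.ofFn v).take l)[i]? = ((List.ofFn v').take l)[i]? := by rw [h]
    simpa [List.getElem?_take, hil, hi] using h'
  · have h := congrFun hvv' ⟨i - l, by omega⟩
    have hi' : l + (i - l) = i := by omega
    simpa [hi'] using h

open Classical in
/-- A fresh digest has given leading `l` bits with probability at most `2^-l`. -/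
theorem expect_take_ofFn_eq_le {l : ℕ} (hl : l ≤ n) (y : List Bool) :
    expect (PMF.uniformOfFintype (Fin n → Bool))
      (fun v => if (List.ofFn v).take l = y then 1 else 0) ≤ (2 ^ l)⁻¹ := by
  rw [expect_uniform, Finset.sum_boole]
  have h1 : (((Finset.univ.filter fun v : Fin n → Bool => (List.ofFn v).take l = y).card : ℕ) :
      ℝ≥0∞) ≤ 2 ^ (n - l) := by
    have := card_take_ofFn_eq_le hl y
    have h2 : ((2 ^ (n - l) : ℕ) : ℝ≥0∞) = 2 ^ (n - l) := by push_cast; rfl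
    rw [← h2]
    refine Nat.cast_le.2 ?_
    convert this
  have h2 : (Fintype.card (Fin n → Bool) : ℝ≥0∞) = 2 ^ (n - l) * 2 ^ l := by
    rw [← pow_add, Nat.sub_add_cancel hl]
    simp
  rw [h2, ENNReal.mul_inv (by simp) (by simp)]
  calc (2 ^ (n - l))⁻¹ * (2 ^ l)⁻¹ * _ ≤ (2 ^ (n - l))⁻¹ * (2 ^ l)⁻¹ * (2 ^ (n - l) : ℝ≥0∞) := by
        gcongr
    _ = (2 ^ (n - l))⁻¹ * 2 ^ (n - l) * (2 ^ l : ℝ≥0∞)⁻¹ := by ring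
    _ = (2 ^ l)⁻¹ := by
        rw [ENNReal.inv_mul_cancel (by simp) (by simp), one_mul]

open Classical in
theorem expect_exists_take_ofFn_eq_le {l : ℕ} (hl : l ≤ n) {β : Type} (L : List β)
    (y : β → List Bool) :
    expect (PMF.uniformOfFintype (Fin n → Bool))
      (fun v => if ∃ e ∈ L, (List.ofFn v).take l = y e then 1 else 0) ≤
        L.length * (2 ^ l)⁻¹ := by
  induction L with
  | nil => simp [expect_const]
  | cons e L ih =>
    refine (expect_mono (g := fun v => (if (List.ofFn v).take l = y e then 1 else 0) +
      if ∃ e ∈ L, (List.ofFn v).take l = y e then 1 else 0) fun v _ => ?_).trans ?_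
    · by_cases h1 : (List.ofFn v).take l = y e
      · simp [h1]
      · simp only [List.mem_cons, exists_eq_or_imp, h1, false_or, if_false, zero_add, le_refl]
    · rw [expect_add, List.length_cons, Nat.cast_add, add_mul, Nat.cast_one, one_mul, add_comm]
      exact add_le_add ih (expect_take_ofFn_eq_le hl _)

/-- The number of cached digests under the round key. -/
def Cache.keyCount (T : Cache n) (key : List Bool) : ℕ := (T.filter fun e => e.1.1 = key).length

/-- The cache holds a collision of leading `l` bits under the round key. -/
def Cache.HasCollision (T : Cache n) (l : ℕ) (key : List Bool) : Prop :=
  ∃ M M' v v', M ≠ M' ∧ T.lookup (key, M) = some v ∧ T.lookup (key, M') = some v' ∧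
    (List.ofFn v).take l = (List.ofFn v').take l

/-- The union bound for winning a round with `q` digests known that form no collision, `Q` being
the number of hash evaluations that fit into the time limit. -/
def winBound (l Q q : ℕ) : ℝ≥0∞ := (1 + ∑ i ∈ Finset.Ico q Q, (i : ℝ≥0∞)) * (2 ^ l)⁻¹

open Classical in
/-- An upper bound for the probability of winning the current round after `q` hash evaluations.
It is trivial if a collision is known, or if more digests under the round key are known than
have been asked for since the key was sent. -/
def winChance (l Q : ℕ) (T : Cache n) (key : List Bool) (q : ℕ) : ℝ≥0∞ :=
  if Q < q then 0
  else if q < T.keyCount key ∨ T.HasCollision l key then 1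
  else winBound l Q q

variable {l Q : ℕ}

theorem winBound_succ_le (q : ℕ) : winBound l Q (q + 1) ≤ winBound l Q q := by
  unfold winBound
  gcongr
  exact Nat.le_succ q

theorem winBound_succ_add {q : ℕ} (hq : q < Q) :
    winBound l Q (q + 1) + q * (2 ^ l)⁻¹ = winBound l Q q := by
  unfold winBound
  rw [← Finset.sum_Ioo_add_eq_sum_Ico hq, ← add_mul, add_assoc]
  rfl

theorem winBound_le (q : ℕ) : winBound l Q q ≤ winBound l Q 0 := by
  unfold winBound
  gcongr
  exact Nat.zero_le q

theorem winChance_le_one (hb : winBound l Q 0 ≤ 1) (T : Cache n) (key : List Bool) (q : ℕ) :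
    winChance l Q T key q ≤ 1 := by
  unfold winChance
  split_ifs
  · exact zero_le
  · exact le_rfl
  · exact (winBound_le q).trans hb

theorem winChance_succ_le (hb : winBound l Q 0 ≤ 1) (T : Cache n) (key : List Bool) (q : ℕ) :
    winChance l Q T key (q + 1) ≤ winChance l Q T key q := by
  by_cases h1 : Q < q + 1
  · simp [winChance, h1]
  by_cases h2 : q < T.keyCount key ∨ T.HasCollision l key
  · refine (winChance_le_one hb T key (q + 1)).trans ?_
    rw [winChance, if_neg (by omega), if_pos h2]
  · push Not at h2
    have e1 : winChance l Q T key (q + 1) = winBound l Q (q + 1) := by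
      rw [winChance, if_neg h1, if_neg]
      push Not
      exact ⟨by omega, h2.2⟩
    have e2 : winChance l Q T key q = winBound l Q q := by
      rw [winChance, if_neg (by omega), if_neg]
      push Not
      exact h2
    rw [e1, e2]
    exact winBound_succ_le q

theorem Cache.lookup_mem {T : Cache n} {x : List Bool × List Bool} {v : Fin n → Bool}
    (h : T.lookup x = some v) : (x, v) ∈ T := by
  obtain ⟨l₁, l₂, rfl, _⟩ := List.lookup_eq_some_iff.1 h
  simp

open Classical in
/-- A hash evaluation that needs a fresh digest does not increase the chance of winning. -/
theorem expect_winChance_cons_le (hl : l ≤ n) (hb : winBound l Q 0 ≤ 1) (T : Cache n)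
    (x : List Bool × List Bool) (key : List Bool) (q : ℕ) :
    expect (PMF.uniformOfFintype (Fin n → Bool))
      (fun v => winChance l Q ((x, v) :: T) key (q + 1)) ≤ winChance l Q T key q := by
  by_cases h1 : Q < q + 1
  · simp [winChance, h1, expect_const]
  by_cases h2 : q < T.keyCount key ∨ T.HasCollision l key
  · refine (expect_le fun v _ => winChance_le_one hb _ key (q + 1)).trans ?_
    rw [winChance, if_neg (by omega), if_pos h2]
  have h3 : winChance l Q T key q = winBound l Q q := by
    rw [winChance, if_neg (by omega), if_neg h2]
  push Not at h2
  rw [h3, ← winBound_succ_add (by omega)]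
  have hpt : ∀ v, winChance l Q ((x, v) :: T) key (q + 1) ≤ winBound l Q (q + 1) +
      if ∃ e ∈ T.filter (fun e => e.1.1 = key), (List.ofFn v).take l = (List.ofFn e.2).take l
        then 1 else 0 := by
    intro v
    by_cases hh : ∃ e ∈ T.filter (fun e => e.1.1 = key),
        (List.ofFn v).take l = (List.ofFn e.2).take l
    · rw [if_pos hh]
      exact (winChance_le_one hb _ _ _).trans le_add_self
    rw [if_neg hh, add_zero, winChance, if_neg (by omega), if_neg]
    push Not at hh ⊢
    constructor
    · refine le_trans ?_ (Nat.succ_le_succ h2.1)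
      simp only [Cache.keyCount, List.filter_cons]
      split_ifs <;> simp
    · rintro ⟨M, M', w, w', hne, hw, hw', heq⟩
      by_cases hM : (key, M) = x
      · have hM' : (key, M') ≠ x := fun h => hne (by rw [← hM] at h; simpa using h.symm)
        rw [← hM, List.lookup_cons_self, Option.some_inj] at hw
        rw [List.lookup_cons, beq_false_of_ne hM'] at hw'
        refine hh ((key, M'), w') ?_ (hw ▸ heq)
        simpa using Cache.lookup_mem hw'
      rw [List.lookup_cons, beq_false_of_ne hM] at hw
      by_cases hM' : (key, M') = x
      · rw [← hM', List.lookup_cons_self, Option.some_inj] at hw'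
        refine hh ((key, M), w) ?_ (hw' ▸ heq.symm)
        simpa using Cache.lookup_mem hw
      · rw [List.lookup_cons, beq_false_of_ne hM'] at hw'
        exact h2.2 ⟨M, M', w, w', hne, hw, hw', heq⟩
  refine (expect_mono fun v _ => hpt v).trans ?_
  rw [expect_add, expect_const]
  gcongr
  have hex := expect_exists_take_ofFn_eq_le hl (T.filter fun e => e.1.1 = key)
    fun e => (List.ofFn e.2).take l
  refine le_trans (le_of_eq (by congr!)) (hex.trans ?_)
  gcongr
  exact h2.1

open Classical in
/-- The chance of winning a round with a fresh key. -/
theorem expect_winChance_fresh_le (hb : winBound l Q 0 ≤ 1) (T : Cache n) :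
    expect (PMF.uniformOfFintype (Fin n → Bool)) (fun v => winChance l Q T (List.ofFn v) 0) ≤
      winBound l Q 0 + T.length * (2 ^ n)⁻¹ := by
  have hpt : ∀ v : Fin n → Bool, winChance l Q T (List.ofFn v) 0 ≤ winBound l Q 0 +
      if ∃ e ∈ T, (List.ofFn v).take n = e.1.1 then 1 else 0 := by
    intro v
    by_cases hh : ∃ e ∈ T, (List.ofFn v).take n = e.1.1
    · rw [if_pos hh]
      exact (winChance_le_one hb _ _ _).trans le_add_self
    rw [if_neg hh, add_zero, winChance, if_neg (by omega), if_neg]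
    rw [List.take_of_length_le (by simp)] at hh
    push Not at hh ⊢
    constructor
    · rw [Cache.keyCount, Nat.le_zero, List.length_eq_zero_iff, List.filter_eq_nil_iff]
      intro e he h
      exact hh e he (by simpa [eq_comm] using h)
    · rintro ⟨M, M', w, w', hne, hw, -, -⟩
      exact hh _ (Cache.lookup_mem hw) rfl
  refine (expect_mono fun v _ => hpt v).trans ?_
  rw [expect_add, expect_const]
  gcongr
  exact expect_exists_take_ofFn_eq_le le_rfl T fun e => e.1.1

open Classical in
/-- The response to the round key wins with probability at most `winChance`. -/
theorem expect_wins_le (hl : l ≤ n) {α : ℝ} (hα : 0 < α)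
    (hQ : Q = ⌊α * timeLimit l⌋₊) (T : Cache n) (key m : List Bool) (q : ℕ) :
    expect ((OComp.query (key, (unpair m).1) fun v => .query (key, (unpair m).2) fun v' =>
      .ret (v, v')).lazy T) (fun a => if Wins α l n q m a.1.1 a.1.2 then 1 else 0) ≤
      winChance l Q T key q := by
  by_cases h1 : Q < q
  · have : ∀ v v', ¬ Wins α l n q m v v' := by
      rintro v v' ⟨-, -, h⟩
      rw [div_le_iff₀ hα, mul_comm] at h
      have := Nat.le_floor h
      omega
    simp [this, expect_const]
  by_cases h2 : q < T.keyCount key ∨ T.HasCollision l key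
  · rw [winChance, if_neg h1, if_pos h2]
    refine expect_le fun a _ => ?_
    split_ifs <;> simp
  rw [winChance, if_neg h1, if_neg h2]
  push Not at h2
  have hbase : (2 ^ l : ℝ≥0∞)⁻¹ ≤ winBound l Q q := by
    unfold winBound
    exact le_mul_of_one_le_left' le_self_add
  refine le_trans ?_ hbase
  by_cases hne : (unpair m).1 = (unpair m).2
  · have : ∀ v v', ¬ Wins α l n q m v v' := fun v v' h => h.1 hne
    simp [this, expect_const]
  have hw : ∀ v v', (if Wins α l n q m v v' then (1 : ℝ≥0∞) else 0) ≤
      if (List.ofFn v).take l = (List.ofFn v').take l then 1 else 0 := by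
    intro v v'
    by_cases h : Wins α l n q m v v'
    · rw [if_pos h, if_pos h.2.1]
    · rw [if_neg h]
      exact zero_le
  have hfresh : ∀ v, expect (PMF.uniformOfFintype (Fin n → Bool))
      (fun v' => if Wins α l n q m v v' then 1 else 0) ≤ (2 ^ l)⁻¹ := fun v =>
    (expect_mono fun v' _ => (hw v v').trans (by simp only [eq_comm, le_refl])).trans
      (expect_take_ofFn_eq_le hl ((List.ofFn v).take l))
  have hne' : (key, (unpair m).2) ≠ (key, (unpair m).1) := fun h => hne (by simpa using h.symm)
  cases hM : T.lookup (key, (unpair m).1) with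
  | some v =>
    cases hM' : T.lookup (key, (unpair m).2) with
    | some v' =>
      simp only [OComp.lazy, hM, hM', expect_pure]
      rw [if_neg]
      · exact zero_le
      · exact fun h => h2.2 ⟨_, _, v, v', hne, hM, hM', h.2.1⟩
    | none =>
      simp only [OComp.lazy, hM, hM', expect_bind, expect_pure]
      exact hfresh v
  | none =>
    have hlook : ∀ v, List.lookup (key, (unpair m).2) (((key, (unpair m).1), v) :: T) =
        T.lookup (key, (unpair m).2) := by
      intro v
      rw [List.lookup_cons, beq_false_of_ne hne']
    cases hM' : T.lookup (key, (unpair m).2) with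
    | some v' =>
      simp only [OComp.lazy, hM, hM', hlook, expect_bind, expect_pure]
      exact (expect_mono fun v _ => hw v v').trans (expect_take_ofFn_eq_le hl _)
    | none =>
      simp only [OComp.lazy, hM, hM', hlook, expect_bind, expect_pure]
      exact expect_le fun v _ => hfresh v

end Collision

/-! ### The number of rounds won -/

/-- Lazy sampling adds at most `q` entries to the cache. -/
def OComp.Grows {n : ℕ} {β : Type} (q : ℕ) (t : OComp n β) : Prop :=
  ∀ T, ∀ a ∈ (t.lazy T).support, a.2.length ≤ T.length + q

namespace OComp.Grows

variable {n q : ℕ} {β γ : Type}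

theorem ret (b : β) : Grows q (.ret b : OComp n β) := by
  intro T a ha
  simp only [lazy, PMF.support_pure, Set.mem_singleton_iff] at ha
  subst ha
  simp

theorem query {x : List Bool × List Bool} {k : (Fin n → Bool) → OComp n β}
    (h : ∀ v, Grows q (k v)) : Grows (q + 1) (.query x k) := by
  intro T a ha
  simp only [lazy] at ha
  split at ha
  · have := h _ _ _ ha
    omega
  · obtain ⟨v, _, hv⟩ := (PMF.mem_support_bind_iff _ _ _).1 ha
    have := h _ _ _ hv
    simp only [List.length_cons] at this
    omega

theorem samp {p : PMF γ} {k : γ → OComp n β} (h : ∀ v, Grows q (k v)) :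
    Grows q (.samp γ p k) := by
  intro T a ha
  obtain ⟨v, _, hv⟩ := (PMF.mem_support_bind_iff _ _ _).1 ha
  exact h _ _ _ hv

theorem bind {q' : ℕ} {t : OComp n β} {k : β → OComp n γ} (ht : Grows q t)
    (hk : ∀ b, Grows q' (k b)) : Grows (q + q') (t.bind k) := by
  intro T a ha
  rw [lazy_bind] at ha
  obtain ⟨b, hb, hb'⟩ := (PMF.mem_support_bind_iff _ _ _).1 ha
  have h1 := ht _ _ hb
  have h2 := hk _ _ _ hb'
  omega

theorem mono {q' : ℕ} {t : OComp n β} (ht : Grows q t) (h : q ≤ q') : Grows q' t :=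
  fun T a ha => (ht T a ha).trans (by omega)

end OComp.Grows

theorem grows_runStepsO {n : ℕ} {E : Type} {oh : OHandler n E} (hoh : ∀ p x e, (oh p x e).Grows 1)
    (B m : ℕ) (c : Config E) : (runStepsO oh B m c).Grows m := by
  induction m generalizing c with
  | zero => exact .ret _
  | succ m ih =>
    rw [runStepsO]
    split_ifs
    · exact .ret _
    · refine (OComp.Grows.bind (q := 1) ?_ ih).mono (by omega)
      unfold stepO
      split
      · exact (OComp.Grows.bind (hoh _ _ _) fun a => .ret (q := 0) _)
      · exact .samp fun c => .ret _

theorem Searcher.grows_respondO (F : Searcher) (n : ℕ) (pk k : List Bool) :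
    (F.respondO n pk k).Grows (F.time.eval (n + pk.length + k.length)) := by
  refine (OComp.Grows.bind (grows_runStepsO ?_ _ _ _) fun c => .ret (q := 0) _).mono (by omega)
  intro p x e
  cases p
  · exact .query fun v => .ret (q := 0) _
  all_goals exact .ret _

theorem eval_mono (p : Polynomial ℕ) {a b : ℕ} (h : a ≤ b) : p.eval a ≤ p.eval b := by
  induction p using Polynomial.induction_on' with
  | add p q hp hq => simpa using add_le_add hp hq
  | monomial k c => simpa using Nat.mul_le_mul_left c (Nat.pow_le_pow_left h k)

theorem length_inputs_le (x y z : List Bool) (i : ℕ) :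
    (inputs x y z i).length ≤ x.length + y.length + z.length := by
  unfold inputs
  split
  · omega
  · omega
  · omega
  · simp

section Game

variable {S : IdScheme} {F : Searcher} {α : ℝ} {l R n Q : ℕ} {sk pk : List Bool} {ζ p : ℝ≥0∞}

theorem grows_ghostHandler {X : ℕ} (P : Port) (x : List Bool) (hx : x.length ≤ X)
    (g : GhostState S) : (ghostHandler S F α l R n sk pk P x g).Grows
      (F.time.eval (n + (pair pk (unary l)).length + X) + 2) := by
  have hver : ∀ round key count inner,
      (ghostVerify S α l R n pk g round key count inner x).Grows 2 := by
    intro round key count inner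
    unfold ghostVerify
    split_ifs
    · refine .query fun v => .query fun v' => ?_
      exact .samp fun k => .ret _
    · exact .query fun v => .query fun v' => .ret _
    · refine .samp fun a => ?_
      split <;> exact .ret _
  unfold ghostHandler
  cases P with
  | hash => exact (OComp.Grows.query fun v => .ret (q := 0) _).mono (by omega)
  | session =>
    dsimp only
    split
    · exact .samp fun s => .ret _
    · exact .ret _
  | prover =>
    dsimp only
    split
    · split_ifs
      · exact .ret _
      · refine (OComp.Grows.bind (F.grows_respondO _ _ _) fun a => .ret (q := 0) _).mono ?_
        have := eval_mono F.time (show n + (pair pk (unary l)).length + x.length ≤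
          n + (pair pk (unary l)).length + X by omega)
        omega
      · exact .samp fun a => .ret _
    · exact .ret _
  | verifier =>
    dsimp only
    split
    · exact (hver _ _ _ _).mono (by omega)
    · exact (hver _ _ _ _).mono (by omega)
    · exact .ret _

/-- The exponential potential: an upper bound for the expectation of `(1 + ζ)^W`, where `W` is the
final number of rounds won, if every round is won with probability at most `p`. -/
def potential (l R Q : ℕ) (ζ p : ℝ≥0∞) (g : GhostState S) (T : Cache n) : ℝ≥0∞ :=
  match g.verifier with
  | .idle => (1 + ζ * p) ^ R
  | .active round key count _ =>
      if round ≤ R then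
        (1 + ζ) ^ count * ((1 + ζ * p) ^ (R - round) * (1 + ζ * winChance l Q T key g.queries))
      else (1 + ζ) ^ count
  | .done _ count => (1 + ζ) ^ count

open Classical in
theorem expect_potential_ghostVerify_le (hl : l ≤ n) (hα : 0 < α)
    (hQ : Q = ⌊α * timeLimit l⌋₊) (hb : winBound l Q 0 ≤ 1) (T : Cache n)
    (hp : winBound l Q 0 + (T.length + 2 : ℕ) * (2 ^ n)⁻¹ ≤ p) (g : GhostState S) (round : ℕ)
    (hround : round ≤ R) (key : List Bool) (count : ℕ) (inner : Option S.VState) (x : List Bool) :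
    expect ((ghostVerify S α l R n pk g round key count inner x).lazy T)
      (fun a => potential l R Q ζ p a.1.2 a.2) ≤
    (1 + ζ) ^ count * ((1 + ζ * p) ^ (R - round) *
      (1 + ζ * if 0 < round then winChance l Q T key g.queries else 0)) := by
  set win : (Fin n → Bool) → (Fin n → Bool) → ℝ≥0∞ := fun v v' =>
    if 0 < round ∧ Wins α l n g.queries x v v' then 1 else 0 with hwin
  set cont : (Fin n → Bool) × (Fin n → Bool) → OComp n (List Bool × GhostState S) := fun a =>
    let count' := if 0 < round ∧ Wins α l n g.queries x a.1 a.2 then count + 1 else count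
    if round < R then
      .samp _ (PMF.uniformOfFintype (Fin n → Bool)) fun k =>
        .ret (List.ofFn k, ⟨g.session, .active (round + 1) (List.ofFn k) count' inner, 0⟩)
    else .ret ([], ⟨g.session, .active (round + 1) key count' inner, 0⟩) with hcont
  have hsplit : ghostVerify S α l R n pk g round key count inner x =
      OComp.bind (.query (key, (unpair x).1) fun v => .query (key, (unpair x).2) fun v' =>
        .ret (v, v')) cont := by
    unfold ghostVerify
    rw [if_pos hround]
    rfl
  have hpow : ∀ v v', (1 + ζ) ^ (if 0 < round ∧ Wins α l n g.queries x v v' then count + 1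
      else count) = (1 + ζ) ^ count * (1 + ζ * win v v') := by
    intro v v'
    simp only [hwin]
    split_ifs <;> simp [pow_succ]
  have hgrow : OComp.Grows 2 (.query (key, (unpair x).1) fun v => .query (key, (unpair x).2)
      fun v' => .ret (v, v') : OComp n ((Fin n → Bool) × (Fin n → Bool))) :=
    .query fun v => .query fun v' => .ret _
  have hcontE : ∀ a (T' : Cache n), T'.length ≤ T.length + 2 →
      expect ((cont a).lazy T') (fun a => potential l R Q ζ p a.1.2 a.2) ≤
        (1 + ζ) ^ count * (1 + ζ * win a.1 a.2) * (1 + ζ * p) ^ (R - round) := by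
    intro a T' hT'
    rw [← hpow]
    simp only [hcont]
    generalize (if 0 < round ∧ Wins α l n g.queries x a.1 a.2 then count + 1 else count) = cnt
    by_cases hR : round < R
    · have hR' : round + 1 ≤ R := hR
      simp only [hR, hR', if_true, OComp.lazy, expect_bind, expect_pure, potential]
      rw [expect_const_mul, expect_const_mul, expect_add, expect_const,
        expect_const_mul]
      have hsucc : R - round = R - (round + 1) + 1 := by omega
      rw [hsucc, pow_succ]
      gcongr
      refine (expect_winChance_fresh_le hb T').trans (le_trans ?_ hp)
      gcongr
    · have hR' : ¬ round + 1 ≤ R := hR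
      simp [hR, hR', OComp.lazy, expect_pure, potential, show R - round = 0 by omega]
  rw [hsplit, OComp.lazy_bind, expect_bind]
  refine (expect_mono fun a ha => hcontE a.1 a.2 (hgrow T a ha)).trans ?_
  have hre : ∀ a : ((Fin n → Bool) × (Fin n → Bool)) × Cache n,
      (1 + ζ) ^ count * (1 + ζ * win a.1.1 a.1.2) * (1 + ζ * p) ^ (R - round) =
      (1 + ζ) ^ count * ((1 + ζ * p) ^ (R - round) * (1 + ζ * win a.1.1 a.1.2)) :=
    fun a => by ring
  simp only [hre, expect_const_mul, expect_add, expect_const]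
  gcongr
  by_cases h0 : 0 < round
  · simp only [hwin, h0, true_and, if_true]
    exact expect_wins_le hl hα hQ T key x g.queries
  · simp [hwin, h0, expect_const]

/-- No request of the adversary increases the expected potential. -/
theorem expect_potential_le (hl : l ≤ n) (hα : 0 < α)
    (hQ : Q = ⌊α * timeLimit l⌋₊) (hb : winBound l Q 0 ≤ 1) (T : Cache n)
    (hp : winBound l Q 0 + (T.length + 2 : ℕ) * (2 ^ n)⁻¹ ≤ p) (P : Port) (x : List Bool)
    (g : GhostState S) :
    expect ((ghostHandler S F α l R n sk pk P x g).lazy T)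
      (fun a => potential l R Q ζ p a.1.2 a.2) ≤ potential l R Q ζ p g T := by
  obtain ⟨ses, ver, q⟩ := g
  cases P with
  | hash =>
    simp only [ghostHandler, OComp.lazy]
    split
    · next v hv =>
      rw [expect_pure]
      simp only [potential]
      cases ver <;> try exact le_rfl
      simp only
      split_ifs
      · gcongr
        exact winChance_succ_le hb _ _ _
      · exact le_rfl
    · next hx =>
      rw [expect_bind]
      simp only [expect_pure, potential]
      cases ver <;> try exact (expect_const _ _).le
      simp only
      split_ifs
      · simp only [expect_const_mul, expect_add, expect_const]
        gcongr
        exact expect_winChance_cons_le hl hb T _ _ _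
      · exact (expect_const _ _).le
  | session =>
    cases ver <;> simp only [ghostHandler, OComp.lazy, expect_bind, expect_pure, potential,
      expect_const, le_refl]
  | prover =>
    cases ver
    case idle =>
      cases ses with
      | none => simp only [ghostHandler, OComp.lazy, expect_pure, potential, le_refl]
      | some s =>
        simp only [ghostHandler]
        split_ifs
        · simp only [OComp.lazy, expect_pure, potential, le_refl]
        · simp only [OComp.lazy_bind, OComp.lazy, expect_bind, expect_pure, potential,
            expect_const, le_refl]
        · simp only [OComp.lazy, expect_bind, expect_pure, potential, expect_const, le_refl]
    all_goals simp only [ghostHandler, OComp.lazy, expect_pure, potential, le_refl]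
  | verifier =>
    cases ver with
    | idle =>
      refine (expect_potential_ghostVerify_le hl hα hQ hb T hp _ 0 (Nat.zero_le _) _ _ _ _).trans ?_
      simp [potential]
    | active round key count inner =>
      by_cases hR : round ≤ R
      · refine (expect_potential_ghostVerify_le hl hα hQ hb T hp _ round hR _ _ _ _).trans ?_
        simp only [potential, if_pos hR]
        gcongr
        split_ifs
        · exact le_rfl
        · exact zero_le
      · simp only [ghostHandler, ghostVerify, if_neg hR, OComp.lazy, expect_bind, potential]
        refine expect_le fun v _ => expect_le fun a _ => ?_
        obtain ⟨a, reply | b⟩ := a <;> simp [OComp.lazy, expect_pure, hR]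
    | done b count => simp only [ghostHandler, OComp.lazy, expect_pure, potential, le_refl]

/-- The Chernoff bound with weight `1 + ζ = (17 / 16) ^ 4` per round won: the base of the tail bound
is `(1 + ζ * (7 / 32)) / (1 + ζ) ^ (1 / 4)`, which is less than one because `7 / 32 < 1 / 4`. -/
theorem one_add_mul_eq_chernoff_base : (1 + 17985 / 65536 * (7 / 32) : ℝ≥0∞) =
    2223047 / 2228224 * (17 / 16) := by
  have : (1 + 17985 / 65536 * (7 / 32) : ℝ≥0) = 2223047 / 2228224 * (17 / 16) := by
    norm_num
  have h := congrArg (fun x : ℝ≥0 => (x : ℝ≥0∞)) this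
  push_cast at h
  simpa [ENNReal.coe_div] using h

/-- A tail bound: winning a quarter of the rounds has exponentially small probability if each
single round is won with probability at most `7 / 32`. -/
theorem value_collisionAccepted_le (A : Adversary) (hl : l ≤ n) (hα : 0 < α)
    (hQ : Q = ⌊α * timeLimit l⌋₊) {L : ℕ} (hL : n + (pair pk (unary l)).length +
      (A.advice n).length ≤ L) {N : ℕ}
    (hN : A.time.eval n * (F.time.eval (n + (pair pk (unary l)).length +
      A.prog.size * (L + A.time.eval n + 1)) + 2) + 2 ≤ N)
    (hp : winBound l Q 0 + N * (2 ^ n)⁻¹ ≤ 7 / 32) :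
    value (lazyHandler (ghostHandler S F α l R n sk pk)) (A.time.eval n)
      (fun s => s.1.collisionAccepted R) (lazyStart S A n l pk) ≤ (2223047 / 2228224) ^ R := by
  set B := A.time.eval n
  set X := A.prog.size * (L + B + 1)
  set σ := F.time.eval (n + (pair pk (unary l)).length + X) + 2
  have hb : winBound l Q 0 ≤ 1 := (le_self_add.trans hp).trans (by
    rw [ENNReal.div_le_iff (by simp) (by simp)]
    norm_num)
  set ζ : ℝ≥0∞ := 17985 / 65536
  have hy : (17 / 16 : ℝ≥0∞) ^ 4 = 1 + ζ := by
    have : (17 / 16 : ℝ≥0) ^ 4 = 1 + 17985 / 65536 := by norm_num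
    have h := congrArg (fun x : ℝ≥0 => (x : ℝ≥0∞)) this
    push_cast at h
    simpa [ENNReal.coe_div] using h
  have hy1 : (1 : ℝ≥0∞) ≤ 17 / 16 := by
    rw [ENNReal.le_div_iff_mul_le (by simp) (by simp)]
    norm_num
  -- A cache that is too long for the remaining number of steps has infinite potential.
  have key := expect_runSteps_le (h := lazyHandler (ghostHandler S F α l R n sk pk)) (L := L)
    (w := A.prog.size) (B := B)
    (Φ := fun k s => if s.2.length + (k * σ + 2) ≤ N then potential l R Q ζ (7 / 32) s.1 s.2
      else ⊤)
    (f := fun s => (17 / 16) ^ R * s.1.collisionAccepted R) ?_ ?_ ?_ B (lazyStart S A n l pk) ?_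
  · simp only [expect_const_mul] at key
    have hstart : (lazyStart S A n l pk).env.2.length + (B * σ + 2) ≤ N := by
      simpa [lazyStart] using hN
    rw [if_pos hstart] at key
    simp only [lazyStart, potential, ζ, one_add_mul_eq_chernoff_base] at key
    rw [mul_pow, mul_comm] at key
    refine (ENNReal.mul_le_mul_iff_left ?_ ?_).1 key
    · simp
    · refine ENNReal.pow_ne_top (ENNReal.div_ne_top (by simp) (by simp))
  · rintro k ⟨⟨ses, ver, q⟩, T⟩
    simp only
    split_ifs
    · cases ver with
      | idle => simp [GhostState.collisionAccepted]
      | active => simp [GhostState.collisionAccepted]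
      | done b count =>
        simp only [GhostState.collisionAccepted, potential]
        split_ifs with hc
        · rw [mul_one, ← hy, ← pow_mul]
          exact pow_le_pow_right₀ hy1 hc
        · simp
    · exact le_top
  · intro k s
    have : k * σ ≤ (k + 1) * σ := Nat.mul_le_mul_right _ (by omega)
    split_ifs <;> first | exact le_rfl | exact le_top | omega
  · rintro k P x ⟨g, T⟩ hx
    simp only [lazyHandler, expect_map]
    by_cases hT : T.length + ((k + 1) * σ + 2) ≤ N
    · rw [if_pos hT]
      refine (expect_mono (g := fun a => potential l R Q ζ (7 / 32) a.1.2 a.2)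
        fun a ha => ?_).trans (expect_potential_le (p := 7 / 32) hl hα hQ hb T ?_ P x g)
      · have hg := grows_ghostHandler (F := F) (α := α) (l := l) (R := R) (n := n) (sk := sk)
          (pk := pk) P x hx g T a ha
        rw [if_pos]
        have : (k + 1) * σ = k * σ + σ := by ring
        have hσ : a.2.length ≤ T.length + σ := hg
        omega
      · refine le_trans ?_ hp
        gcongr
        omega
    · rw [if_neg hT]
      exact le_top
  · refine ⟨fun i => ?_, ?_⟩
    · refine (length_inputs_le _ _ _ i).trans ?_
      rw [length_unary]
      exact hL.trans (by simp)
    · simp [lazyStart]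

end Game

/-! ### Running a program inside another program -/

/-- The expression with register `i` moved to `ρ i`. -/
def Expr.rename (ρ : ℕ → ℕ) : Expr → Expr
  | .reg i => .reg (ρ i)
  | .empty => .empty
  | .push b e => .push b (e.rename ρ)
  | .first e => .first (e.rename ρ)
  | .tail e => .tail (e.rename ρ)
  | .eq e d => .eq (e.rename ρ) (d.rename ρ)
  | .pair e d => .pair (e.rename ρ) (d.rename ρ)
  | .fst e => .fst (e.rename ρ)
  | .snd e => .snd (e.rename ρ)

theorem Expr.eval_rename {ρ : ℕ → ℕ} {μ μ' : Mem} (e : Expr)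
    (h : ∀ i < e.size, μ' (ρ i) = μ i) : (e.rename ρ).eval μ' = e.eval μ := by
  induction e with
  | reg i => exact h i (by simp [size])
  | empty => rfl
  | push b e ih =>
    simp only [rename, eval, ih fun i hi => h i (by simp only [size]; omega)]
  | eq e d ihe ihd =>
    simp only [rename, eval, ihe fun i hi => h i (by simp only [size]; omega),
      ihd fun i hi => h i (by simp only [size]; omega)]
  | pair e d ihe ihd =>
    simp only [rename, eval, ihe fun i hi => h i (by simp only [size]; omega),
      ihd fun i hi => h i (by simp only [size]; omega)]
  | first e ih => simp only [rename, eval, ih fun i hi => h i (by simp only [size]; omega)]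
  | tail e ih => simp only [rename, eval, ih fun i hi => h i (by simp only [size]; omega)]
  | fst e ih => simp only [rename, eval, ih fun i hi => h i (by simp only [size]; omega)]
  | snd e ih => simp only [rename, eval, ih fun i hi => h i (by simp only [size]; omega)]

theorem Expr.cost_rename {ρ : ℕ → ℕ} {μ μ' : Mem} (e : Expr)
    (h : ∀ i < e.size, μ' (ρ i) = μ i) : (e.rename ρ).cost μ' = e.cost μ := by
  have hev : ∀ d : Expr, d.size ≤ e.size → (d.rename ρ).eval μ' = d.eval μ :=
    fun d hd => d.eval_rename fun i hi => h i (by omega)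
  induction e with
  | reg i => simp only [rename, cost, h i (by simp [size])]
  | empty => rfl
  | push b e ih =>
    have h1 := hev (.push b e) le_rfl
    simp only [rename] at h1
    simp only [rename, cost, h1, ih (fun i hi => h i (by simp only [size]; omega))
      fun d hd => hev d (by simp only [size]; omega)]
  | eq e d ihe ihd =>
    have h1 := hev (.eq e d) le_rfl
    simp only [rename] at h1
    simp only [rename, cost, h1, ihe (fun i hi => h i (by simp only [size]; omega))
      fun d hd => hev d (by simp only [size]; omega), ihd (fun i hi => h i (by simp only [size]; omega))
      fun d hd => hev d (by simp only [size]; omega)]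
  | pair e d ihe ihd =>
    have h1 := hev (.pair e d) le_rfl
    simp only [rename] at h1
    simp only [rename, cost, h1, ihe (fun i hi => h i (by simp only [size]; omega))
      fun d hd => hev d (by simp only [size]; omega), ihd (fun i hi => h i (by simp only [size]; omega))
      fun d hd => hev d (by simp only [size]; omega)]
  | first e ih =>
    have h1 := hev (.first e) le_rfl
    simp only [rename] at h1
    simp only [rename, cost, h1, ih (fun i hi => h i (by simp only [size]; omega))
      fun d hd => hev d (by simp only [size]; omega)]
  | tail e ih =>
    have h1 := hev (.tail e) le_rfl
    simp only [rename] at h1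
    simp only [rename, cost, h1, ih (fun i hi => h i (by simp only [size]; omega))
      fun d hd => hev d (by simp only [size]; omega)]
  | fst e ih =>
    have h1 := hev (.fst e) le_rfl
    simp only [rename] at h1
    simp only [rename, cost, h1, ih (fun i hi => h i (by simp only [size]; omega))
      fun d hd => hev d (by simp only [size]; omega)]
  | snd e ih =>
    have h1 := hev (.snd e) le_rfl
    simp only [rename] at h1
    simp only [rename, cost, h1, ih (fun i hi => h i (by simp only [size]; omega))
      fun d hd => hev d (by simp only [size]; omega)]

theorem Expr.eval_rename_congr {ρ : ℕ → ℕ} {μ μ' : Mem} (y : Expr)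
    (h : ∀ i, μ' (ρ i) = μ (ρ i)) :
    (y.rename ρ).eval μ' = (y.rename ρ).eval μ ∧ (y.rename ρ).cost μ' = (y.rename ρ).cost μ :=
  ⟨(y.eval_rename fun i _ => h i).trans (y.eval_rename (μ := fun i => μ (ρ i)) fun _ _ => rfl).symm,
    (y.cost_rename fun i _ => h i).trans
      (y.cost_rename (μ := fun i => μ (ρ i)) fun _ _ => rfl).symm⟩

/-- The program with register `i` moved to `ρ i` and every request replaced by a program. -/
def Cmd.compile (ρ : ℕ → ℕ) (a : ℕ → Port → Expr → Cmd) : Cmd → Cmd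
  | .skip => .skip
  | .assign i e => .assign (ρ i) (e.rename ρ)
  | .coin i => .coin (ρ i)
  | .ask i p e => a (ρ i) p (e.rename ρ)
  | .gate g e d => .gate g (e.rename ρ) (d.rename ρ)
  | .measure i e => .measure (ρ i) (e.rename ρ)
  | .seq c d => .seq (c.compile ρ a) (d.compile ρ a)
  | .cond e c d => .cond (e.rename ρ) (c.compile ρ a) (d.compile ρ a)
  | .loop e c => .loop (e.rename ρ) (c.compile ρ a)

theorem Cmd.IsClassical.compile {ρ : ℕ → ℕ} {a : ℕ → Port → Expr → Cmd}
    (ha : ∀ i p e, (a i p e).IsClassical) (c : Cmd) (hc : c.IsClassical) :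
    (c.compile ρ a).IsClassical := by
  induction c with
  | ask i p e => exact ha _ _ _
  | seq c d ihc ihd => exact ⟨ihc hc.1, ihd hc.2⟩
  | cond e c d ihc ihd => exact ⟨ihc hc.1, ihd hc.2⟩
  | loop e c ih => exact ih hc
  | gate g e d => exact hc
  | measure i e => exact hc
  | _ => trivial

section Simulation

variable {E E' : Type}

/-- The program that answers a request of the simulated program, `a (ρ i) p x`, takes time at
most `D`, apart from the length of the reply if `slack` is set. It leaves the invariant `J` intact
or leads to a state of the environments that satisfies `Term`. -/
def SimulatesAsk (h : Handler E) (h' : Handler E') (B' : ℕ) (acc : E' → ℝ≥0∞) (ρ : ℕ → ℕ)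
    (a : ℕ → Port → Expr → Cmd) (w X D : ℕ) (slack : Bool)
    (J : ℕ → E → Mem → QState → E' → Prop) (Term : E → E' → Prop) : Prop :=
  ∀ (k i : ℕ) (p : Port) (x : Expr) (e : E) (μ : Mem) (ψ : QState) (e' : E') (K : List Cmd) (t : ℕ)
    (g : List Bool × E → ℝ≥0∞), i < w → (x.rename ρ).cost μ ≤ X → J (k + 1) e μ ψ e' → t + D ≤ B' →
    (∀ b ∈ (h p ((x.rename ρ).eval μ) e).support, ∀ μ' ψ' e'' t',
      t' ≤ t + D + (if slack then b.1.length else 0) →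
      ((μ' (ρ i) = b.1 ∧ (∀ j < w, j ≠ i → μ' (ρ j) = μ (ρ j)) ∧ ψ' = ψ ∧ J k b.2 μ' ψ' e'') ∨
        Term b.2 e'') →
      g b ≤ value h' B' acc ⟨K, μ', ψ', e'', t'⟩) →
    expect (h p ((x.rename ρ).eval μ) e) g ≤
      value h' B' acc ⟨a (ρ i) p (x.rename ρ) :: K, μ, ψ, e', t⟩

variable {h : Handler E} {h' : Handler E'} {B B' : ℕ} {acc : E' → ℝ≥0∞} {ρ : ℕ → ℕ}
  {a : ℕ → Port → Expr → Cmd} {w L D N : ℕ} {slack track : Bool}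
  {J : ℕ → E → Mem → QState → E' → Prop} {Term : E → E' → Prop} {f : Config E → ℝ≥0∞}
  {K : List Cmd}

/-- The compiled program does at least as well as the original one. The flag `track` says that both
programs work on the same quantum memory; otherwise the original program is classical. -/
theorem expect_runSteps_le_value_compile (hρ : Function.Injective ρ)
    (hmono : ∀ k e μ ψ e', J (k + 1) e μ ψ e' → J k e μ ψ e')
    (hreg : ∀ k e μ ψ e' i x, J k e μ ψ e' → J k e (Function.update μ (ρ i) x) ψ e')
    (hqmem : track = true → ∀ k e μ ψ ψ' e', J k e μ ψ e' → J k e μ ψ' e')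
    (hask : SimulatesAsk h h' B' acc ρ a w (w * (L + B + 1)) D slack J Term)
    (hterm : ∀ e e', Term e e' → ∀ m c todo μ ψ t, c.env = e →
      expect (runSteps h B m c) f ≤ value h' B' acc ⟨todo, μ, ψ, e', t⟩)
    (hend : ∀ k c μ ψ e' t, c.todo = [] → J k c.env μ ψ e' → (∀ i < w, μ (ρ i) = c.mem i) →
      (slack = false → t ≤ N) → f c ≤ value h' B' acc ⟨K, μ, ψ, e', t⟩)
    (hcut : ∀ k c μ ψ e' t todo, c.todo ≠ [] → J k c.env μ ψ e' →
      f c ≤ value h' B' acc ⟨todo, μ, ψ, e', t⟩)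
    (hD : 2 * (w * (L + B + 1)) + 1 ≤ D) (hN : N ≤ B') (m : ℕ) (c : Config E) (μ : Mem)
    (ψ : QState) (e' : E') (t : ℕ) (hc : c.Bounded L w) (hJ : J m c.env μ ψ e')
    (hμ : ∀ i < w, μ (ρ i) = c.mem i) (hψ : track = true → ψ = c.qmem)
    (hcl : track = false → ∀ p ∈ c.todo, p.IsClassical)
    (ht : t + m * D + (if slack then B - c.time else 0) ≤ N ∨ slack = true ∧ B ≤ c.time) :
    expect (runSteps h B m c) f ≤
      value h' B' acc ⟨c.todo.map (Cmd.compile ρ a) ++ K, μ, ψ, e', t⟩ := by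
  induction m generalizing c μ ψ e' t with
  | zero =>
    rw [runSteps, expect_pure]
    by_cases h1 : c.todo = []
    · rw [h1]
      refine hend 0 c μ ψ e' t h1 hJ hμ fun hs => ?_
      simp only [hs] at ht
      simpa using ht
    · exact hcut 0 c _ _ _ _ _ h1 hJ
  | succ m ih =>
    by_cases h1 : c.todo = []
    · rw [runSteps_of_todo_nil _ _ _ _ h1, expect_pure, h1]
      refine hend _ c μ ψ e' t h1 hJ hμ fun hs => ?_
      simp only [hs] at ht
      simp only [Bool.false_eq_true, if_false, add_zero, false_and, or_false] at ht
      omega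
    by_cases h2 : B ≤ c.time
    · rw [runSteps_of_le_time _ _ _ _ h2, expect_pure]
      exact hcut _ c _ _ _ _ _ h1 hJ
    have hstep : ∀ c' ∈ (step h c).support, c'.Bounded L w := hc.step
    have hcost := hc.cost_le (B := B) (by omega)
    rw [runSteps_succ _ _ _ _ h1 (by omega), expect_bind]
    obtain ⟨todo, ν, ψ₀, e, s⟩ := c
    obtain ⟨p, Q, rfl⟩ := List.exists_cons_of_ne_nil h1
    simp only at hJ hμ hψ ht h2 hcost
    have hmD : (m + 1) * D = m * D + D := by ring
    rw [hmD] at ht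
    have ht' : t + (m * D + D) + (if slack then B - s else 0) ≤ N := ht.resolve_right fun h => h2 h.2
    have htB : t + D ≤ B' := by omega
    have htB' : t < B' := by omega
    -- The time left after a step that costs the simulation at most `D`.
    have hnext : ∀ t' s', t' ≤ t + D → s ≤ s' →
        t' + m * D + (if slack then B - s' else 0) ≤ N ∨ slack = true ∧ B ≤ s' := by
      intro t' s' h3 h4
      left
      cases slack <;> simp only [Bool.false_eq_true, if_false, if_true] at ht' ⊢ <;> omega
    have hsize := hc.size_le p List.mem_cons_self
    have hclp : track = false → p.IsClassical := fun h => hcl h p List.mem_cons_self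
    have hclQ : track = false → ∀ q ∈ Q, q.IsClassical :=
      fun h q hq => hcl h q (List.mem_cons_of_mem _ hq)
    have hev : ∀ x : Expr, x.size ≤ w → (x.rename ρ).eval μ = x.eval ν :=
      fun x hx => x.eval_rename fun i hi => hμ i (by omega)
    have hco : ∀ x : Expr, x.size ≤ w → (x.rename ρ).cost μ = x.cost ν :=
      fun x hx => x.cost_rename fun i hi => hμ i (by omega)
    have hupd : ∀ (i : ℕ) (x : List Bool), ∀ j < w, Function.update μ (ρ i) x (ρ j) =
        Function.update ν i x j := by
      intro i x j hj
      simp only [Function.update_apply, hρ.eq_iff, hμ j hj]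
    cases p with
    | skip =>
      simp only [step, PMF.support_pure, Set.mem_singleton_iff, forall_eq] at hstep
      simp only [step, expect_pure, List.map_cons, List.cons_append, Cmd.compile]
      refine le_value_skip htB' ?_
      exact ih _ _ _ _ _ hstep (hmono _ _ _ _ _ hJ) hμ hψ hclQ (hnext _ _ (by omega) (by simp))
    | assign i x =>
      simp only [step, PMF.support_pure, Set.mem_singleton_iff, forall_eq] at hstep
      simp only [step, expect_pure, List.map_cons, List.cons_append, Cmd.compile]
      simp only [Cmd.size] at hsize
      refine le_value_assign (w * (L + B + 1)) ?_ htB' fun t' ht' => ?_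
      · rw [hco x (by omega)]
        exact hcost x (by omega)
      · rw [hev x (by omega)]
        exact ih _ _ _ _ _ hstep (hreg _ _ _ _ _ _ _ (hmono _ _ _ _ _ hJ)) (hupd _ _) hψ hclQ
          (hnext _ _ (by omega) (by simp only; omega))
    | coin i =>
      simp only [step, expect_map, List.map_cons, List.cons_append, Cmd.compile]
      refine le_value_coin htB' fun b => ?_
      exact ih _ _ _ _ _ (hstep _ ((PMF.mem_support_map_iff _ _ _).2 ⟨b, by simp, rfl⟩))
        (hreg _ _ _ _ _ _ _ (hmono _ _ _ _ _ hJ)) (hupd _ _) hψ hclQ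
        (hnext _ _ (by omega) (by simp))
    | ask i p x =>
      simp only [step, expect_map, List.map_cons, List.cons_append, Cmd.compile]
      simp only [Cmd.size] at hsize
      rw [← hev x (by omega)]
      refine hask m i p x e μ ψ e' _ t _ (by omega) ?_ hJ htB ?_
      · rw [hco x (by omega)]
        exact hcost x (by omega)
      intro b hb μ' ψ' e'' t' ht'' hor
      rcases hor with ⟨g1, g2, rfl, g4⟩ | hT
      · refine ih _ _ _ _ _ (hstep _ ((PMF.mem_support_map_iff _ _ _).2
          ⟨b, by rwa [← hev x (by omega)], rfl⟩)) g4 ?_ hψ hclQ ?_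
        · intro j hj
          simp only [Function.update_apply]
          split_ifs with hji
          · rw [hji, g1]
          · rw [g2 j hj hji, hμ j hj]
        · simp only
          rcases Nat.lt_or_ge (s + 1 + x.cost ν + b.1.length) B with h3 | h3
          · left
            cases slack <;> simp only [Bool.false_eq_true, if_false, if_true] at ht' ht'' ⊢ <;>
              omega
          · cases slack
            · left
              simp only [Bool.false_eq_true, if_false] at ht' ht'' ⊢
              omega
            · exact Or.inr ⟨rfl, h3⟩
      · exact hterm _ _ hT _ _ _ _ _ _ rfl
    | gate g x y =>
      simp only [step, PMF.support_pure, Set.mem_singleton_iff, forall_eq] at hstep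
      simp only [step, expect_pure, List.map_cons, List.cons_append, Cmd.compile]
      simp only [Cmd.size] at hsize
      cases htr : track with
      | false => exact absurd (hclp htr) (by simp [Cmd.IsClassical])
      | true =>
        refine le_value_gate (2 * (w * (L + B + 1))) ?_ htB' fun t' ht' => ?_
        · rw [hco x (by omega), hco y (by omega)]
          have h3 := hcost x (by omega)
          have h4 := hcost y (by omega)
          omega
        · rw [hev x (by omega), hev y (by omega), hψ htr]
          exact ih _ _ _ _ _ hstep (hqmem htr _ _ _ _ _ _ (hmono _ _ _ _ _ hJ)) hμ (fun _ => rfl)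
            hclQ (hnext _ _ (by omega) (by simp only; omega))
    | measure i x =>
      simp only [step, expect_map, List.map_cons, List.cons_append, Cmd.compile]
      simp only [Cmd.size] at hsize
      cases htr : track with
      | false => exact absurd (hclp htr) (by simp [Cmd.IsClassical])
      | true =>
        rw [← hψ htr, ← hev x (by omega)]
        refine le_value_measure (w * (L + B + 1)) ?_ htB' fun b hb t' ht' => ?_
        · rw [hco x (by omega)]
          exact hcost x (by omega)
        · refine ih _ _ _ _ _ ?_
            (hreg _ _ _ _ _ _ _ (hqmem htr _ _ _ _ _ _ (hmono _ _ _ _ _ hJ))) (hupd _ _)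
            (fun _ => rfl) hclQ (hnext _ _ (by omega) (by simp only; omega))
          rw [hψ htr, hev x (by omega)] at hb ⊢
          exact hstep _ ((PMF.mem_support_map_iff _ _ _).2 ⟨b, hb, rfl⟩)
    | seq p q =>
      simp only [step, PMF.support_pure, Set.mem_singleton_iff, forall_eq] at hstep
      simp only [step, expect_pure, List.map_cons, List.cons_append, Cmd.compile]
      refine le_value_seq htB' ?_
      refine ih _ _ _ _ _ hstep (hmono _ _ _ _ _ hJ) hμ hψ ?_ (hnext _ _ (by omega) (by simp))
      intro htr
      simp only [List.mem_cons, forall_eq_or_imp]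
      exact ⟨(hclp htr).1, (hclp htr).2, hclQ htr⟩
    | cond x p q =>
      simp only [step, PMF.support_pure, Set.mem_singleton_iff, forall_eq] at hstep
      simp only [step, expect_pure, List.map_cons, List.cons_append, Cmd.compile]
      simp only [Cmd.size] at hsize
      refine le_value_cond (w * (L + B + 1)) ?_ htB' fun t' ht' => ?_
      · rw [hco x (by omega)]
        exact hcost x (by omega)
      · rw [hev x (by omega)]
        have := ih _ _ _ _ t' hstep (hmono _ _ _ _ _ hJ) hμ hψ ?_
          (hnext _ _ (by omega) (by simp only; omega))
        · refine this.trans (le_of_eq ?_)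
          split_ifs <;> rfl
        · intro htr
          simp only [List.mem_cons, forall_eq_or_imp]
          refine ⟨?_, hclQ htr⟩
          split_ifs
          · exact (hclp htr).2
          · exact (hclp htr).1
    | loop x p =>
      simp only [step, PMF.support_pure, Set.mem_singleton_iff, forall_eq] at hstep
      simp only [step, expect_pure, List.map_cons, List.cons_append, Cmd.compile]
      simp only [Cmd.size] at hsize
      refine le_value_loop (w * (L + B + 1)) ?_ htB' fun t' ht' => ?_
      · rw [hco x (by omega)]
        exact hcost x (by omega)
      · rw [hev x (by omega)]
        have := ih _ _ _ _ t' hstep (hmono _ _ _ _ _ hJ) hμ hψ ?_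
          (hnext _ _ (by omega) (by simp only; omega))
        · refine this.trans (le_of_eq ?_)
          split_ifs <;> rfl
        · intro htr
          simp only
          split_ifs
          · exact hclQ htr
          · simp only [List.mem_cons, forall_eq_or_imp]
            exact ⟨hclp htr, hclp htr, hclQ htr⟩

end Simulation

/-! ### Lazy sampling by a program

The registers of the reduction are divided by their residue modulo 5: residue 0 is for the
adversary, residue 1 for bookkeeping, residue 2 for the honest prover's program, residues 3 and 4
for the programs that compute `1^ℓ` and `1^r`. The names of bookkeeping registers are notations
for numerals, so that decision procedures see which registers differ.

`regPk` holds the public key of the given scheme, `regFullPk` that of the augmented scheme,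
`regParam` the security parameter and `regRounds` the number of rounds, both in unary. `regOpen`
says whether a session with the honest prover is open, `regFresh` whether the prover's first
message in it is due, and `regLeft` has one bit for every message that the prover still has to send
before the given scheme starts. `regMet` says whether the verifier has been contacted, `regVLeft`
has one bit for every message still due from the verifier before the given scheme starts, and
`regKey` holds the round key. `regCache` holds the digests sampled so far. The others are scratch
registers. -/

notation "regPk" => 1
notation "regFullPk" => 6
notation "regParam" => 11
notation "regRounds" => 16
notation "regOpen" => 21
notation "regFresh" => 26
notation "regLeft" => 31
notation "regMet" => 36
notation "regVLeft" => 41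
notation "regKey" => 46
notation "regCache" => 51
notation "regQuery" => 56
notation "regCursor" => 61
notation "regFound" => 66
notation "regResult" => 71
notation "regCount" => 76
notation "regCoin" => 81

/-- Bookkeeping registers that a hash evaluation may change. -/
def IsScratch (i : ℕ) : Prop := i % 5 = 1 ∧ 51 ≤ i

/-- The encoding of a cache by nested pairs. -/
def Cache.encode {n : ℕ} : Cache n → List Bool
  | [] => []
  | e :: T => pair (pair (pair e.1.1 e.1.2) (List.ofFn e.2)) (Cache.encode T)

theorem pair_ne_nil (x y : List Bool) : pair x y ≠ [] := by
  intro h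
  have := length_pair x y
  rw [h, List.length_nil] at this
  omega

theorem pair_inj {x y x' y' : List Bool} : pair x y = pair x' y' ↔ x = x' ∧ y = y' := by
  refine ⟨fun h => ?_, fun h => by rw [h.1, h.2]⟩
  have := congrArg unpair h
  simpa [unpair_pair] using this

/-- The loop that pushes `|regCount|` random bits to the result. -/
def sampleLoop : Cmd :=
  .loop (.reg regCount) <|
    .seq (.coin regCoin) <|
    .seq (.cond (.eq (.reg regCoin) (.push true .empty))
        (.assign regResult (.push true (.reg regResult)))
        (.assign regResult (.push false (.reg regResult)))) <|
      .assign regCount (.tail (.reg regCount))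

/-- The program that samples a digest. -/
def sampleCmd : Cmd :=
  .seq (.assign regCount (.reg regParam)) <| .seq (.assign regResult .empty) sampleLoop

/-- The loop that searches the cache for the query. -/
def searchLoop : Cmd :=
  .loop (.reg regCursor) <|
    .cond (.eq (.fst (.fst (.reg regCursor))) (.reg regQuery))
      (.seq (.assign regResult (.snd (.fst (.reg regCursor)))) <|
        .seq (.assign regFound (.push true .empty)) (.assign regCursor .empty))
      (.assign regCursor (.snd (.reg regCursor)))

/-- The program that evaluates the lazily sampled oracle. -/
def hashCmd (x : Expr) : Cmd :=
  .seq (.assign regQuery (.pair (.fst x) (.snd x))) <|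
  .seq (.assign regCursor (.reg regCache)) <|
  .seq (.assign regFound .empty) <|
  .seq searchLoop <|
    .cond (.reg regFound) .skip <|
      .seq sampleCmd <|
        .assign regCache (.pair (.pair (.reg regQuery) (.reg regResult)) (.reg regCache))

theorem isClassical_sampleCmd : sampleCmd.IsClassical := by
  simp [sampleCmd, sampleLoop, Cmd.IsClassical]

theorem isClassical_hashCmd (x : Expr) : (hashCmd x).IsClassical := by
  simp [hashCmd, searchLoop, sampleCmd, sampleLoop, Cmd.IsClassical]

theorem expect_uniform_snoc (j : ℕ) (g : (Fin (j + 1) → Bool) → ℝ≥0∞) :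
    expect (PMF.uniformOfFintype (Fin (j + 1) → Bool)) g =
      expect (PMF.uniformOfFintype Bool) fun b =>
        expect (PMF.uniformOfFintype (Fin j → Bool)) fun v => g (Fin.snoc (α := fun _ => Bool) v b) := by
  simp only [expect_uniform]
  rw [← (Fin.snocEquiv fun _ : Fin (j + 1) => Bool).sum_comp, Fintype.sum_prod_type,
    ← Finset.mul_sum, ← mul_assoc]
  congr 1
  rw [← ENNReal.mul_inv (by simp) (by simp)]
  congr 1
  simp [pow_succ, mul_comm]

section Blocks

variable {E : Type} {h : Handler E} {B : ℕ} {f : E → ℝ≥0∞} {K : List Cmd} {ψ : QState} {e : E}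

theorem expect_le_value_sampleLoop {L : ℕ} (j : ℕ) (acc : List Bool) (μ : Mem) (t : ℕ)
    (g : (Fin j → Bool) → ℝ≥0∞) (hcount : μ regCount = unary j) (hres : μ regResult = acc)
    (hL : j + acc.length ≤ L) (hB : t + (j + 1) * (30 * (L + 1)) ≤ B)
    (H : ∀ v μ' t', t' ≤ t + (j + 1) * (30 * (L + 1)) → μ' regResult = List.ofFn v ++ acc →
      (∀ i, i ≠ regCount → i ≠ regCoin → i ≠ regResult → μ' i = μ i) →
      g v ≤ value h B f ⟨K, μ', ψ, e, t'⟩) :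
    expect (PMF.uniformOfFintype (Fin j → Bool)) g ≤
      value h B f ⟨sampleLoop :: K, μ, ψ, e, t⟩ := by
  induction j generalizing acc μ t with
  | zero =>
    refine le_value_loop 1 (by simp [Expr.cost, hcount, unary]) (by omega) fun t' ht' => ?_
    rw [if_pos (by simp [Expr.eval, hcount, unary])]
    refine expect_le fun v _ => ?_
    exact H v μ t' (by omega) (by simp [hres]) fun i _ _ _ => rfl
  | succ j ih =>
    have hj : (j + 1 + 1) * (30 * (L + 1)) = (j + 1) * (30 * (L + 1)) + 30 * (L + 1) := by ring
    rw [hj] at hB H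
    refine le_value_loop (1 + (j + 1)) (by simp [Expr.cost, hcount, unary]) (by omega)
      fun t1 ht1 => ?_
    rw [if_neg (by simp [Expr.eval, hcount, unary])]
    rw [expect_uniform_snoc]
    refine le_value_seq (by omega) ?_
    refine le_value_coin (by omega) fun b => ?_
    refine le_value_seq (by omega) ?_
    refine le_value_cond 9 ?_ (by omega) fun t2 ht2 => ?_
    · simp only [Expr.cost, Expr.eval, Function.update_self]
      split_ifs <;> simp
    have hif : (if Expr.eval (Function.update μ regCoin [b])
          (.eq (.reg regCoin) (.push true .empty)) = [] then
        Cmd.assign regResult (.push false (.reg regResult)) else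
        Cmd.assign regResult (.push true (.reg regResult))) =
        .assign regResult (.push b (.reg regResult)) := by
      cases b <;> simp [Expr.eval]
    rw [hif]
    refine le_value_assign (4 + 2 * L) ?_ (by omega) fun t3 ht3 => ?_
    · simp [Expr.cost, Expr.eval, hres]
      omega
    refine le_value_assign (4 + 2 * L) ?_ (by omega) fun t4 ht4 => ?_
    · simp [Expr.cost, Expr.eval, hcount, unary]
      omega
    refine ih (b :: acc) _ t4 _ ?_ ?_ ?_ ?_ ?_
    · simp [Expr.eval, hcount, unary]
    · simp [Expr.eval, hres]
    · simp only [List.length_cons]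
      omega
    · omega
    · intro v μ' t' ht' hr hfr
      refine H _ μ' t' (by omega) ?_ fun i h1 h2 h3 => ?_
      · rw [hr, List.ofFn_succ_last]
        simp [Fin.snoc]
      · rw [hfr i h1 h2 h3]
        simp [h1, h2, h3]

theorem expect_le_value_sampleCmd {L n : ℕ} (μ : Mem) (t : ℕ)
    (g : (Fin n → Bool) → ℝ≥0∞) (hn : μ regParam = unary n) (hL : n ≤ L)
    (hB : t + 40 * ((L + 1) * (L + 1)) ≤ B)
    (H : ∀ v μ' t', t' ≤ t + 40 * ((L + 1) * (L + 1)) → μ' regResult = List.ofFn v →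
      (∀ i, i ≠ regCount → i ≠ regCoin → i ≠ regResult → μ' i = μ i) →
      g v ≤ value h B f ⟨K, μ', ψ, e, t'⟩) :
    expect (PMF.uniformOfFintype (Fin n → Bool)) g ≤
      value h B f ⟨sampleCmd :: K, μ, ψ, e, t⟩ := by
  have hcost : (n + 1) * (30 * (L + 1)) ≤ 30 * ((L + 1) * (L + 1)) := by nlinarith
  have hL1 : L + 1 ≤ (L + 1) * (L + 1) := by nlinarith
  refine le_value_seq (by omega) ?_
  refine le_value_assign (1 + n) (by simp [Expr.cost, hn, unary]) (by omega) fun t1 ht1 => ?_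
  refine le_value_seq (by omega) ?_
  refine le_value_assign 1 (by simp [Expr.cost]) (by omega) fun t2 ht2 => ?_
  refine expect_le_value_sampleLoop (L := L) n [] _ _ g ?_ ?_ (by simpa using hL) (by omega) ?_
  · simp [Expr.eval, hn]
  · simp [Expr.eval]
  · intro v μ' t' ht' hr hfr
    refine H v μ' t' (by omega) (by simpa using hr) fun i h1 h2 h3 => ?_
    rw [hfr i h1 h2 h3]
    simp [h1, h3]

theorem le_value_searchLoop {L n : ℕ} (T : Cache n) (x : List Bool × List Bool) (μ : Mem) (t : ℕ)
    (X : ℝ≥0∞) (hcur : μ regCursor = T.encode) (hq : μ regQuery = pair x.1 x.2)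
    (hfound : μ regFound = []) (hL : T.encode.length ≤ L) (hqL : (pair x.1 x.2).length ≤ L)
    (hB : t + (T.length + 1) * (30 * (L + 1)) ≤ B)
    (H : ∀ μ' t', t' ≤ t + (T.length + 1) * (30 * (L + 1)) →
      (match T.lookup x with
        | some v => μ' regFound = [true] ∧ μ' regResult = List.ofFn v
        | none => μ' regFound = []) →
      (∀ i, i ≠ regCursor → i ≠ regFound → i ≠ regResult → μ' i = μ i) →
      X ≤ value h B f ⟨K, μ', ψ, e, t'⟩) :
    X ≤ value h B f ⟨searchLoop :: K, μ, ψ, e, t⟩ := by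
  induction T generalizing μ t with
  | nil =>
    simp only [Cache.encode] at hcur
    simp only [List.length_nil, zero_add, one_mul] at hB H
    refine le_value_loop 1 (by simp [Expr.cost, hcur]) (by omega) fun t' ht' => ?_
    rw [if_pos (by simp [Expr.eval, hcur])]
    exact H μ t' (by omega) (by simpa using hfound) fun i _ _ _ => rfl
  | cons y T ih =>
    obtain ⟨y, v⟩ := y
    have hlen : (T.length + 1 + 1) * (30 * (L + 1)) =
        (T.length + 1) * (30 * (L + 1)) + 30 * (L + 1) := by ring
    rw [List.length_cons, hlen] at hB H
    simp only [Cache.encode] at hcur hL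
    have h1 := length_pair (pair (pair y.1 y.2) (List.ofFn v)) (Cache.encode T)
    have h2 := length_pair (pair y.1 y.2) (List.ofFn v)
    refine le_value_loop (1 + L) (by simp [Expr.cost, hcur]; omega) (by omega) fun t1 ht1 => ?_
    rw [if_neg (by simpa [Expr.eval, hcur] using pair_ne_nil _ _)]
    refine le_value_cond (5 * L + 10) ?_ (by omega) fun t2 ht2 => ?_
    · simp only [Expr.cost, Expr.eval, hcur, hq, unpair_pair]
      split_ifs <;> simp <;> omega
    by_cases hxy : x = y
    · subst hxy
      rw [if_neg (by simp [Expr.eval, hcur, hq, unpair_pair])]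
      refine le_value_seq (by omega) ?_
      refine le_value_assign (3 * L + 10) ?_ (by omega) fun t3 ht3 => ?_
      · simp only [Expr.cost, Expr.eval, hcur, unpair_pair]
        omega
      refine le_value_seq (by omega) ?_
      refine le_value_assign 3 (by simp [Expr.cost, Expr.eval]) (by omega) fun t4 ht4 => ?_
      refine le_value_assign 1 (by simp [Expr.cost]) (by omega) fun t5 ht5 => ?_
      refine le_value_loop 1 (by simp [Expr.cost, Expr.eval]) (by omega) fun t6 ht6 => ?_
      rw [if_pos (by simp [Expr.eval])]
      refine H _ t6 (by omega) ?_ fun i h3 h4 h5 => ?_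
      · simp [Expr.eval, hcur, unpair_pair]
      · simp [h3, h4, h5]
    · have hne : ¬ (pair y.1 y.2 = pair x.1 x.2) := by
        rw [pair_inj]
        exact fun h => hxy (Prod.ext h.1.symm h.2.symm)
      rw [if_pos (by simp [Expr.eval, hcur, hq, unpair_pair, hne])]
      refine le_value_assign (2 * L + 10) ?_ (by omega) fun t3 ht3 => ?_
      · simp only [Expr.cost, Expr.eval, hcur, unpair_pair]
        omega
      refine ih _ t3 ?_ ?_ ?_ (by omega) (by omega) fun μ' t' ht' hres hfr => ?_
      · simp [Expr.eval, hcur, unpair_pair]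
      · simp [hq]
      · simp [hfound]
      · refine H μ' t' (by omega) ?_ fun i h3 h4 h5 => ?_
        · rw [List.lookup_cons, beq_false_of_ne hxy]
          exact hres
        · rw [hfr i h3 h4 h5]
          simp [h3]

theorem length_le_length_encode {n : ℕ} (T : Cache n) : T.length ≤ T.encode.length := by
  induction T with
  | nil => simp
  | cons y T ih =>
    simp only [Cache.encode, length_pair, List.length_cons]
    omega

/-- The time that the evaluation of the lazily sampled oracle takes. -/
def hashCost (C L : ℕ) : ℕ := 2 * C + 150 * ((L + 1) * (L + 1))

theorem expect_le_value_hashCmd {L n C : ℕ} (T : Cache n) (x : Expr) (μ : Mem) (t : ℕ)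
    (g : (Fin n → Bool) × Cache n → ℝ≥0∞) (hcache : μ regCache = T.encode)
    (hn : μ regParam = unary n) (hC : x.cost μ ≤ C) (hTL : T.encode.length ≤ L)
    (hxL : 2 * (x.eval μ).length + 1 ≤ L) (hnL : n ≤ L) (hB : t + hashCost C L ≤ B)
    (H : ∀ v T' μ' t', t' ≤ t + hashCost C L →
      (v, T') ∈ ((OComp.query (unpair (x.eval μ)) fun v => .ret v).lazy T).support →
      (T' = T ∨ T' = (unpair (x.eval μ), v) :: T) → μ' regResult = List.ofFn v →
      μ' regCache = Cache.encode T' → (∀ i, ¬ IsScratch i → μ' i = μ i) →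
      g (v, T') ≤ value h B f ⟨K, μ', ψ, e, t'⟩) :
    expect ((OComp.query (unpair (x.eval μ)) fun v => .ret v).lazy T) g ≤
      value h B f ⟨hashCmd x :: K, μ, ψ, e, t⟩ := by
  set y := unpair (x.eval μ) with hy
  have hup := length_unpair_le (x.eval μ)
  rw [← hy] at hup
  have hqL : (pair y.1 y.2).length ≤ L := by
    rw [length_pair]
    omega
  have hcost : (T.length + 1) * (30 * (L + 1)) ≤ 30 * ((L + 1) * (L + 1)) := by
    have := length_le_length_encode T
    nlinarith
  have hL1 : L + 1 ≤ (L + 1) * (L + 1) := by nlinarith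
  have hxC := x.length_eval_lt_cost μ
  unfold hashCost at hB H
  have hfr0 : ∀ i, ¬ IsScratch i → i ≠ regQuery ∧ i ≠ regCursor ∧ i ≠ regFound ∧ i ≠ regResult ∧
      i ≠ regCount ∧ i ≠ regCoin ∧ i ≠ regCache := by
    intro i hi
    unfold IsScratch at hi
    omega
  refine le_value_seq (by omega) ?_
  refine le_value_assign (2 * C + 3 * L + 10) ?_ (by omega) fun t1 ht1 => ?_
  · simp only [Expr.cost, Expr.eval, ← hy]
    omega
  refine le_value_seq (by omega) ?_
  refine le_value_assign (1 + L) ?_ (by omega) fun t2 ht2 => ?_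
  · simpa [Expr.cost, hcache] using hTL
  refine le_value_seq (by omega) ?_
  refine le_value_assign 1 (by simp [Expr.cost]) (by omega) fun t3 ht3 => ?_
  refine le_value_seq (by omega) ?_
  refine le_value_searchLoop T y _ _ _ ?_ ?_ ?_ hTL hqL (by omega) ?_
  · simp [Expr.eval, hcache]
  · simp [Expr.eval, hy]
  · simp [Expr.eval]
  intro μ1 t4 ht4 hres hfr
  have hq1 : μ1 regQuery = pair y.1 y.2 := by
    rw [hfr regQuery (by decide) (by decide) (by decide)]
    simp [Expr.eval, hy]
  have hT1 : μ1 regCache = T.encode := by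
    rw [hfr regCache (by decide) (by decide) (by decide)]
    simp [hcache]
  have hn1 : μ1 regParam = unary n := by
    rw [hfr regParam (by decide) (by decide) (by decide)]
    simp [hn]
  have hfr1 : ∀ i, ¬ IsScratch i → μ1 i = μ i := by
    intro i hi
    obtain ⟨i1, i2, i3, i4, -, -, i7⟩ := hfr0 i hi
    rw [hfr i i2 i3 i4]
    simp [i1, i2, i3]
  cases hlook : T.lookup y with
  | some v =>
    simp only [hlook] at hres
    simp only [OComp.lazy, hlook, expect_pure]
    refine le_value_cond 2 (by simp [Expr.cost, hres]) (by omega) fun t5 ht5 => ?_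
    rw [if_neg (by simp [Expr.eval, hres])]
    refine le_value_skip (by omega) ?_
    exact H v T μ1 _ (by omega) (by simp [OComp.lazy, hlook]) (Or.inl rfl) hres.2 hT1 hfr1
  | none =>
    simp only [hlook] at hres
    simp only [OComp.lazy, hlook, expect_bind, expect_pure]
    refine le_value_cond 1 (by simp [Expr.cost, hres]) (by omega) fun t5 ht5 => ?_
    rw [if_pos (by simp [Expr.eval, hres])]
    refine le_value_seq (by omega) ?_
    refine expect_le_value_sampleCmd (L := L) μ1 _ _ hn1 hnL (by omega) ?_
    intro v μ2 t6 ht6 hres2 hfr2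
    have hq2 : μ2 regQuery = pair y.1 y.2 := by
      rw [hfr2 regQuery (by decide) (by decide) (by decide), hq1]
    have hT2 : μ2 regCache = T.encode := by
      rw [hfr2 regCache (by decide) (by decide) (by decide), hT1]
    refine le_value_assign (20 * L + 20) ?_ (by omega) fun t7 ht7 => ?_
    · simp only [Expr.cost, Expr.eval, hq2, hT2, hres2, length_pair] at hqL ⊢
      simp only [List.length_ofFn]
      omega
    refine H v _ _ t7 (by omega) (by simp [OComp.lazy, hlook]) (Or.inr rfl) ?_ ?_ fun i hi => ?_
    · simp [hres2]
    · simp [Expr.eval, hq2, hT2, hres2, Cache.encode]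
    · obtain ⟨i1, i2, i3, i4, i5, i6, i7⟩ := hfr0 i hi
      rw [Function.update_of_ne i7, hfr2 i i5 i6 i4, hfr1 i hi]

end Blocks

/-! ### Running the honest prover's program -/

/-- The cache has at most `N` entries, for keys and messages of total length at most `M`. -/
def Cache.Within {n : ℕ} (N M : ℕ) (T : Cache n) : Prop :=
  T.length ≤ N ∧ ∀ e ∈ T, e.1.1.length + e.1.2.length ≤ M

theorem Cache.Within.length_encode_le {n N M : ℕ} {T : Cache n} (hT : T.Within N M) (hn : n ≤ M) :
    T.encode.length ≤ N * (10 * M + 7) := by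
  refine le_trans ?_ (Nat.mul_le_mul_right _ hT.1)
  have h2 := hT.2
  clear hT
  induction T with
  | nil => simp [Cache.encode]
  | cons y T ih =>
    have h3 := ih fun e he => h2 e (List.mem_cons_of_mem _ he)
    have h4 := h2 y List.mem_cons_self
    have h5 : (T.length + 1) * (10 * M + 7) = T.length * (10 * M + 7) + (10 * M + 7) := by ring
    simp only [Cache.encode, length_pair, List.length_cons, List.length_ofFn, h5]
    omega

theorem Cache.Within.cons {n N M : ℕ} {T : Cache n} (hT : T.Within N M) {y : List Bool × List Bool}
    (hy : y.1.length + y.2.length ≤ M) (v : Fin n → Bool) : Cache.Within (N + 1) M ((y, v) :: T) := by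
  refine ⟨by simpa using hT.1, ?_⟩
  simp only [List.mem_cons, forall_eq_or_imp]
  exact ⟨hy, hT.2⟩

theorem Cache.Within.mono {n N N' M : ℕ} {T : Cache n} (hT : T.Within N M) (h : N ≤ N') :
    T.Within N' M := ⟨hT.1.trans h, hT.2⟩

/-- The registers of the honest prover's program. -/
def proverReg (i : ℕ) : ℕ := 5 * i + 2

/-- Requests of the honest prover's program: only the oracle answers. -/
def proverAsk (i : ℕ) (p : Port) (x : Expr) : Cmd :=
  match p with
  | .hash => .seq (hashCmd x) (.assign i (.reg regResult))
  | _ => .assign i .empty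

/-- The program that empties the first `k` registers of the honest prover's program. -/
def clearCmd : ℕ → Cmd
  | 0 => .skip
  | k + 1 => .seq (.assign (proverReg k) .empty) (clearCmd k)

/-- The program that computes the honest prover's reply to the round key `x`. -/
def Searcher.cmd (F : Searcher) (x : Expr) : Cmd :=
  .seq (clearCmd (F.prog.size + 1)) <|
  .seq (.assign (proverReg 0) (.reg regParam)) <|
  .seq (.assign (proverReg 1) (.reg regFullPk)) <|
  .seq (.assign (proverReg 2) x) (F.prog.compile proverReg proverAsk)

theorem Searcher.isClassical_cmd (F : Searcher) (x : Expr) : (F.cmd x).IsClassical := by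
  have h1 : ∀ k, (clearCmd k).IsClassical := by
    intro k
    induction k with
    | zero => trivial
    | succ k ih => exact ⟨trivial, ih⟩
  refine ⟨h1 _, trivial, trivial, trivial, F.classical.compile ?_⟩
  intro i p e
  cases p
  · exact ⟨isClassical_hashCmd _, trivial⟩
  all_goals trivial

theorem Searcher.expect_lazy_respondO (F : Searcher) {n : ℕ} (pk k : List Bool) (T : Cache n)
    (g : List Bool × Cache n → ℝ≥0∞) {B : ℕ} (hB : B = F.time.eval (n + pk.length + k.length)) :
    expect ((F.respondO n pk k).lazy T) g =
      expect (runSteps (lazyHandler (oracleOnly n)) B B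
        ⟨[F.prog], inputs (unary n) pk k, ket ∅, ((), T), 0⟩)
        fun c => if c.todo = [] then g (c.mem 0, c.env.2) else 0 := by
  subst hB
  rw [respondO, OComp.lazy_bind, lazy_runStepsO, expect_bind, expect_map]
  refine expect_congr fun c hc => ?_
  have hsup := (OComp.lazy_support (runStepsO (oracleOnly n) _ _ _) T
    (c.mapEnv Prod.fst, c.env.2) (by
      rw [lazy_runStepsO]
      exact (PMF.mem_support_map_iff _ _ _).2 ⟨c, hc, rfl⟩)).2 fun _ _ => false
  rw [eval_runStepsO, eval_oracleOnly] at hsup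
  have := F.halts n _ pk k _ hsup
  simp only [Config.mapEnv] at this
  simp [this, OComp.lazy, expect_pure, Config.mapEnv]

section Blocks

variable {E : Type} {h : Handler E} {B' : ℕ} {f : E → ℝ≥0∞} {K : List Cmd} {ψ : QState} {e : E}

theorem le_value_clearCmd (k : ℕ) (μ : Mem) (t : ℕ) (X : ℝ≥0∞) (hB : t + (3 * k + 1) ≤ B')
    (H : ∀ μ' t', t' ≤ t + (3 * k + 1) → (∀ i < k, μ' (proverReg i) = []) →
      (∀ i, (μ i = [] → μ' i = []) ∧ (i % 5 ≠ 2 → μ' i = μ i)) →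
      X ≤ value h B' f ⟨K, μ', ψ, e, t'⟩) :
    X ≤ value h B' f ⟨clearCmd k :: K, μ, ψ, e, t⟩ := by
  induction k generalizing μ t with
  | zero =>
    refine le_value_skip (by omega) ?_
    exact H μ _ (by omega) (by simp) fun i => ⟨id, fun _ => rfl⟩
  | succ k ih =>
    refine le_value_seq (by omega) ?_
    refine le_value_assign 1 (by simp [Expr.cost]) (by omega) fun t1 ht1 => ?_
    refine ih _ t1 (by omega) fun μ' t' ht' h1 h2 => ?_
    refine H μ' t' (by omega) (fun i hi => ?_) fun i => ⟨fun hi => (h2 i).1 ?_, fun hi => ?_⟩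
    · rcases Nat.lt_succ_iff_lt_or_eq.1 hi with hi | rfl
      · exact h1 i hi
      · exact (h2 _).1 (by simp [Expr.eval])
    · rw [Function.update_apply]
      split_ifs
      · rfl
      · exact hi
    · rw [(h2 i).2 hi, Function.update_of_ne]
      rintro rfl
      simp only [proverReg] at hi
      omega

/-- The time that the simulation of the honest prover's program takes, apart from the evaluation
of the round key. -/
def Searcher.cost (F : Searcher) (M L B : ℕ) : ℕ :=
  3 * F.prog.size + 2 * M + 50 + B * (2 * M + hashCost M L + L + 10)

theorem Searcher.cost_mono (F : Searcher) (M L : ℕ) {B C : ℕ} (h : B ≤ C) :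
    F.cost M L B ≤ F.cost M L C := by
  unfold Searcher.cost
  have := Nat.mul_le_mul_right (2 * M + hashCost M L + L + 10) h
  omega

theorem Searcher.expect_le_value_cmd (F : Searcher) {n N M L B C : ℕ} (T : Cache n)
    (y : Expr) (pk : List Bool) (μ : Mem) (t : ℕ) (g : List Bool × Cache n → ℝ≥0∞)
    (hcache : μ regCache = T.encode) (hn : μ regParam = unary n) (hpk : μ regFullPk = pk)
    (hC : (y.rename (5 * ·)).cost μ ≤ C)
    (hB : B = F.time.eval (n + pk.length + ((y.rename (5 * ·)).eval μ).length))
    (hM : (F.prog.size + 1) * (n + pk.length + ((y.rename (5 * ·)).eval μ).length + B + 1) ≤ M)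
    (hT : T.Within N M) (hL : (N + B) * (10 * M + 7) + 2 * M + 1 ≤ L)
    (ht : t + (C + F.cost M L B) ≤ B')
    (H : ∀ a T' μ' t', t' ≤ t + (C + F.cost M L B) → Cache.Within (N + B) M T' →
      μ' (proverReg 0) = a → μ' regCache = Cache.encode T' →
      (∀ i, i % 5 ≠ 2 → ¬ IsScratch i → μ' i = μ i) →
      g (a, T') ≤ value h B' f ⟨K, μ', ψ, e, t'⟩) :
    expect ((F.respondO n pk ((y.rename (5 * ·)).eval μ)).lazy T) g ≤
      value h B' f ⟨F.cmd (y.rename (5 * ·)) :: K, μ, ψ, e, t⟩ := by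
  set x := y.rename (5 * ·) with hx
  set m := x.eval μ with hm
  set w := F.prog.size + 1 with hw
  have hM' : n + pk.length + m.length + B + 1 ≤ M :=
    le_trans (Nat.le_mul_of_pos_left _ (by omega)) hM
  rw [F.expect_lazy_respondO pk m T g hB]
  unfold Searcher.cost at ht H
  have hDpos : 0 ≤ B * (2 * M + hashCost M L + L + 10) := Nat.zero_le _
  refine le_value_seq (by omega) ?_
  refine le_value_clearCmd _ _ _ _ (by omega) fun μ1 t1 ht1 hclear hfr => ?_
  have hxeval : ∀ μ' : Mem, (∀ i, i % 5 ≠ 2 → μ' i = μ i) → x.eval μ' = m ∧ x.cost μ' = x.cost μ := by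
    intro μ' h'
    have h1 := y.eval_rename (ρ := (5 * ·)) (μ := fun i => μ (5 * i)) (μ' := μ')
      fun i _ => h' _ (by omega)
    have h2 := y.eval_rename (ρ := (5 * ·)) (μ := fun i => μ (5 * i)) (μ' := μ) fun i _ => rfl
    have h3 := y.cost_rename (ρ := (5 * ·)) (μ := fun i => μ (5 * i)) (μ' := μ')
      fun i _ => h' _ (by omega)
    have h4 := y.cost_rename (ρ := (5 * ·)) (μ := fun i => μ (5 * i)) (μ' := μ) fun i _ => rfl
    exact ⟨h1.trans h2.symm, h3.trans h4.symm⟩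
  have hpr : ∀ i j, i % 5 ≠ 2 → i ≠ proverReg j := by
    rintro i j hi rfl
    simp only [proverReg] at hi
    omega
  have hne01 : proverReg 0 ≠ proverReg 1 := by decide
  have hne02 : proverReg 0 ≠ proverReg 2 := by decide
  have hne12 : proverReg 1 ≠ proverReg 2 := by decide
  refine le_value_seq (by omega) ?_
  refine le_value_assign (1 + n) ?_ (by omega) fun t2 ht2 => ?_
  · simp [Expr.cost, (hfr regParam).2 (by decide), hn, unary]
  refine le_value_seq (by omega) ?_
  refine le_value_assign (1 + pk.length) ?_ (by omega) fun t3 ht3 => ?_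
  · simp [Expr.cost, Function.update_of_ne (hpr regFullPk 0 (by decide)),
      (hfr regFullPk).2 (by decide), hpk]
  set μ3 := Function.update (Function.update μ1 (proverReg 0) (Expr.eval μ1 (.reg regParam)))
    (proverReg 1) (Expr.eval (Function.update μ1 (proverReg 0) (Expr.eval μ1 (.reg regParam)))
      (.reg regFullPk)) with hμ3
  have hfr3 : ∀ i, i % 5 ≠ 2 → μ3 i = μ i := by
    intro i hi
    rw [hμ3, Function.update_of_ne (hpr i 1 hi), Function.update_of_ne (hpr i 0 hi), (hfr i).2 hi]
  refine le_value_seq (by omega) ?_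
  refine le_value_assign C (by rw [(hxeval μ3 hfr3).2]; exact hC) (by omega) fun t4 ht4 => ?_
  rw [(hxeval μ3 hfr3).1]
  have hinj : Function.Injective proverReg := by
    intro i j hij
    simp only [proverReg] at hij
    omega
  have hbase := expect_runSteps_le_value_compile (h := lazyHandler (oracleOnly n)) (h' := h)
    (B := B) (B' := B') (acc := f) (ρ := proverReg) (a := proverAsk) (w := w)
    (L := n + pk.length + m.length) (D := 2 * M + hashCost M L + L + 10)
    (N := t4 + B * (2 * M + hashCost M L + L + 10)) (slack := false) (track := false)
    (J := fun k s μ' ψ' e' => e' = e ∧ ψ' = ψ ∧ μ' regCache = Cache.encode s.2 ∧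
      s.2.length + k ≤ N + B ∧ Cache.Within (N + B) M s.2 ∧
      ∀ i, i % 5 ≠ 2 → ¬ IsScratch i → μ' i = μ i)
    (Term := fun _ _ => False)
    (f := fun c => if c.todo = [] then g (c.mem 0, c.env.2) else 0) (K := K)
    hinj ?_ ?_ (by simp) ?_ (by simp) ?_ ?_ ?_ (by omega) B
    ⟨[F.prog], inputs (unary n) pk m, ket ∅, ((), T), 0⟩
    (Function.update μ3 (proverReg 2) m) ψ e t4 ?_ ?_ ?_ (by simp) ?_ (Or.inl (by simp))
  · exact hbase
  · rintro k s μ' ψ' e' ⟨h1, h2, h3, h4, h5⟩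
    exact ⟨h1, h2, h3, by omega, h5⟩
  · rintro k s μ' ψ' e' i x ⟨h1, h2, h3, h4, h5, h6⟩
    refine ⟨h1, h2, ?_, h4, h5, fun j hj hj' => ?_⟩
    · rw [Function.update_of_ne (hpr _ _ (by decide)), h3]
    · rw [Function.update_of_ne (hpr _ _ hj), h6 j hj hj']
  · -- Requests of the simulated program.
    rintro k i p z ⟨⟨⟩, T'⟩ μ' ψ' e' K' t' g' hi hzc ⟨rfl, rfl, h3, h4, h5, h6⟩ htB Hk
    simp only [Bool.false_eq_true, if_false, add_zero, or_false] at Hk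
    simp only at h3 h4 h5
    have hzM : (z.rename proverReg).cost μ' ≤ M := hzc.trans hM
    have hzl := (z.rename proverReg).length_eval_lt_cost μ'
    have hother : ∀ p, p ≠ .hash → (lazyHandler (oracleOnly n) p
        ((z.rename proverReg).eval μ') ((), T')) = PMF.pure ([], ((), T')) := by
      intro p hp
      cases p <;> first | exact absurd rfl hp | simp [lazyHandler, oracleOnly, OComp.lazy, PMF.pure_map]
    by_cases hp : p = .hash
    · subst hp
      simp only [lazyHandler, oracleOnly, expect_map]
      have hfun : ((OComp.query (unpair ((z.rename proverReg).eval μ')) fun v =>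
          OComp.ret (List.ofFn v, ())).lazy T') = ((OComp.query (unpair ((z.rename proverReg).eval μ'))
          fun v => OComp.ret v).lazy T').map fun a => ((List.ofFn a.1, ()), a.2) := by
        simp only [OComp.lazy]
        split <;> simp [PMF.map_bind, PMF.pure_map]
      rw [hfun, expect_map]
      have henc := h5.length_encode_le (by omega)
      refine le_value_seq (by omega) ?_
      refine expect_le_value_hashCmd (L := L) (C := M) T' _ μ' _ _ h3 ?_ hzM (by omega) (by omega)
        (by omega) (by omega) ?_
      · rw [h6 regParam (by decide) (by simp [IsScratch]), hn]
      intro v T'' μ'' t'' ht'' hsup hTT hres hcache'' hfr''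
      refine le_value_assign (1 + n) (by simp [Expr.cost, hres]) (by omega) fun t5 ht5 => ?_
      have hlen : T''.length ≤ T'.length + 1 := by rcases hTT with rfl | rfl <;> simp
      refine Hk _ ?_ _ _ _ _ (by omega) ⟨?_, ?_, rfl, rfl, rfl, ?_, ?_, ?_, ?_⟩
      · refine (PMF.mem_support_map_iff _ _ _).2 ⟨((List.ofFn v, ()), T''), ?_, rfl⟩
        exact hfun ▸ (PMF.mem_support_map_iff _ _ _).2 ⟨_, hsup, rfl⟩
      · simp [Expr.eval, hres]
      · intro j hj hji
        rw [Function.update_of_ne (hinj.ne hji), hfr'']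
        simp only [IsScratch, proverReg]
        omega
      · rw [Function.update_of_ne (hpr _ _ (by decide)), hcache'']
      · simp only
        omega
      · rcases hTT with rfl | rfl
        · exact h5
        · refine ⟨by simp only [List.length_cons]; omega, (h5.cons ?_ v).2⟩
          have := length_unpair_le ((z.rename proverReg).eval μ')
          omega
      · intro j hj hj'
        rw [Function.update_of_ne (hpr _ _ hj), hfr'' j hj', h6 j hj hj']
    · have hcmd : proverAsk (proverReg i) p (z.rename proverReg) = .assign (proverReg i) .empty := by
        cases p <;> first | exact absurd rfl hp | rfl
      rw [hother p hp] at Hk ⊢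
      rw [expect_pure, hcmd]
      refine le_value_assign 1 (by simp [Expr.cost]) (by omega) fun t5 ht5 => ?_
      refine Hk _ (by simp) _ _ _ _ (by omega) ⟨?_, ?_, rfl, rfl, rfl, ?_, ?_, h5, ?_⟩
      · simp [Expr.eval]
      · intro j hj hji
        rw [Function.update_of_ne (hinj.ne hji)]
      · rw [Function.update_of_ne (hpr _ _ (by decide)), h3]
      · simp only
        omega
      · intro j hj hj'
        rw [Function.update_of_ne (hpr _ _ hj), h6 j hj hj']
  · -- The end of the simulated program.
    rintro k c μ' ψ' e' t' hnil ⟨rfl, rfl, h3, h4, h5, h6⟩ hreg htN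
    have := htN rfl
    simp only [hnil, if_true]
    exact H _ _ μ' t' (by omega) h5 (hreg 0 (by omega)) h3 h6
  · rintro k c μ' ψ' e' t' todo hne -
    simp [hne]
  · have := hM
    omega
  · refine ⟨fun i => (length_inputs_le _ _ _ i).trans (by simp [length_unary]), ?_⟩
    simp [hw]
  · refine ⟨rfl, rfl, ?_, by have := hT.1; simp only; omega, hT.mono (by omega), fun i hi hi' => ?_⟩
    · rw [Function.update_of_ne (hpr _ _ (by decide)), hfr3 _ (by decide), hcache]
    · rw [Function.update_of_ne (hpr _ _ hi), hfr3 i hi]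
  · intro i hi
    match i with
    | 0 =>
      rw [Function.update_of_ne hne02, hμ3, Function.update_of_ne hne01, Function.update_self]
      simp only [Expr.eval, inputs]
      rw [(hfr regParam).2 (by decide), hn]
    | 1 =>
      rw [Function.update_of_ne hne12, hμ3, Function.update_self]
      simp only [Expr.eval, inputs]
      rw [Function.update_of_ne (hpr _ _ (by decide)), (hfr regFullPk).2 (by decide), hpk]
    | 2 => rw [Function.update_self]; rfl
    | i + 3 =>
      rw [Function.update_of_ne (hinj.ne (by omega)), hμ3, Function.update_of_ne (hinj.ne (by omega)),
        Function.update_of_ne (hinj.ne (by omega)), hclear _ hi]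
      rfl
  · simpa using F.classical

end Blocks

/-! ### Answering the adversary's requests -/

/-- Requests of the adversary against the augmented scheme, answered by an adversary against the
given scheme. -/
def adversaryAsk (F : Searcher) (i : ℕ) (p : Port) (x : Expr) : Cmd :=
  match p with
  | .hash => .seq (hashCmd x) (.assign i (.reg regResult))
  | .session =>
      .cond (.reg regMet) (.assign i .empty) <|
        .seq (.assign regOpen (.push true .empty)) <|
        .seq (.assign regFresh (.push true .empty)) <|
        .seq (.assign regLeft (.push true (.reg regRounds))) (.ask i .session .empty)
  | .prover =>
      .cond (.reg regMet) (.assign i .empty) <|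
      .cond (.reg regOpen)
        (.cond (.reg regFresh)
          (.seq (.assign regFresh .empty) <|
            .seq (.assign regLeft (.tail (.reg regLeft))) (.assign i .empty))
          (.cond (.reg regLeft)
            (.seq (F.cmd x) <|
              .seq (.assign regLeft (.tail (.reg regLeft))) (.assign i (.reg (proverReg 0))))
            (.ask i .prover x)))
        (.assign i .empty)
  | .verifier =>
      .cond (.reg regVLeft)
        (.seq (hashCmd (.pair (.reg regKey) (.fst x))) <|
          .seq (hashCmd (.pair (.reg regKey) (.snd x))) <|
          .seq (.assign regMet (.push true .empty)) <|
          .seq (.assign regVLeft (.tail (.reg regVLeft))) <|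
          .cond (.reg regVLeft)
            (.seq sampleCmd <| .seq (.assign regKey (.reg regResult)) (.assign i (.reg regResult)))
            (.assign i .empty))
        (.ask i .verifier x)

theorem isClassical_adversaryAsk (F : Searcher) (i : ℕ) (p : Port) (x : Expr) :
    (adversaryAsk F i p x).IsClassical := by
  cases p <;> simp [adversaryAsk, Cmd.IsClassical, isClassical_hashCmd, isClassical_sampleCmd,
    Searcher.isClassical_cmd]

/-- The bookkeeping registers and the game against the given scheme agree with the state `g` of the
game against the augmented scheme. -/
def GameStateRel (S : IdScheme) (R n : ℕ) (g : GhostState S) (μ : Mem)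
    (e : GameState S.toTimed) : Prop :=
  match g.verifier with
  | .idle => μ regMet = [] ∧ μ regVLeft = unary (R + 1) ∧ μ regKey = [] ∧ e.verifier = .idle ∧
      match g.session with
      | none => μ regOpen = []
      | some s => μ regOpen = [true] ∧ e.session = some s.2 ∧
          μ regFresh = (if s.1 = 0 then [true] else []) ∧ μ regLeft = unary (R + 1 - s.1)
  | .active round key _ inner => μ regMet = [true] ∧ μ regVLeft = unary (R + 1 - round) ∧
      μ regKey = key ∧ key.length ≤ n ∧
      match inner with
      | none => e.verifier = .idle
      | some v => e.verifier = .active v ∧ R < round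
  | .done _ _ => False

/-- The invariant of the reduction before the verifier's decision; `k` is the number of remaining
steps, each of which adds at most `σ` entries to the cache. -/
structure GameRel (S : IdScheme) (R n N M σ : ℕ) (fullPk : List Bool) (k : ℕ)
    (s : GhostState S × Cache n) (μ : Mem) (e : GameState S.toTimed) : Prop where
  param : μ regParam = unary n
  fullPk : μ regFullPk = fullPk
  rounds : μ regRounds = unary R
  cache : μ regCache = s.2.encode
  length_le : s.2.length + k * σ ≤ N
  within : s.2.Within N M
  state : GameStateRel S R n s.1 μ e

/-- Both games have ended with the same decision of the given scheme's verifier. -/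
def GameOver (S : IdScheme) {n : ℕ} (s : GhostState S × Cache n) (e : GameState S.toTimed) : Prop :=
  match s.1.verifier with
  | .done b _ => e.verifier = .done b
  | _ => False

theorem GameStateRel.congr {S : IdScheme} {R n : ℕ} {g : GhostState S} {μ μ' : Mem}
    {e : GameState S.toTimed} (h : GameStateRel S R n g μ e)
    (hμ : ∀ i, i % 5 = 1 → i < 51 → μ' i = μ i) : GameStateRel S R n g μ' e := by
  unfold GameStateRel at h ⊢
  rw [hμ regMet (by decide) (by decide), hμ regVLeft (by decide) (by decide),
    hμ regKey (by decide) (by decide), hμ regOpen (by decide) (by decide),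
    hμ regFresh (by decide) (by decide), hμ regLeft (by decide) (by decide)]
  exact h

theorem GameRel.mono {S : IdScheme} {R n N M σ : ℕ} {fullPk : List Bool} {k : ℕ}
    {s : GhostState S × Cache n} {μ : Mem} {e : GameState S.toTimed}
    (h : GameRel S R n N M σ fullPk (k + 1) s μ e) : GameRel S R n N M σ fullPk k s μ e := by
  refine { h with length_le := ?_ }
  have := h.length_le
  have : (k + 1) * σ = k * σ + σ := by ring
  omega

theorem GameRel.congr {S : IdScheme} {R n N M σ : ℕ} {fullPk : List Bool} {k : ℕ}
    {s : GhostState S × Cache n} {μ μ' : Mem} {e : GameState S.toTimed}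
    (h : GameRel S R n N M σ fullPk k s μ e) (hμ : ∀ i, i % 5 = 1 → i ≤ 51 → μ' i = μ i) :
    GameRel S R n N M σ fullPk k s μ' e where
  param := by rw [hμ regParam (by decide) (by decide), h.param]
  fullPk := by rw [hμ regFullPk (by decide) (by decide), h.fullPk]
  rounds := by rw [hμ regRounds (by decide) (by decide), h.rounds]
  cache := by rw [hμ regCache (by decide) (by decide), h.cache]
  length_le := h.length_le
  within := h.within
  state := h.state.congr fun i hi hi' => hμ i hi hi'.le

/-- The environment of an adversary against the given scheme. -/
abbrev plainHandler (S : IdScheme) (n : ℕ) (sk pk : List Bool) : Handler (GameState S.toTimed) :=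
  gameHandler S.toTimed 1 n sk pk noOracle

section Ask

variable {S : IdScheme} {F : Searcher} {α : ℝ} {l R n : ℕ} {sk pk : List Bool}
  {B' N M L σ X D w : ℕ} {acc : GameState S.toTimed → ℝ≥0∞}

/-- `SimulatesAsk` for requests to the port `p`. -/
def SimulatesPort (p : Port) (S : IdScheme) (F : Searcher) (α : ℝ) (l R n : ℕ)
    (sk pk : List Bool) (B' N M σ X D w : ℕ) (acc : GameState S.toTimed → ℝ≥0∞) : Prop :=
  ∀ (k i : ℕ) (x : Expr) (s : GhostState S × Cache n) (μ : Mem) (ψ : QState)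
    (e' : GameState S.toTimed) (K : List Cmd) (t : ℕ) (g : List Bool × GhostState S × Cache n → ℝ≥0∞),
    (x.rename (5 * ·)).cost μ ≤ X →
    GameRel S R n N M σ (pair pk (unary l)) (k + 1) s μ e' → t + D ≤ B' →
    (∀ b ∈ (lazyHandler (ghostHandler S F α l R n sk pk) p ((x.rename (5 * ·)).eval μ) s).support,
      ∀ μ' e'' t', t' ≤ t + D + b.1.length →
      ((μ' (5 * i) = b.1 ∧ (∀ j < w, j ≠ i → μ' (5 * j) = μ (5 * j)) ∧
        GameRel S R n N M σ (pair pk (unary l)) k b.2 μ' e'') ∨ GameOver S b.2 e'') →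
      g b ≤ value (plainHandler S n sk pk) B' acc ⟨K, μ', ψ, e'', t'⟩) →
    expect (lazyHandler (ghostHandler S F α l R n sk pk) p ((x.rename (5 * ·)).eval μ) s) g ≤
      value (plainHandler S n sk pk) B' acc
        ⟨adversaryAsk F (5 * i) p (x.rename (5 * ·)) :: K, μ, ψ, e', t⟩

theorem update_adversaryReg_of_residue {μ : Mem} {i j : ℕ} {y : List Bool} (h : j % 5 ≠ 0) :
    Function.update μ (5 * i) y j = μ j :=
  Function.update_of_ne (by omega) _ _

theorem simulatesPort_hash (hX : X + n + 1 ≤ M) (hL : N * (10 * M + 7) + 2 * M + 1 ≤ L) (hσ : 1 ≤ σ)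
    (hD : hashCost X L + n + 10 ≤ D) :
    SimulatesPort .hash S F α l R n sk pk B' N M σ X D w acc := by
  rintro k i x ⟨gs, T⟩ μ ψ e' K t g hx hrel ht H
  have hxl := (x.rename (5 * ·)).length_eval_lt_cost μ
  have henc := hrel.within.length_encode_le (by omega)
  have hfun : (ghostHandler S F α l R n sk pk .hash ((x.rename (5 * ·)).eval μ) gs).lazy T =
      ((OComp.query (unpair ((x.rename (5 * ·)).eval μ)) fun v => OComp.ret v).lazy T).map
        fun a => ((List.ofFn a.1, { gs with queries := gs.queries + 1 }), a.2) := by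
    simp only [ghostHandler, OComp.lazy]
    split <;> simp [PMF.map_bind, PMF.pure_map]
  simp only [lazyHandler, hfun, PMF.map_comp, expect_map] at H ⊢
  refine le_value_seq (by omega) ?_
  simp only at henc
  refine expect_le_value_hashCmd (L := L) (C := X) T _ μ _ _ hrel.cache hrel.param hx (by omega)
    (by omega) (by omega) (by omega) ?_
  intro v T' μ' t' ht' hsup hTT hres hcache hfr
  refine le_value_assign (1 + n) (by simp [Expr.cost, hres]) (by omega) fun t1 ht1 => ?_
  refine H _ ((PMF.mem_support_map_iff _ _ _).2 ⟨_, hsup, rfl⟩) _ _ _ ?_ (Or.inl ⟨?_, ?_, ?_⟩)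
  · simp only [Function.comp, List.length_ofFn]
    omega
  · simp [Expr.eval, hres]
  · intro j _ hji
    rw [Function.update_of_ne (by omega), hfr]
    simp only [IsScratch]
    omega
  · have hlen : T'.length ≤ T.length + 1 := by rcases hTT with rfl | rfl <;> simp
    have h1 := hrel.length_le
    have h2 : (k + 1) * σ = k * σ + σ := by ring
    simp only at h1
    have hst : GameStateRel S R n { gs with queries := gs.queries + 1 } μ e' := hrel.state
    refine ⟨?_, ?_, ?_, ?_, ?_, ?_, hst.congr fun j hj hj' => ?_⟩
    · rw [update_adversaryReg_of_residue (by decide), hfr _ (by simp [IsScratch]), hrel.param]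
    · rw [update_adversaryReg_of_residue (by decide), hfr _ (by simp [IsScratch]), hrel.fullPk]
    · rw [update_adversaryReg_of_residue (by decide), hfr _ (by simp [IsScratch]), hrel.rounds]
    · rw [update_adversaryReg_of_residue (by decide), hcache]
      rfl
    · simp only [Function.comp]
      omega
    · rcases hTT with rfl | rfl
      · exact hrel.within
      · have := length_unpair_le ((x.rename (5 * ·)).eval μ)
        exact ⟨by simp only [Function.comp, List.length_cons] at hlen ⊢; omega,
          (hrel.within.cons (by omega) v).2⟩
    · rw [update_adversaryReg_of_residue (by omega), hfr]
      simp only [IsScratch]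
      omega

theorem simulatesPort_session (hD : 2 * R + 50 ≤ D) :
    SimulatesPort .session S F α l R n sk pk B' N M σ X D w acc := by
  rintro k i x ⟨⟨ses, ver, q⟩, T⟩ μ ψ e' K t g hx hrel ht H
  have hst := hrel.state
  cases ver with
  | done b count => exact hst.elim
  | active round key count inner =>
    have hmet : μ regMet = [true] := hst.1
    simp only [lazyHandler, ghostHandler, OComp.lazy, PMF.pure_map] at H ⊢
    rw [expect_pure]
    refine le_value_cond 2 (by simp [Expr.cost, hmet]) (by omega) fun t1 ht1 => ?_
    rw [if_neg (by simp [Expr.eval, hmet])]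
    refine le_value_assign 1 (by simp [Expr.cost]) (by omega) fun t2 ht2 => ?_
    refine H _ (by simp) _ _ _ (by omega) (Or.inl ⟨?_, ?_, ?_⟩)
    · simp [Expr.eval]
    · intro j _ hji
      rw [Function.update_of_ne (by omega)]
    · exact hrel.mono.congr fun j hj _ => update_adversaryReg_of_residue (by omega)
  | idle =>
    obtain ⟨hmet, hvl, hkey, hver, -⟩ := id hst
    have hsrc : lazyHandler (ghostHandler S F α l R n sk pk) .session ((x.rename (5 * ·)).eval μ)
        (⟨ses, .idle, q⟩, T) = (S.proverInit n sk pk).map fun s =>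
          ([], ⟨some (0, s), .idle, q⟩, T) := by
      simp [lazyHandler, ghostHandler, OComp.lazy, PMF.map, Function.comp_def]
    have htgt : plainHandler S n sk pk .session [] e' = (S.proverInit n sk pk).map fun s =>
        ([], { e' with session := some s }) := by
      simp only [plainHandler, gameHandler, hver]
      rfl
    rw [hsrc] at H ⊢
    rw [expect_map]
    refine le_value_cond 1 (by simp [Expr.cost, hmet]) (by omega) fun t1 ht1 => ?_
    rw [if_pos (by simp [Expr.eval, hmet])]
    refine le_value_seq (by omega) ?_
    refine le_value_assign 3 (by simp [Expr.cost, Expr.eval]) (by omega) fun t2 ht2 => ?_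
    refine le_value_seq (by omega) ?_
    refine le_value_assign 3 (by simp [Expr.cost, Expr.eval]) (by omega) fun t3 ht3 => ?_
    refine le_value_seq (by omega) ?_
    refine le_value_assign (2 * R + 3) ?_ (by omega) fun t4 ht4 => ?_
    · simp [Expr.cost, Expr.eval, hrel.rounds, length_unary]
      omega
    rw [value_ask (by omega), show Expr.empty.eval _ = [] from rfl, htgt, expect_map]
    refine expect_mono fun s hs => ?_
    refine H _ ((PMF.mem_support_map_iff _ _ _).2 ⟨s, hs, rfl⟩) _ _ _ ?_ (Or.inl ⟨?_, ?_, ?_⟩)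
    · simp only [Expr.cost, List.length_nil]
      omega
    · simp
    · intro j _ hji
      rw [Function.update_of_ne (by omega)]
      simp only [Function.update_of_ne (show 5 * j ≠ regLeft by omega),
        Function.update_of_ne (show 5 * j ≠ regFresh by omega),
        Function.update_of_ne (show 5 * j ≠ regOpen by omega)]
    · have hm := hrel.mono
      have hp := hm.param
      have hf := hm.fullPk
      have hr := hm.rounds
      have hc := hm.cache
      refine ⟨?_, ?_, ?_, ?_, hm.length_le, hm.within, ?_, ?_, ?_, hver, ?_, rfl, ?_, ?_⟩
      all_goals simp [update_adversaryReg_of_residue, hp, hf, hr, hc, hmet, hvl, hkey,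
        Expr.eval, unary, List.replicate_succ]

theorem simulatesPort_prover {BF : ℕ}
    (hBF : F.time.eval (n + (pair pk (unary l)).length + X) ≤ BF)
    (hM : (F.prog.size + 1) * (n + (pair pk (unary l)).length + X + BF + 1) ≤ M)
    (hL : N * (10 * M + 7) + 2 * M + 1 ≤ L) (hσ : BF ≤ σ)
    (hD : X + F.cost M L BF + 10 * R + 50 ≤ D) :
    SimulatesPort .prover S F α l R n sk pk B' N M σ X D w acc := by
  rintro k i x ⟨⟨ses, ver, q⟩, T⟩ μ ψ e' K t g hx hrel ht H
  have hst := hrel.state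
  cases ver with
  | done b count => exact hst.elim
  | active round key count inner =>
    have hmet : μ regMet = [true] := hst.1
    simp only [lazyHandler, ghostHandler, OComp.lazy, PMF.pure_map] at H ⊢
    rw [expect_pure]
    refine le_value_cond 2 (by simp [Expr.cost, hmet]) (by omega) fun t1 ht1 => ?_
    rw [if_neg (by simp [Expr.eval, hmet])]
    refine le_value_assign 1 (by simp [Expr.cost]) (by omega) fun t2 ht2 => ?_
    refine H _ (by simp) _ _ _ (by omega) (Or.inl ⟨?_, ?_, ?_⟩)
    · simp [Expr.eval]
    · intro j _ hji
      rw [Function.update_of_ne (by omega)]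
    · exact hrel.mono.congr fun j hj _ => update_adversaryReg_of_residue (by omega)
  | idle =>
    obtain ⟨hmet, hvl, hkey, hver, hses⟩ := id hst
    refine le_value_cond 1 (by simp [Expr.cost, hmet]) (by omega) fun t1 ht1 => ?_
    rw [if_pos (by simp [Expr.eval, hmet])]
    cases ses with
    | none =>
      have hop : μ regOpen = [] := hses
      simp only [lazyHandler, ghostHandler, OComp.lazy, PMF.pure_map] at H ⊢
      rw [expect_pure]
      refine le_value_cond 1 (by simp [Expr.cost, hop]) (by omega) fun t2 ht2 => ?_
      rw [if_pos (by simp [Expr.eval, hop])]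
      refine le_value_assign 1 (by simp [Expr.cost]) (by omega) fun t3 ht3 => ?_
      refine H _ (by simp) _ _ _ (by omega) (Or.inl ⟨?_, ?_, ?_⟩)
      · simp [Expr.eval]
      · intro j _ hji
        rw [Function.update_of_ne (by omega)]
      · exact hrel.mono.congr fun j hj _ => update_adversaryReg_of_residue (by omega)
    | some s =>
      obtain ⟨rd, s⟩ := s
      obtain ⟨hop, hes, hfresh, hleft⟩ := hses
      simp only at hes hfresh hleft
      refine le_value_cond 2 (by simp [Expr.cost, hop]) (by omega) fun t2 ht2 => ?_
      rw [if_neg (by simp [Expr.eval, hop])]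
      by_cases h0 : rd = 0
      · -- The opening message of the session.
        subst h0
        rw [if_pos rfl] at hfresh
        simp only [lazyHandler, ghostHandler, if_true, OComp.lazy, PMF.pure_map] at H ⊢
        rw [expect_pure]
        refine le_value_cond 2 (by simp [Expr.cost, hfresh]) (by omega) fun t3 ht3 => ?_
        rw [if_neg (by simp [Expr.eval, hfresh])]
        refine le_value_seq (by omega) ?_
        refine le_value_assign 1 (by simp [Expr.cost]) (by omega) fun t4 ht4 => ?_
        refine le_value_seq (by omega) ?_
        refine le_value_assign (2 * R + 5) ?_ (by omega) fun t5 ht5 => ?_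
        · simp [Expr.cost, Expr.eval, hleft, length_unary]
          omega
        refine le_value_assign 1 (by simp [Expr.cost]) (by omega) fun t6 ht6 => ?_
        refine H _ (by simp) _ _ _ (by omega) (Or.inl ⟨by simp [Expr.eval], ?_, ?_⟩)
        · intro j _ hji
          rw [Function.update_of_ne (by omega), Function.update_of_ne (by omega),
            Function.update_of_ne (by omega)]
        · have hm := hrel.mono
          have hp := hm.param
          have hf := hm.fullPk
          have hr := hm.rounds
          have hc := hm.cache
          refine ⟨?_, ?_, ?_, ?_, hm.length_le, hm.within, ?_, ?_, ?_, hver, ?_, hes, ?_, ?_⟩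
          all_goals simp [update_adversaryReg_of_residue, hp, hf, hr, hc, hmet, hvl, hkey, hop,
            hleft, Expr.eval, unary]
      rw [if_neg h0] at hfresh
      refine le_value_cond 1 (by simp [Expr.cost, hfresh]) (by omega) fun t3 ht3 => ?_
      rw [if_pos (by simp [Expr.eval, hfresh])]
      refine le_value_cond (R + 2) ?_ (by omega) fun t4 ht4 => ?_
      · simp [Expr.cost, hleft, length_unary]
        omega
      by_cases h1 : rd ≤ R
      · -- A collision round: the honest prover's program is run.
        rw [if_neg (by simp only [Expr.eval, hleft, unary_eq_nil]; omega)]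
        have hsrc : lazyHandler (ghostHandler S F α l R n sk pk) .prover
            ((x.rename (5 * ·)).eval μ) (⟨some (rd, s), .idle, q⟩, T) =
            ((F.respondO n (pair pk (unary l)) ((x.rename (5 * ·)).eval μ)).lazy T).map fun a =>
              (a.1, ⟨some (rd + 1, s), .idle, q⟩, a.2) := by
          simp [lazyHandler, ghostHandler, h0, h1, OComp.lazy_bind, OComp.lazy, PMF.map,
            Function.comp_def]
        rw [hsrc] at H ⊢
        rw [expect_map, expect_eq_ite]
        refine le_value_seq (by omega) ?_
        have hxl := (x.rename (5 * ·)).length_eval_lt_cost μ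
        set B := F.time.eval (n + (pair pk (unary l)).length + ((x.rename (5 * ·)).eval μ).length)
          with hB
        have hBB : B ≤ BF := (eval_mono _ (by omega)).trans hBF
        have hlen := hrel.length_le
        have hkσ : (k + 1) * σ = k * σ + σ := by ring
        simp only at hlen
        have hLT : (T.length + B) * (10 * M + 7) ≤ N * (10 * M + 7) :=
          Nat.mul_le_mul_right _ (by omega)
        have hMB : (F.prog.size + 1) * (n + (pair pk (unary l)).length +
            ((x.rename (5 * ·)).eval μ).length + B + 1) ≤ M :=
          le_trans (Nat.mul_le_mul_left _ (by omega)) hM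
        have hcost := F.cost_mono M L hBB
        refine F.expect_le_value_cmd (N := T.length) (M := M) (L := L) (B := B) (C := X) T x
          (pair pk (unary l)) μ _ _ hrel.cache hrel.param hrel.fullPk hx hB hMB
          ⟨le_rfl, hrel.within.2⟩ (by omega) (by omega) ?_
        intro a T' μ' t5 ht5 hT' ha hcache hfr
        subst ha
        have hfr' : ∀ j, j % 5 = 1 → j < 51 → μ' j = μ j := fun j hj hj' =>
          hfr j (by omega) fun h => by unfold IsScratch at h; omega
        refine le_value_seq (by omega) ?_
        refine le_value_assign (2 * R + 5) ?_ (by omega) fun t6 ht6 => ?_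
        · simp [Expr.cost, Expr.eval, hfr' regLeft (by decide) (by decide), hleft, length_unary]
          omega
        refine le_value_assign (1 + (μ' (proverReg 0)).length) ?_ (by omega) fun t7 ht7 => ?_
        · simp [Expr.cost, proverReg]
        split_ifs with hsup
        swap
        · exact zero_le
        refine H _ ((PMF.mem_support_map_iff _ _ _).2 ⟨_, hsup, rfl⟩) _ _ _ ?_
          (Or.inl ⟨by simp [Expr.eval, proverReg], ?_, ?_⟩)
        · simp only
          omega
        · intro j _ hji
          rw [Function.update_of_ne (by omega), Function.update_of_ne (by omega),
            hfr _ (by omega) (by unfold IsScratch; omega)]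
        · refine ⟨?_, ?_, ?_, ?_, ?_, ?_, ?_, ?_, ?_, hver, ?_, hes, ?_, ?_⟩
          · simp [update_adversaryReg_of_residue, hfr', hrel.param]
          · simp [update_adversaryReg_of_residue, hfr', hrel.fullPk]
          · simp [update_adversaryReg_of_residue, hfr', hrel.rounds]
          · simp [update_adversaryReg_of_residue, hcache]
          · have := hT'.1
            simp only
            omega
          · exact hT'.mono (by omega)
          · simp [update_adversaryReg_of_residue, hfr', hmet]
          · simp [update_adversaryReg_of_residue, hfr', hvl]
          · simp [update_adversaryReg_of_residue, hfr', hkey]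
          · simp [update_adversaryReg_of_residue, hfr', hop]
          · simp [update_adversaryReg_of_residue, hfr', hfresh]
          · simp only [ne_eq, Nat.reduceMod, one_ne_zero, not_false_eq_true,
              update_adversaryReg_of_residue, Function.update_self, Expr.eval,
              hfr' regLeft (by decide) (by decide), hleft, tail_unary]
            congr 1
      · -- The given scheme's part of the session.
        rw [if_pos (by simp only [Expr.eval, hleft, unary_eq_nil]; omega)]
        have hsrc : lazyHandler (ghostHandler S F α l R n sk pk) .prover
            ((x.rename (5 * ·)).eval μ) (⟨some (rd, s), .idle, q⟩, T) =
            (S.proverStep s ((x.rename (5 * ·)).eval μ)).map fun a =>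
              (a.2, ⟨some (rd, a.1), .idle, q⟩, T) := by
          simp [lazyHandler, ghostHandler, h0, h1, OComp.lazy, PMF.map, Function.comp_def]
        have htgt : plainHandler S n sk pk .prover ((x.rename (5 * ·)).eval μ) e' =
            (S.proverStep s ((x.rename (5 * ·)).eval μ)).map fun a =>
              (a.2, { e' with session := some a.1 }) := by
          simp only [plainHandler, gameHandler, hver, hes]
          rfl
        rw [hsrc] at H ⊢
        rw [value_ask (by omega), htgt, expect_map, expect_map]
        refine expect_mono fun a ha => ?_
        refine H _ ((PMF.mem_support_map_iff _ _ _).2 ⟨a, ha, rfl⟩) _ _ _ ?_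
          (Or.inl ⟨by simp, ?_, ?_⟩)
        · simp only
          omega
        · intro j _ hji
          rw [Function.update_of_ne (by omega)]
        · have hm := hrel.mono.congr (μ' := Function.update μ (5 * i) a.2) fun j hj _ =>
            update_adversaryReg_of_residue (by omega)
          have hst' := hm.state
          exact ⟨hm.param, hm.fullPk, hm.rounds, hm.cache, hm.length_le, hm.within, hst'.1, hst'.2.1,
            hst'.2.2.1, hver, hst'.2.2.2.2.1, rfl, hst'.2.2.2.2.2.2.1, hst'.2.2.2.2.2.2.2⟩

end Ask

/-! ### Answering the messages to the verifier -/

section AskVerifier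

variable {S : IdScheme} {F : Searcher} {α : ℝ} {l R n : ℕ} {sk pk : List Bool}
  {B' N M L σ X D w : ℕ} {acc : GameState S.toTimed → ℝ≥0∞}

/-- What the bookkeeping registers say about an unfinished verifier, whether or not it has been
contacted. -/
theorem GameStateRel.verifier {g : GhostState S} {μ : Mem} {e : GameState S.toTimed}
    (h : GameStateRel S R n g μ e) (m : List Bool) :
    ∃ round key count inner,
      ghostHandler S F α l R n sk pk .verifier m g =
        ghostVerify S α l R n pk g round key count inner m ∧
      (R < round → μ regMet = [true]) ∧ μ regVLeft = unary (R + 1 - round) ∧ μ regKey = key ∧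
      key.length ≤ n ∧
      match inner with
      | none => e.verifier = .idle
      | some v => e.verifier = .active v ∧ R < round := by
  obtain ⟨ses, ver, q⟩ := g
  cases ver with
  | idle =>
    obtain ⟨-, hvl, hkey, hver, -⟩ := h
    exact ⟨0, [], 0, none, rfl, by simp, hvl, hkey, by simp, hver⟩
  | active round key count inner =>
    obtain ⟨hmet, h⟩ := h
    exact ⟨round, key, count, inner, rfl, fun _ => hmet, h⟩
  | done b count => exact h.elim

theorem simulatesPort_verifier (hX : X + n + 1 ≤ M) (hR : R + 10 * M + 10 ≤ L)
    (hL : N * (10 * M + 7) ≤ L) (hσ : 2 ≤ σ)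
    (hD : 2 * hashCost (10 * M) L + 40 * ((L + 1) * (L + 1)) + 10 * L + 100 ≤ D) :
    SimulatesPort .verifier S F α l R n sk pk B' N M σ X D w acc := by
  rintro k i x ⟨gs, T⟩ μ ψ e' K t g hx hrel ht H
  have hxl := (x.rename (5 * ·)).length_eval_lt_cost μ
  obtain ⟨round, key, count, inner, hgh, hmet, hvl, hkey, hkn, hin⟩ :=
    hrel.state.verifier (F := F) (α := α) (l := l) (sk := sk) (pk := pk)
      ((x.rename (5 * ·)).eval μ)
  simp only at hgh
  set m := (x.rename (5 * ·)).eval μ with hm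
  have hm2 := length_unpair_le m
  have hlen := hrel.length_le
  have hkσ : (k + 1) * σ = k * σ + σ := by ring
  simp only at hlen
  refine le_value_cond (R + 2) ?_ (by omega) fun t1 ht1 => ?_
  · simp [Expr.cost, hvl, length_unary]
    omega
  by_cases h1 : round ≤ R
  · -- A collision round.
    rw [if_neg (by simp only [Expr.eval, hvl, unary_eq_nil]; omega)]
    obtain ⟨cnt, hsrc⟩ : ∃ cnt : (Fin n → Bool) → (Fin n → Bool) → ℕ,
        lazyHandler (ghostHandler S F α l R n sk pk) .verifier m (gs, T) =
        ((OComp.query (key, (unpair m).1) fun v => .ret v).lazy T).bind fun a =>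
          ((OComp.query (key, (unpair m).2) fun v => .ret v).lazy a.2).bind fun a' =>
            if round < R then (PMF.uniformOfFintype (Fin n → Bool)).map fun v => (List.ofFn v,
              ⟨gs.session, .active (round + 1) (List.ofFn v) (cnt a.1 a'.1) inner, 0⟩, a'.2)
            else PMF.pure ([],
              ⟨gs.session, .active (round + 1) key (cnt a.1 a'.1) inner, 0⟩, a'.2) := by
      classical
      refine ⟨fun v v' => if 0 < round ∧ Wins α l n gs.queries m v v' then count + 1 else count, ?_⟩
      simp only [lazyHandler, hgh, ghostVerify, h1, if_true]
      rw [OComp.lazy_query, PMF.map_bind]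
      congr! 2 with a
      rw [OComp.lazy_query, PMF.map_bind]
      congr! 2 with a'
      split_ifs <;> simp [OComp.lazy, PMF.map, Function.comp_def]
    rw [hsrc] at H ⊢
    rw [expect_bind]
    have hinner : inner = none := by
      cases inner with
      | none => rfl
      | some v => exact absurd hin.2 (by omega)
    subst hinner
    have hLT : ∀ j ≤ N, j * (10 * M + 7) ≤ L := fun j hj => (Nat.mul_le_mul_right _ hj).trans hL
    have hqlen : ∀ z : List Bool, z.length ≤ m.length → (pair key z).length ≤ 2 * n + 1 + X := by
      intro z hz
      rw [length_pair]
      omega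
    refine le_value_seq (by omega) ?_
    have hq1 : (Expr.pair (.reg regKey) (.fst (x.rename (5 * ·)))).eval μ =
        pair key (unpair m).1 := by simp [Expr.eval, hkey, hm]
    rw [← unpair_pair key (unpair m).1, ← hq1] at H ⊢
    refine expect_le_value_hashCmd (L := L) (C := 10 * M) T _ μ _ _ hrel.cache hrel.param ?_
      ((hrel.within.length_encode_le (by omega)).trans hL) ?_ (by omega) (by omega) ?_
    · have := hqlen (unpair m).1 (by omega)
      simp only [Expr.cost, hq1]
      simp only [Expr.eval, hkey, ← hm]
      omega
    · have := hqlen (unpair m).1 (by omega)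
      rw [hq1]
      omega
    intro v T1 μ1 t2 ht2 hsup1 hTT1 hres1 hcache1 hfr1
    have hfr1' : ∀ j, j < 51 → μ1 j = μ j := fun j hj =>
      hfr1 j fun h => by unfold IsScratch at h; omega
    have hwithin : ∀ (j : ℕ) (T T' : Cache n) (z : List Bool) (v : Fin n → Bool),
        T.Within j M → z.length ≤ m.length → (T' = T ∨ T' = ((key, z), v) :: T) →
        T'.Within (j + 1) M := by
      rintro j T T' z v hT hz (rfl | rfl)
      · exact hT.mono (by omega)
      · exact hT.cons (by simp only; omega) v
    have hT1 : T1.Within (T.length + 1) M := by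
      rw [hq1, unpair_pair] at hTT1
      exact hwithin _ _ _ _ _ ⟨le_rfl, hrel.within.2⟩ (by omega) hTT1
    rw [expect_bind]
    refine le_value_seq (by omega) ?_
    have hx1 := x.eval_rename_congr (ρ := (5 * ·)) (μ := μ) (μ' := μ1)
      fun j => hfr1 _ (by simp only [IsScratch]; omega)
    have hq2 : (Expr.pair (.reg regKey) (.snd (x.rename (5 * ·)))).eval μ1 =
        pair key (unpair m).2 := by
      simp only [Expr.eval, hx1.1, hfr1' regKey (by decide), hkey, ← hm]
    rw [← unpair_pair key (unpair m).2, ← hq2] at H ⊢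
    refine expect_le_value_hashCmd (L := L) (C := 10 * M) T1 _ μ1 _ _ hcache1 ?_ ?_
      ((hT1.length_encode_le (by omega)).trans (hLT _ (by omega))) ?_ (by omega) (by omega) ?_
    · rw [hfr1' regParam (by decide), hrel.param]
    · have := hqlen (unpair m).2 (by omega)
      simp only [Expr.cost, hq2]
      simp only [Expr.eval, hx1.1, hx1.2, hfr1' regKey (by decide), hkey, ← hm]
      omega
    · have := hqlen (unpair m).2 (by omega)
      rw [hq2]
      omega
    intro v' T2 μ2 t3 ht3 hsup2 hTT2 hres2 hcache2 hfr2
    have hfr2' : ∀ j, j < 51 → μ2 j = μ j := fun j hj => by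
      rw [hfr2 j fun h => by unfold IsScratch at h; omega, hfr1' j hj]
    have hT2 : T2.Within (T.length + 2) M := by
      rw [hq2, unpair_pair] at hTT2
      exact hwithin _ _ _ _ _ hT1 (by omega) hTT2
    have hT2l := hT2.1
    refine le_value_seq (by omega) ?_
    refine le_value_assign 3 (by simp [Expr.cost, Expr.eval]) (by omega) fun t4 ht4 => ?_
    refine le_value_seq (by omega) ?_
    refine le_value_assign (2 * R + 5) ?_ (by omega) fun t5 ht5 => ?_
    · simp [Expr.cost, Expr.eval, hfr2', hvl, length_unary]
      omega
    set μ3 := Function.update (Function.update μ2 regMet ((Expr.push true .empty).eval μ2)) regVLeft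
      ((Expr.reg regVLeft).tail.eval
        (Function.update μ2 regMet ((Expr.push true .empty).eval μ2))) with hμ3
    have hadv : ∀ j, μ3 (5 * j) = μ (5 * j) := by
      intro j
      rw [hμ3, Function.update_of_ne (by omega), Function.update_of_ne (by omega),
        hfr2 _ (by unfold IsScratch; omega), hfr1 _ (by unfold IsScratch; omega)]
    have hleft : μ3 regVLeft = unary (R + 1 - (round + 1)) := by
      rw [hμ3]
      simp only [Function.update_self, Expr.eval]
      rw [Function.update_of_ne (by decide), hfr2' _ (by decide), hvl, tail_unary]
      congr 1
    have hmet3 : μ3 regMet = [true] := by simp [hμ3, Expr.eval]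
    have hfr3 : ∀ j, j < 51 → j ≠ regMet → j ≠ regVLeft → μ3 j = μ j := by
      intro j hj h4 h5
      rw [hμ3, Function.update_of_ne h5, Function.update_of_ne h4, hfr2' j hj]
    have hcache3 : μ3 regCache = T2.encode := by simp [hμ3, hcache2]
    have hlenk : T2.length + k * σ ≤ N := by omega
    refine le_value_cond (R + 2) ?_ (by omega) fun t6 ht6 => ?_
    · simp [Expr.cost, hleft, length_unary]
      omega
    by_cases h2 : round < R
    · simp only [h2, if_true] at H ⊢
      rw [if_neg (by simp only [Expr.eval, hleft, unary_eq_nil]; omega)]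
      rw [expect_map]
      refine le_value_seq (by omega) ?_
      refine expect_le_value_sampleCmd (L := L) μ3 _ _ ?_ (by omega) (by omega) ?_
      · rw [hfr3 _ (by decide) (by decide) (by decide), hrel.param]
      intro κ μ4 t7 ht7 hres hfr4
      refine le_value_seq (by omega) ?_
      refine le_value_assign (1 + n) (by simp [Expr.cost, hres]) (by omega) fun t8 ht8 => ?_
      refine le_value_assign (1 + n) (by simp [Expr.cost, hres]) (by omega) fun t9 ht9 => ?_
      refine H (List.ofFn κ,
        ⟨gs.session, .active (round + 1) (List.ofFn κ) (cnt v v') none, 0⟩, T2) ?_ _ _ _ ?_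
        (Or.inl ⟨?_, ?_, ?_⟩)
      · refine (PMF.mem_support_bind_iff _ _ _).2 ⟨(v, T1), hsup1,
          (PMF.mem_support_bind_iff _ _ _).2 ⟨(v', T2), hsup2, ?_⟩⟩
        exact (PMF.mem_support_map_iff _ _ _).2 ⟨κ, by simp, rfl⟩
      · simp only
        omega
      · simp [Expr.eval, hres]
      · intro j _ hji
        rw [Function.update_of_ne (by omega), Function.update_of_ne (by omega),
          hfr4 _ (by omega) (by omega) (by omega), hadv]
      · refine ⟨?_, ?_, ?_, ?_, hlenk, hT2.mono (by omega), ?_, ?_, ?_, by simp, hin⟩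
        · simp [update_adversaryReg_of_residue, hfr4, hfr3, hrel.param]
        · simp [update_adversaryReg_of_residue, hfr4, hfr3, hrel.fullPk]
        · simp [update_adversaryReg_of_residue, hfr4, hfr3, hrel.rounds]
        · simp [update_adversaryReg_of_residue, hfr4, hcache3]
        · simp [update_adversaryReg_of_residue, hfr4, hmet3]
        · simp [update_adversaryReg_of_residue, hfr4, hleft]
        · simp [update_adversaryReg_of_residue, Expr.eval, hres]
    · simp only [h2, if_false] at H ⊢
      rw [if_pos (by simp only [Expr.eval, hleft, unary_eq_nil]; omega)]
      rw [expect_pure]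
      refine le_value_assign 1 (by simp [Expr.cost]) (by omega) fun t7 ht7 => ?_
      refine H ([], ⟨gs.session, .active (round + 1) key (cnt v v') none, 0⟩, T2) ?_ _ _ _ ?_
        (Or.inl ⟨?_, ?_, ?_⟩)
      · refine (PMF.mem_support_bind_iff _ _ _).2 ⟨(v, T1), hsup1,
          (PMF.mem_support_bind_iff _ _ _).2 ⟨(v', T2), hsup2, by simp⟩⟩
      · simp only
        omega
      · simp [Expr.eval]
      · intro j _ hji
        rw [Function.update_of_ne (by omega), hadv]
      · refine ⟨?_, ?_, ?_, ?_, hlenk, hT2.mono (by omega), ?_, ?_, ?_, hkn, hin⟩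
        · simp [update_adversaryReg_of_residue, hfr3, hrel.param]
        · simp [update_adversaryReg_of_residue, hfr3, hrel.fullPk]
        · simp [update_adversaryReg_of_residue, hfr3, hrel.rounds]
        · simp [update_adversaryReg_of_residue, hcache3]
        · simp [update_adversaryReg_of_residue, hmet3]
        · simp [update_adversaryReg_of_residue, hleft]
        · simp [update_adversaryReg_of_residue, hfr3, hkey]
  · -- The given scheme's part.
    rw [if_pos (by simp only [Expr.eval, hvl, unary_eq_nil]; omega)]
    have hmet' := hmet (by omega)
    have hsrc : lazyHandler (ghostHandler S F α l R n sk pk) .verifier m (gs, T) =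
        ((match inner with
          | some v => PMF.pure v
          | none => S.verifierInit n pk).bind fun v => S.verifierStep v m).map
          fun (a : S.VState × (List Bool ⊕ Bool)) =>
          match a.2 with
          | .inl reply => (reply, ⟨gs.session, .active round key count (some a.1), 0⟩, T)
          | .inr b => ([b || decide (R ≤ 4 * count)], ⟨gs.session, .done b count, 0⟩, T) := by
      simp only [lazyHandler, hgh, ghostVerify, h1, if_false, OComp.lazy, PMF.map, PMF.bind_bind]
      congr! 4 with v a
      obtain ⟨a, reply | b⟩ := a <;> simp [OComp.lazy]
    have htgt : plainHandler S n sk pk .verifier m e' =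
        ((match inner with
          | some v => PMF.pure v
          | none => S.verifierInit n pk).bind fun v => S.verifierStep v m).map
          fun (a : S.VState × (List Bool ⊕ Bool)) =>
          match a.2 with
          | .inl reply => (reply, { e' with verifier := .active a.1, queries := 0 })
          | .inr b => ([b], { e' with verifier := .done b, queries := 0 }) := by
      cases inner with
      | none =>
        simp only [plainHandler, gameHandler, hin, PMF.map_bind]
        rfl
      | some v =>
        simp only [plainHandler, gameHandler, hin.1, PMF.pure_bind]
        rfl
    rw [hsrc] at H ⊢
    rw [value_ask (by omega), htgt, expect_map, expect_map]
    refine expect_mono fun a ha => ?_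
    have H' := H _ ((PMF.mem_support_map_iff _ _ _).2 ⟨a, ha, rfl⟩)
    obtain ⟨v, reply | b⟩ := a
    · refine H' _ _ _ ?_ (Or.inl ⟨by simp, ?_, ?_⟩)
      · simp only
        omega
      · intro j _ hji
        rw [Function.update_of_ne (by omega)]
      · have hm := hrel.mono
        refine ⟨?_, ?_, ?_, ?_, hm.length_le, hm.within, ?_, ?_, ?_, hkn, rfl, by omega⟩
        · simp [update_adversaryReg_of_residue, hm.param]
        · simp [update_adversaryReg_of_residue, hm.fullPk]
        · simp [update_adversaryReg_of_residue, hm.rounds]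
        · simp [update_adversaryReg_of_residue, hm.cache]
        · simp [update_adversaryReg_of_residue, hmet']
        · simp [update_adversaryReg_of_residue, hvl]
        · simp [update_adversaryReg_of_residue, hkey]
    · refine H' _ _ _ ?_ (Or.inr rfl)
      simp only [List.length_singleton]
      omega

end AskVerifier

/-! ### Simulation of the game against the augmented scheme -/

section GameSimulation

variable {S : IdScheme} {F : Searcher} {α : ℝ} {l R n : ℕ} {sk pk : List Bool}

/-- The decision of the given scheme's verifier is the same in both games, and it is final. -/
theorem GameOver.expect_runSteps_le_value {s : GhostState S × Cache n} {e : GameState S.toTimed}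
    (h : GameOver S s e) {B B' : ℕ} (m : ℕ) (c : Config (GhostState S × Cache n))
    (d : Config (GameState S.toTimed)) (hc : c.env = s) (hd : d.env = e) :
    expect (runSteps (lazyHandler (ghostHandler S F α l R n sk pk)) B m c)
        (fun c => c.env.1.innerAccepted) ≤
      value (plainHandler S n sk pk) B' (fun e => if e.verifier.accepted then 1 else 0) d := by
  obtain ⟨⟨ses, ver, q⟩, T⟩ := s
  cases ver with
  | idle => exact h.elim
  | active round key count inner => exact h.elim
  | done b count =>
    have he : e.verifier = .done b := h
    cases b with
    | false =>
      refine (expect_le (c := 0) fun c' hc' => ?_).trans zero_le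
      have := runSteps_env_invariant (P := fun s : GhostState S × Cache n =>
        s.1.verifier = .done false count) ?_ m c (by rw [hc]) c' hc'
      · simp [GhostState.innerAccepted, this]
      · rintro p x ⟨⟨ses, ver, q⟩, T⟩ rfl a ha
        simp only [lazyHandler, PMF.mem_support_map_iff] at ha
        obtain ⟨b, hb, rfl⟩ := ha
        cases p with
        | hash =>
          simp only [ghostHandler, OComp.lazy] at hb
          split at hb
          · simp only [PMF.support_pure, Set.mem_singleton_iff] at hb
            subst hb
            rfl
          · simp only [PMF.mem_support_bind_iff, PMF.support_pure, Set.mem_singleton_iff] at hb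
            obtain ⟨v, -, rfl⟩ := hb
            rfl
        | _ =>
          simp only [ghostHandler, OComp.lazy, PMF.support_pure, Set.mem_singleton_iff] at hb
          subst hb
          rfl
    | true =>
      refine (expect_le (c := 1) fun c' hc' => ?_).trans (le_expect fun d' hd' => ?_)
      · unfold GhostState.innerAccepted
        split <;> simp
      · have := runSteps_env_invariant (P := fun e : GameState S.toTimed =>
          e.verifier = .done true) ?_ _ d (by rw [hd, he]) d' hd'
        · simp [VStatus.accepted, this]
        · rintro p x e he a ha
          cases p <;> simp only [plainHandler, gameHandler, he, PMF.support_pure,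
            Set.mem_singleton_iff] at ha <;> subst ha <;> first | exact he | rfl

/-- A bound for the cost of an expression of the adversary, hence for the lengths of its requests;
`w` bounds the size of its program, `Λ` the total length of its inputs, and `B` its time. -/
def maxRequest (w Λ B : ℕ) : ℕ := w * (Λ + B + 1)

/-- A bound for the time of the honest prover's program on a round key chosen by the adversary. -/
def maxHonest (F : Searcher) (w Λ B : ℕ) : ℕ := F.time.eval (Λ + maxRequest w Λ B)

/-- A bound for the length of a hash query, no matter who makes it. -/
def maxQuery (F : Searcher) (w Λ B : ℕ) : ℕ :=
  (F.prog.size + 1) * (Λ + maxRequest w Λ B + maxHonest F w Λ B + 1)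

/-- A bound for the length of the encoded cache and of the other bookkeeping registers; `R` is the
number of rounds. -/
def maxCache (F : Searcher) (w Λ B R : ℕ) : ℕ :=
  B * (maxHonest F w Λ B + 2) * (10 * maxQuery F w Λ B + 7) + 10 * maxQuery F w Λ B + R + 10

/-- A bound for the time that it takes to answer one request of the adversary. -/
def requestTime (F : Searcher) (w Λ B R : ℕ) : ℕ :=
  F.cost (maxQuery F w Λ B) (maxCache F w Λ B R) (maxHonest F w Λ B) +
    2 * hashCost (10 * maxQuery F w Λ B) (maxCache F w Λ B R) +
    40 * ((maxCache F w Λ B R + 1) * (maxCache F w Λ B R + 1)) + 20 * maxCache F w Λ B R + 100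

/-- A program that answers the adversary's requests from bookkeeping registers in their initial
state makes the given scheme's verifier accept with at least the adversary's chance. -/
theorem value_innerAccepted_le_value_compile (A : Adversary) {w Λ B B' : ℕ} (hw : A.prog.size ≤ w)
    (hΛ : n + (pair pk (unary l)).length + (A.advice n).length ≤ Λ) (hB : B = A.time.eval n)
    (μ : Mem) (e : GameState S.toTimed) (t : ℕ) (ht : t + B * requestTime F w Λ B R + B ≤ B')
    (h0 : μ 0 = unary n) (h5 : μ 5 = pair pk (unary l)) (h10 : μ 10 = A.advice n)
    (hμ : ∀ i, 3 ≤ i → μ (5 * i) = []) (hparam : μ regParam = unary n)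
    (hfull : μ regFullPk = pair pk (unary l)) (hrounds : μ regRounds = unary R)
    (hopen : μ regOpen = []) (hmet : μ regMet = []) (hvl : μ regVLeft = unary (R + 1))
    (hkey : μ regKey = []) (hcache : μ regCache = []) (he : e.verifier = .idle) :
    value (lazyHandler (ghostHandler S F α l R n sk pk)) (A.time.eval n)
        (fun s => s.1.innerAccepted) (lazyStart S A n l pk) ≤
      value (plainHandler S n sk pk) B' (fun e => if e.verifier.accepted then 1 else 0)
        ⟨[A.prog.compile (5 * ·) (adversaryAsk F)], μ, ket ∅, e, t⟩ := by
  rw [← hB]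
  set X := maxRequest w Λ B with hX
  set BF := maxHonest F w Λ B with hBF
  set M := maxQuery F w Λ B with hM
  set L := maxCache F w Λ B R with hL
  set D := requestTime F w Λ B R with hD
  set N := B * (BF + 2) with hN
  have hM1 : (F.prog.size + 1) * (Λ + X + BF + 1) = M := rfl
  have hM2 : Λ + X + BF + 1 ≤ M := le_trans (Nat.le_mul_of_pos_left _ (by omega)) hM1.le
  have hL1 : L = N * (10 * M + 7) + 10 * M + R + 10 := rfl
  have hL2 : L + 1 ≤ (L + 1) * (L + 1) := by nlinarith
  have hD1 : D = F.cost M L BF + 2 * hashCost (10 * M) L + 40 * ((L + 1) * (L + 1)) + 20 * L +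
    100 := rfl
  have hhash : hashCost X L ≤ hashCost (10 * M) L := by
    unfold hashCost
    omega
  have hactive : ∀ (k : ℕ) (s : GhostState S × Cache n) (μ : Mem) (e : GameState S.toTimed),
      GameRel S R n N M (BF + 2) (pair pk (unary l)) k s μ e → s.1.innerAccepted = 0 := by
    rintro k ⟨⟨ses, ver, q⟩, T⟩ μ e h
    cases ver with
    | done b count => exact h.state.elim
    | _ => rfl
  have hmain := expect_runSteps_le_value_compile
    (h := lazyHandler (ghostHandler S F α l R n sk pk)) (h' := plainHandler S n sk pk)
    (B := B) (B' := B') (acc := fun e => if e.verifier.accepted then 1 else 0) (ρ := (5 * ·))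
    (a := adversaryAsk F) (w := w) (L := Λ) (D := D) (N := B') (slack := true) (track := true)
    (J := fun k s μ _ e => GameRel S R n N M (BF + 2) (pair pk (unary l)) k s μ e)
    (Term := GameOver S) (f := fun c => c.env.1.innerAccepted) (K := [])
    (fun i j h => by simpa using h) (fun k s μ ψ e h => h.mono) ?_ (fun _ _ _ _ _ _ _ h => h) ?_
    (fun s e h m c todo μ ψ t hc => h.expect_runSteps_le_value m c _ hc rfl) ?_ ?_ ?_ le_rfl B
    (lazyStart S A n l pk) μ (ket ∅) e t ?_ ?_ ?_ (fun _ => rfl) (by simp) (Or.inl ?_)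
  · exact hmain
  · intro k s μ ψ e i x h
    exact h.congr fun j hj _ => update_adversaryReg_of_residue (by omega)
  · intro k i p x s μ ψ e' K t g hi hx hJ htB H
    simp only [if_true] at H
    have H' : ∀ b ∈ (lazyHandler (ghostHandler S F α l R n sk pk) p ((x.rename (5 * ·)).eval μ)
        s).support, ∀ μ' e'' t', t' ≤ t + D + b.1.length →
        ((μ' (5 * i) = b.1 ∧ (∀ j < w, j ≠ i → μ' (5 * j) = μ (5 * j)) ∧
          GameRel S R n N M (BF + 2) (pair pk (unary l)) k b.2 μ' e'') ∨ GameOver S b.2 e'') →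
        g b ≤ value (plainHandler S n sk pk) B'
          (fun e => if e.verifier.accepted then 1 else 0) ⟨K, μ', ψ, e'', t'⟩ := by
      intro b hb μ' e'' t' ht' hor
      refine H b hb μ' ψ e'' t' ht' (hor.imp_left fun h => ⟨h.1, h.2.1, rfl, h.2.2⟩)
    have hhonest : F.time.eval (n + (pair pk (unary l)).length + X) ≤ BF :=
      eval_mono _ (by omega)
    have hMle : (F.prog.size + 1) * (n + (pair pk (unary l)).length + X + BF + 1) ≤ M :=
      le_trans (Nat.mul_le_mul_left _ (by omega)) hM1.le
    cases p with
    | hash =>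
      exact simulatesPort_hash (L := L) (X := X) (by omega) (by omega) (by omega) (by omega)
        k i x s μ ψ e' K t g hx hJ htB H'
    | session =>
      exact simulatesPort_session (X := X) (by omega) k i x s μ ψ e' K t g hx hJ htB H'
    | prover =>
      exact simulatesPort_prover (L := L) (X := X) hhonest hMle (by omega) (by omega) (by omega)
        k i x s μ ψ e' K t g hx hJ htB H'
    | verifier =>
      exact simulatesPort_verifier (L := L) (X := X) (by omega) (by omega) (by omega) (by omega)
        (by omega) k i x s μ ψ e' K t g hx hJ htB H'
  · intro k c μ ψ e t _ hJ _ _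
    rw [hactive _ _ _ _ hJ]
    exact zero_le
  · intro k c μ ψ e t todo _ hJ
    rw [hactive _ _ _ _ hJ]
    exact zero_le
  · have : w * (Λ + B + 1) = X := rfl
    omega
  · refine ⟨fun i => (length_inputs_le _ _ _ i).trans ?_, ?_⟩
    · simp only [length_unary, lazyStart]
      omega
    · simpa [lazyStart] using hw
  · refine ⟨hparam, hfull, hrounds, by simp [lazyStart, hcache, Cache.encode], ?_, ?_, ?_⟩
    · simp [lazyStart, hN]
    · simp [lazyStart, Cache.Within]
    · exact ⟨hmet, hvl, hkey, he, hopen⟩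
  · intro i _
    match i with
    | 0 => exact h0
    | 1 => exact h5
    | 2 => exact h10
    | i + 3 => exact hμ (i + 3) (by omega)
  · simp only [if_true, lazyStart]
    omega

end GameSimulation

/-! ### Computing the parameters -/

/-- A program that computes a function of the security parameter runs without an environment: all
its requests are answered by the empty string. -/
def Cmd.standalone (ρ : ℕ → ℕ) (p : Cmd) : Cmd := p.compile ρ fun i _ _ => .assign i .empty

theorem hashHandler_noOracle (p : Port) (x : List Bool) (u : Unit) :
    hashHandler noOracle p x u = PMF.pure ([], u) := by
  cases p <;> rfl

/-- The time that the simulation of a program with time `B` takes. -/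
def standaloneTime (p : Cmd) (n B : ℕ) : ℕ := B * (2 * ((p.size + 1) * (n + B + 1)) + 10)

/-- Rule for a program that computes `1^v` from `1^n` without an environment: it leaves the result
in its output register and changes no registers but its own. -/
theorem le_value_standalone {E : Type} {h : Handler E} {B' : ℕ} {f : E → ℝ≥0∞} {K : List Cmd}
    {ψ : QState} {e : E} {p : Cmd} {B n v : ℕ} (hp : p.IsClassical)
    (hrun : ∀ c ∈ (run (hashHandler noOracle) B p (inputs (unary n) [] []) ()).support,
      c.todo = [] ∧ c.mem 0 = unary v) {ρ : ℕ → ℕ} (hρ : Function.Injective ρ) (μ : Mem) (t : ℕ)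
    (h0 : μ (ρ 0) = unary n) (hμ : ∀ i, i ≠ 0 → μ (ρ i) = []) (X : ℝ≥0∞)
    (ht : t + standaloneTime p n B ≤ B')
    (H : ∀ μ' t', t' ≤ t + standaloneTime p n B → μ' (ρ 0) = unary v →
      (∀ j, (∀ i, j ≠ ρ i) → μ' j = μ j) → X ≤ value h B' f ⟨K, μ', ψ, e, t'⟩) :
    X ≤ value h B' f ⟨p.standalone ρ :: K, μ, ψ, e, t⟩ := by
  have hX : X = expect (runSteps (hashHandler noOracle) B B
      ⟨[p], inputs (unary n) [] [], ket ∅, (), 0⟩)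
      fun c => if c.todo = [] ∧ c.mem 0 = unary v then X else 0 := by
    exact ((expect_congr fun c hc => if_pos (hrun c hc)).trans (expect_const _ X)).symm
  rw [hX]
  unfold standaloneTime at ht H
  have hmain := expect_runSteps_le_value_compile (h := hashHandler noOracle) (h' := h)
    (B := B) (B' := B') (acc := f) (ρ := ρ) (a := fun i _ _ => .assign i .empty) (w := p.size + 1)
    (L := n) (D := 2 * ((p.size + 1) * (n + B + 1)) + 10)
    (N := t + B * (2 * ((p.size + 1) * (n + B + 1)) + 10)) (slack := false) (track := false)
    (J := fun _ _ μ' ψ' e' => e' = e ∧ ψ' = ψ ∧ ∀ j, (∀ i, j ≠ ρ i) → μ' j = μ j)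
    (Term := fun _ _ => False)
    (f := fun c => if c.todo = [] ∧ c.mem 0 = unary v then X else 0) (K := K)
    hρ (fun _ _ _ _ _ h => h) ?_ (by simp) ?_ (by simp) ?_ ?_ (by omega) (by omega) B
    ⟨[p], inputs (unary n) [] [], ket ∅, (), 0⟩ μ ψ e t ?_ ⟨rfl, rfl, fun _ _ => rfl⟩ ?_ (by simp)
    (by simpa using hp) (Or.inl (by simp))
  · exact hmain
  · rintro k s μ' ψ' e' i x ⟨h1, h2, h3⟩
    refine ⟨h1, h2, fun j hj => ?_⟩
    rw [Function.update_of_ne (hj i), h3 j hj]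
  · rintro k i q x s μ' ψ' e' K' t' g hi hx ⟨rfl, rfl, h3⟩ htB Hk
    simp only [hashHandler_noOracle, PMF.support_pure, Set.mem_singleton_iff, forall_eq,
      Bool.false_eq_true, if_false, add_zero, or_false] at Hk ⊢
    rw [expect_pure]
    refine le_value_assign 1 (by simp [Expr.cost]) (by omega) fun t1 ht1 => ?_
    refine Hk _ _ _ _ (by omega) ⟨by simp [Expr.eval], fun j _ hji => ?_, rfl, rfl, rfl,
      fun j hj => ?_⟩
    · rw [Function.update_of_ne (hρ.ne hji)]
    · rw [Function.update_of_ne (hj i), h3 j hj]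
  · rintro k c μ' ψ' e' t' hnil ⟨rfl, rfl, h3⟩ hreg htN
    split_ifs with hc
    · exact H μ' t' (htN rfl) (by rw [hreg 0 (by omega), hc.2]) h3
    · exact zero_le
  · rintro k c μ' ψ' e' t' todo hne -
    simp [hne]
  · refine ⟨fun i => (length_inputs_le _ _ _ i).trans (by simp [length_unary]), by simp⟩
  · intro i _
    match i with
    | 0 => exact h0
    | 1 => exact hμ 1 (by omega)
    | 2 => exact hμ 2 (by omega)
    | i + 3 => exact hμ (i + 3) (by omega)

/-- The output of a program of bounded running time is of bounded length. -/
theorem length_mem_le_of_run {p : Cmd} {n B : ℕ} :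
    ∀ c ∈ (run (hashHandler noOracle) B p (inputs (unary n) [] []) ()).support,
      ∀ i, (c.mem i).length ≤ n + B + (p.size * (n + B + 1) + 1) := by
  intro c hc
  refine (runSteps_induction (P := fun c => c.Bounded n p.size ∧
    ∀ i, (c.mem i).length ≤ n + B + (p.size * (n + B + 1) + 1)) ?_ B _ ⟨⟨?_, ?_⟩, ?_⟩ c hc).2
  · rintro c ⟨hc, hlen⟩ hne htime c' hc'
    refine ⟨hc.step c' hc', ?_⟩
    have hcost := hc.cost_le htime
    obtain ⟨todo, μ, ψ, e, t⟩ := c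
    obtain ⟨q, Q, rfl⟩ := List.exists_cons_of_ne_nil hne
    have hsize := hc.size_le q List.mem_cons_self
    simp only at hlen hcost hsize
    have hupd : ∀ i y, y.length ≤ p.size * (n + B + 1) + 1 → ∀ j,
        (Function.update μ i y j).length ≤ n + B + (p.size * (n + B + 1) + 1) := by
      intro i y hy j
      rw [Function.update_apply]
      split_ifs
      · omega
      · exact hlen j
    cases q <;> simp only [step, PMF.support_pure, Set.mem_singleton_iff, PMF.mem_support_map_iff,
      hashHandler_noOracle] at hc'
    case assign i x =>
      subst hc'
      simp only [Cmd.size] at hsize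
      have h1 := hcost x (by omega)
      have h2 := x.length_eval_lt_cost μ
      exact hupd _ _ (by omega)
    case coin i =>
      obtain ⟨b, -, rfl⟩ := hc'
      exact hupd _ _ (by simp)
    case measure i x =>
      obtain ⟨b, -, rfl⟩ := hc'
      exact hupd _ _ (by simp)
    case ask i q x =>
      obtain ⟨b, rfl, rfl⟩ := hc'
      exact hupd _ _ (by simp)
    all_goals
      subst hc'
      exact hlen
  · exact fun i => (length_inputs_le _ _ _ i).trans (by simp [length_unary])
  · simp
  · exact fun i => (length_inputs_le _ _ _ i).trans (by simp [length_unary]; omega)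

/-! ### The reduction -/

/-- The adversary against the given scheme: it computes `1^ℓ` and `1^r` by the programs `pℓ` and
`pr`, sets up the registers, and runs the adversary `a` against the augmented scheme, answering its
requests itself where they do not concern the given scheme. -/
def reduction (F : Searcher) (pℓ pr a : Cmd) : Cmd :=
  .seq (.assign 10 (.reg 2)) <|
  .seq (.assign regParam (.reg 0)) <|
  .seq (.assign 3 (.reg 0)) <|
  .seq (pℓ.standalone (5 * · + 3)) <|
  .seq (.assign 5 (.pair (.reg regPk) (.reg 3))) <|
  .seq (.assign regFullPk (.reg 5)) <|
  .seq (.assign 4 (.reg 0)) <|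
  .seq (pr.standalone (5 * · + 4)) <|
  .seq (.assign regRounds (.reg 4)) <|
  .seq (.assign regVLeft (.push true (.reg regRounds))) (a.compile (5 * ·) (adversaryAsk F))

theorem isClassical_reduction {F : Searcher} {pℓ pr a : Cmd} (hℓ : pℓ.IsClassical)
    (hr : pr.IsClassical) (ha : a.IsClassical) : (reduction F pℓ pr a).IsClassical := by
  have h1 : ∀ (ρ : ℕ → ℕ) (p : Cmd), p.IsClassical → (p.standalone ρ).IsClassical :=
    fun ρ p hp => hp.compile (a := fun i _ _ => .assign i .empty) fun _ _ _ => trivial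
  exact ⟨trivial, trivial, trivial, h1 _ _ hℓ, trivial, trivial, trivial, h1 _ _ hr, trivial,
    trivial, ha.compile fun i p x => isClassical_adversaryAsk F i p x⟩

/-- The running time of the reduction, in terms of the bounds `Λ` for the lengths of its inputs,
`R` for the number of rounds, and `B`, `Bℓ`, `Br` for the times of the three programs. -/
def reductionTime (F : Searcher) (pℓ pr a : Cmd) (n Λ R B Bℓ Br : ℕ) : ℕ :=
  standaloneTime pℓ n Bℓ + standaloneTime pr n Br + 20 * (Λ + R) + 100 +
    B * requestTime F a.size Λ B R + B

/-- The reduction, started on its own inputs, sets up the registers as the simulation needs them. -/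
theorem value_innerAccepted_le_value_reduction {S : IdScheme} {F : Searcher} {α : ℝ}
    {l R n : ℕ} {sk pk : List Bool} {pℓ pr : Cmd} {Bℓ Br : ℕ} (A : Adversary)
    (hpℓ : pℓ.IsClassical) (hpr : pr.IsClassical)
    (hrunℓ : ∀ c ∈ (run (hashHandler noOracle) Bℓ pℓ (inputs (unary n) [] []) ()).support,
      c.todo = [] ∧ c.mem 0 = unary l)
    (hrunr : ∀ c ∈ (run (hashHandler noOracle) Br pr (inputs (unary n) [] []) ()).support,
      c.todo = [] ∧ c.mem 0 = unary R)
    {Λ B' : ℕ} (hΛ : n + (pair pk (unary l)).length + (A.advice n).length ≤ Λ)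
    (hB' : reductionTime F pℓ pr A.prog n Λ R (A.time.eval n) Bℓ Br ≤ B') :
    value (lazyHandler (ghostHandler S F α l R n sk pk)) (A.time.eval n)
        (fun s => s.1.innerAccepted) (lazyStart S A n l pk) ≤
      value (plainHandler S n sk pk) B' (fun e => if e.verifier.accepted then 1 else 0)
        ⟨[reduction F pℓ pr A.prog], inputs (unary n) pk (A.advice n), ket ∅,
          ⟨none, .idle, 0⟩, 0⟩ := by
  unfold reductionTime at hB'
  have hlen : (pair pk (unary l)).length = 2 * pk.length + 1 + l := by
    rw [length_pair, length_unary]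
  have hl := length_unary l
  have hn := length_unary n
  have hR := length_unary R
  refine le_value_seq (by omega) ?_
  refine le_value_assign (1 + Λ) (by simp [Expr.cost, inputs]; omega) (by omega) fun t1 ht1 => ?_
  refine le_value_seq (by omega) ?_
  refine le_value_assign (1 + n) (by simp [Expr.cost, inputs, hn]) (by omega) fun t2 ht2 => ?_
  refine le_value_seq (by omega) ?_
  refine le_value_assign (1 + n) (by simp [Expr.cost, inputs, hn]) (by omega) fun t3 ht3 => ?_
  set μ1 : Mem := Function.update (Function.update (Function.update
    (inputs (unary n) pk (A.advice n)) 10 (A.advice n)) 11 (unary n)) 3 (unary n) with hμ1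
  have hin : ∀ j, 3 ≤ j → inputs (unary n) pk (A.advice n) j = [] := by
    intro j hj
    match j with
    | j + 3 => rfl
  have hμ1' : ∀ j, 3 ≤ j → j ≠ 10 → j ≠ 11 → j ≠ 3 → μ1 j = [] := by
    intro j h3 h4 h5 h6
    rw [hμ1, Function.update_of_ne h6, Function.update_of_ne h5, Function.update_of_ne h4, hin j h3]
  refine le_value_seq (by omega) ?_
  refine le_value_standalone (ρ := (5 * · + 3)) hpℓ hrunℓ (fun i j h => by simpa using h) μ1 _ rfl
    (fun i hi => hμ1' _ (by omega) (by omega) (by omega) (by omega)) _ (by omega) ?_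
  intro μ2 t4 ht4 h2 hfr2
  have hμ2 : ∀ j, j % 5 ≠ 3 → μ2 j = μ1 j := fun j hj => hfr2 j fun i => by omega
  have hμ2l : μ2 3 = unary l := h2
  refine le_value_seq (by omega) ?_
  refine le_value_assign (4 * Λ + 10) ?_ (by omega) fun t5 ht5 => ?_
  · simp only [Expr.cost, Expr.eval, hμ2l, hμ2 1 (by decide)]
    have : μ1 1 = pk := rfl
    rw [this, hlen, hl]
    omega
  have h5 : Expr.eval μ2 (.pair (.reg 1) (.reg 3)) = pair pk (unary l) := by
    simp only [Expr.eval, hμ2l, hμ2 1 (by decide)]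
    rfl
  rw [h5]
  refine le_value_seq (by omega) ?_
  refine le_value_assign (1 + Λ) ?_ (by omega) fun t6 ht6 => ?_
  · simp only [Expr.cost, Function.update_self]
    omega
  refine le_value_seq (by omega) ?_
  refine le_value_assign (1 + n) ?_ (by omega) fun t7 ht7 => ?_
  · simp [Expr.cost, hμ2, hμ1, inputs, hn]
  set μ3 : Mem := Function.update (Function.update (Function.update μ2 5 (pair pk (unary l))) 6
    (Expr.eval (Function.update μ2 5 (pair pk (unary l))) (.reg 5))) 4
    (Expr.eval (Function.update (Function.update μ2 5 (pair pk (unary l))) 6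
      (Expr.eval (Function.update μ2 5 (pair pk (unary l))) (.reg 5))) (.reg 0)) with hμ3
  have hμ3' : ∀ j, j ≠ 5 → j ≠ 6 → j ≠ 4 → μ3 j = μ2 j := by
    intro j h3 h4 h5
    rw [hμ3, Function.update_of_ne h5, Function.update_of_ne h4, Function.update_of_ne h3]
  refine le_value_seq (by omega) ?_
  refine le_value_standalone (ρ := (5 * · + 4)) hpr hrunr (fun i j h => by simpa using h) μ3 _ ?_
    (fun i hi => ?_) _ (by omega) ?_
  · simp [hμ3, Expr.eval, hμ2, hμ1, inputs]
  · rw [hμ3' _ (by omega) (by omega) (by omega), hμ2 _ (by omega),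
      hμ1' _ (by omega) (by omega) (by omega) (by omega)]
  intro μ4 t8 ht8 h4 hfr4
  have hμ4 : ∀ j, j % 5 ≠ 4 → μ4 j = μ3 j := fun j hj => hfr4 j fun i => by omega
  have hμ4R : μ4 4 = unary R := h4
  refine le_value_seq (by omega) ?_
  refine le_value_assign (1 + R) (by simp [Expr.cost, hμ4R, hR]) (by omega) fun t9 ht9 => ?_
  refine le_value_seq (by omega) ?_
  refine le_value_assign (2 * R + 5) ?_ (by omega) fun t10 ht10 => ?_
  · simp [Expr.cost, Expr.eval, hμ4R, hR]
    omega
  set μ5 : Mem := Function.update (Function.update μ4 16 (Expr.eval μ4 (.reg 4))) 41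
    (Expr.eval (Function.update μ4 16 (Expr.eval μ4 (.reg 4))) (.push true (.reg 16))) with hμ5
  have hμ5' : ∀ j, j ≠ 16 → j ≠ 41 → j % 5 ≠ 4 → μ5 j = μ3 j := by
    intro j h3 h4 h5
    rw [hμ5, Function.update_of_ne h4, Function.update_of_ne h3, hμ4 j h5]
  have hμ5'' : ∀ j, 7 ≤ j → j ≠ 10 → j ≠ 11 → j ≠ 16 → j ≠ 41 → j % 5 ≠ 4 → j % 5 ≠ 3 →
      μ5 j = [] := by
    intro j a1 a2 a3 a4 a5 a6 a7
    rw [hμ5' j a4 a5 a6, hμ3' j (by omega) (by omega) (by omega), hμ2 j a7,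
      hμ1' j (by omega) a2 a3 (by omega)]
  refine value_innerAccepted_le_value_compile A le_rfl hΛ rfl μ5 _ _ (by omega) ?_ ?_ ?_
    (fun i hi => hμ5'' _ (by omega) (by omega) (by omega) (by omega) (by omega) (by omega)
      (by omega)) ?_ ?_ ?_ ?_ ?_ ?_ ?_ ?_ rfl
  · simp [hμ5', hμ3', hμ2, hμ1, inputs]
  · simp [hμ5', hμ3]
  · simp [hμ5', hμ3', hμ2, hμ1]
  · simp [hμ5', hμ3', hμ2, hμ1]
  · simp [hμ5', hμ3, Expr.eval]
  · simp [hμ5, Expr.eval, hμ4R]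
  · simp [hμ5'']
  · simp [hμ5'']
  · simp [hμ5, Expr.eval, hμ4R, unary, List.replicate_succ]
  · simp [hμ5'']
  · simp [hμ5'']

/-! ### Polynomial bounds -/

/-- Functions bounded by a polynomial with natural coefficients. -/
def PolyBounded (f : ℕ → ℕ) : Prop := ∃ p : Polynomial ℕ, ∀ n, f n ≤ p.eval n

namespace PolyBounded

variable {f g : ℕ → ℕ}

theorem mono (hg : PolyBounded g) (h : ∀ n, f n ≤ g n) : PolyBounded f :=
  let ⟨p, hp⟩ := hg
  ⟨p, fun n => (h n).trans (hp n)⟩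

theorem const (c : ℕ) : PolyBounded fun _ => c := ⟨.C c, fun n => by simp⟩

theorem id : PolyBounded fun n => n := ⟨.X, fun n => by simp⟩

theorem add (hf : PolyBounded f) (hg : PolyBounded g) : PolyBounded fun n => f n + g n :=
  let ⟨p, hp⟩ := hf
  let ⟨q, hq⟩ := hg
  ⟨p + q, fun n => by simpa using add_le_add (hp n) (hq n)⟩

theorem mul (hf : PolyBounded f) (hg : PolyBounded g) : PolyBounded fun n => f n * g n :=
  let ⟨p, hp⟩ := hf
  let ⟨q, hq⟩ := hg
  ⟨p * q, fun n => by simpa using Nat.mul_le_mul (hp n) (hq n)⟩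

theorem eval (q : Polynomial ℕ) (hf : PolyBounded f) : PolyBounded fun n => q.eval (f n) :=
  let ⟨p, hp⟩ := hf
  ⟨q.comp p, fun n => by simpa [Polynomial.eval_comp] using eval_mono q (hp n)⟩

/-- Polynomials are dominated by `2 ^ n`. -/
theorem eventually_le_two_pow (hf : PolyBounded f) : ∀ᶠ n in Filter.atTop, f n ≤ 2 ^ n := by
  obtain ⟨p, hp⟩ := hf
  have h : (fun n : ℕ => ((p.eval n : ℕ) : ℝ)) =o[Filter.atTop] fun n : ℕ => (2 : ℝ) ^ n := by
    clear hp
    induction p using Polynomial.induction_on' with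
    | add p q hp hq => simpa using hp.add hq
    | monomial k c =>
      simpa using (isLittleO_pow_const_const_pow_of_one_lt (R := ℝ) k one_lt_two).const_mul_left
        (c : ℝ)
  filter_upwards [h.bound one_pos] with n hn
  refine (hp n).trans ?_
  simp only [Real.norm_natCast, norm_pow, Real.norm_ofNat, one_mul] at hn
  exact_mod_cast hn

end PolyBounded

theorem PolyTimeComputable.polyBounded {f : ℕ → ℕ} (hf : PolyTimeComputable f) :
    PolyBounded f := by
  obtain ⟨p, t, -, hrun⟩ := hf
  have ht : PolyBounded fun n => t.eval n := ⟨t, fun n => le_rfl⟩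
  refine ((PolyBounded.id.add ht).add (((PolyBounded.const p.size).mul
    ((PolyBounded.id.add ht).add (.const 1))).add (.const 1))).mono fun n => ?_
  obtain ⟨c, hc⟩ :=
    (run (hashHandler noOracle) (t.eval n) p (inputs (unary n) [] []) ()).support_nonempty
  have := length_mem_le_of_run c hc 0
  rwa [(hrun n c hc).2, length_unary] at this

theorem polyBounded_reductionTime (F : Searcher) (pℓ pr a : Cmd) {Λ R B Bℓ Br : ℕ → ℕ}
    (hΛ : PolyBounded Λ) (hR : PolyBounded R) (hB : PolyBounded B) (hBℓ : PolyBounded Bℓ)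
    (hBr : PolyBounded Br) :
    PolyBounded fun n => reductionTime F pℓ pr a n (Λ n) (R n) (B n) (Bℓ n) (Br n) := by
  have hid := PolyBounded.id
  have h1 : PolyBounded fun n => maxRequest a.size (Λ n) (B n) :=
    (PolyBounded.const _).mul ((hΛ.add hB).add (.const 1))
  have h2 : PolyBounded fun n => maxHonest F a.size (Λ n) (B n) := .eval _ (hΛ.add h1)
  have h3 : PolyBounded fun n => maxQuery F a.size (Λ n) (B n) :=
    (PolyBounded.const _).mul (((hΛ.add h1).add h2).add (.const 1))
  have h4 : PolyBounded fun n => maxCache F a.size (Λ n) (B n) (R n) :=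
    ((((hB.mul (h2.add (.const 2))).mul (((PolyBounded.const 10).mul h3).add (.const 7))).add
      ((PolyBounded.const 10).mul h3)).add hR).add (.const 10)
  have hhash : ∀ {C L : ℕ → ℕ}, PolyBounded C → PolyBounded L →
      PolyBounded fun n => hashCost (C n) (L n) := fun hC hL =>
    ((PolyBounded.const 2).mul hC).add ((PolyBounded.const 150).mul
      ((hL.add (.const 1)).mul (hL.add (.const 1))))
  have hcost : PolyBounded fun n => F.cost (maxQuery F a.size (Λ n) (B n))
      (maxCache F a.size (Λ n) (B n) (R n)) (maxHonest F a.size (Λ n) (B n)) :=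
    (((PolyBounded.const _).add ((PolyBounded.const 2).mul h3)).add (.const 50)).add
      (h2.mul (((((PolyBounded.const 2).mul h3).add (hhash h3 h4)).add h4).add (.const 10)))
  have h5 : PolyBounded fun n => requestTime F a.size (Λ n) (B n) (R n) :=
    (((hcost.add ((PolyBounded.const 2).mul (hhash ((PolyBounded.const 10).mul h3) h4))).add
      ((PolyBounded.const 40).mul ((h4.add (.const 1)).mul (h4.add (.const 1))))).add
      ((PolyBounded.const 20).mul h4)).add (.const 100)
  have hst : ∀ (p : Cmd) {B : ℕ → ℕ}, PolyBounded B →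
      PolyBounded fun n => standaloneTime p n (B n) := fun p B hB =>
    hB.mul (((PolyBounded.const 2).mul ((PolyBounded.const _).mul
      ((hid.add hB).add (.const 1)))).add (.const 10))
  exact (((((hst pℓ hBℓ).add (hst pr hBr)).add ((PolyBounded.const 20).mul (hΛ.add hR))).add
    (.const 100)).add (hB.mul h5)).add hB

/-- The reduction does as well against the given scheme as the adversary does in the given
scheme's part of the augmented protocol. -/
theorem exists_reduction (S : IdScheme) (F : Searcher) (α : ℝ) {ℓ r : ℕ → ℕ}
    (hℓ : PolyTimeComputable ℓ) (hr : PolyTimeComputable r) (A : Adversary) :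
    ∃ A' : Adversary, (∀ P, A.HasPower P → A'.HasPower P) ∧ ∀ n,
      (expect (S.keyGen n) fun k =>
        value (lazyHandler (ghostHandler S F α (ℓ n) (r n) n k.1 k.2)) (A.time.eval n)
          (fun s => s.1.innerAccepted) (lazyStart S A n (ℓ n) k.2)) ≤
        S.toTimed.advantage 1 A' n noOracle := by
  have hℓb := hℓ.polyBounded
  have hrb := hr.polyBounded
  obtain ⟨pℓ, tℓ, hcℓ, hrunℓ⟩ := hℓ
  obtain ⟨pr, tr, hcr, hrunr⟩ := hr
  obtain ⟨ppk, hpk⟩ := S.pk_poly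
  obtain ⟨padv, hadv⟩ := A.advice_poly
  have hpoly : ∀ q : Polynomial ℕ, PolyBounded fun n => q.eval n := fun q => ⟨q, fun n => le_rfl⟩
  obtain ⟨T, hT⟩ := polyBounded_reductionTime F pℓ pr A.prog
    (Λ := fun n => n + (2 * ppk.eval n + 1 + ℓ n) + padv.eval n) (B := fun n => A.time.eval n)
    ((PolyBounded.id.add ((((PolyBounded.const 2).mul (hpoly ppk)).add (.const 1)).add hℓb)).add
      (hpoly padv)) hrb (hpoly A.time) (hpoly tℓ) (hpoly tr)
  refine ⟨⟨reduction F pℓ pr A.prog, T, A.advice, A.advice_poly⟩, fun P hP =>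
    ⟨fun hq => isClassical_reduction hcℓ hcr (hP.1 hq), hP.2⟩, fun n => ?_⟩
  rw [TimedIdScheme.advantage, expect_ite_eq_map_apply, expect_bind]
  refine expect_mono fun k hk => ?_
  refine value_innerAccepted_le_value_reduction A hcℓ hcr (hrunℓ n) (hrunr n) ?_ (hT n)
  have h1 := hpk n k hk
  have h2 := hadv n
  rw [length_pair, length_unary]
  omega

/-! ### Asymptotics -/

theorem Negligible.add {ε δ : ℕ → ℝ≥0∞} (hε : Negligible ε) (hδ : Negligible δ) :
    Negligible fun n => ε n + δ n := by
  intro c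
  filter_upwards [hε (c + 1), hδ (c + 1), Filter.eventually_ge_atTop 2] with n h1 h2 hn
  refine (ENNReal.add_lt_add h1 h2).trans_le ?_
  have hn0 : (n : ℝ≥0∞) ≠ 0 := by
    simp only [ne_eq, Nat.cast_eq_zero]
    omega
  have h3 : (n : ℝ≥0∞)⁻¹ ≤ 2⁻¹ := by
    rw [ENNReal.inv_le_inv]
    exact_mod_cast hn
  rw [pow_succ, ENNReal.mul_inv (Or.inr (ENNReal.natCast_ne_top n)) (Or.inr hn0), ← mul_add]
  refine mul_le_of_le_one_right' ((add_le_add h3 h3).trans ?_)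
  rw [ENNReal.inv_two_add_inv_two]

theorem Negligible.mono {ε δ : ℕ → ℝ≥0∞} (hδ : Negligible δ)
    (h : ∀ᶠ n in Filter.atTop, ε n ≤ δ n) : Negligible ε := by
  intro c
  filter_upwards [h, hδ c] with n h1 h2
  exact h1.trans_lt h2

/-- A superlogarithmic exponent makes a power of a constant negligible. -/
theorem negligible_pow {q : ℝ} (hq0 : 0 < q) (hq1 : q < 1) {r : ℕ → ℕ}
    (hr : Filter.Tendsto (fun n : ℕ => (r n : ℝ) / Real.log n) Filter.atTop Filter.atTop) :
    Negligible fun n => ENNReal.ofReal q ^ r n := by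
  intro c
  have hlog : 0 < -Real.log q := by
    have := Real.log_neg hq0 hq1
    linarith
  filter_upwards [hr.eventually_ge_atTop ((c + 1) / -Real.log q), Filter.eventually_ge_atTop 2]
    with n h1 hn
  have hn1 : (1 : ℝ) < n := by
    exact_mod_cast hn
  have hn0 : (0 : ℝ) < n := by linarith
  have hlogn : 0 < Real.log n := Real.log_pos hn1
  have h2 : ((c : ℝ) + 1) * Real.log n ≤ r n * -Real.log q := by
    rwa [div_le_div_iff₀ hlog hlogn] at h1
  have h3 : q ^ r n < ((n : ℝ) ^ c)⁻¹ := by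
    rw [← Real.log_lt_log_iff (by positivity) (by positivity), Real.log_pow, Real.log_inv,
      Real.log_pow]
    nlinarith
  have h4 : ((n : ℝ≥0∞) ^ c)⁻¹ = ENNReal.ofReal ((n : ℝ) ^ c)⁻¹ := by
    rw [ENNReal.ofReal_inv_of_pos (by positivity), ENNReal.ofReal_pow hn0.le, ENNReal.ofReal_natCast]
  rw [h4, ← ENNReal.ofReal_pow hq0.le]
  exact (ENNReal.ofReal_lt_ofReal_iff (by positivity)).2 h3

/-- Within the time limit an adversary wins a round with probability at most `27 / 128`, up to the
probability of guessing the round key in advance. With `s = 2 ^ (l / 6) ≥ 2 α`, the time limit is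
about `s ^ 2`, the number of hash evaluations about `s ^ 3 / 2`, and the number of digests
`s ^ 6`. -/
theorem winBound_le_const {l Q : ℕ} {α : ℝ} (hα : 1 ≤ α) (hl : 6 * Real.logb 2 (2 * α) ≤ l)
    (hQ : Q = ⌊α * timeLimit l⌋₊) : winBound l Q 0 ≤ 27 / 128 := by
  set s : ℝ := (2 : ℝ) ^ ((l : ℝ) / 6) with hs
  have hs0 : 0 < s := Real.rpow_pos_of_pos two_pos _
  have hsα : 2 * α ≤ s := by
    rw [hs, ← Real.logb_le_iff_le_rpow one_lt_two (by linarith)]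
    linarith
  have hs6 : s ^ 6 = 2 ^ l := by
    rw [hs, ← Real.rpow_natCast, ← Real.rpow_mul two_pos.le, ← Real.rpow_natCast]
    congr 1
    push_cast
    ring
  have hs2 : ((2 : ℝ) ^ l) ^ (1 / 3 : ℝ) = s ^ 2 := by
    rw [← hs6, ← Real.rpow_natCast, ← Real.rpow_mul hs0.le, ← Real.rpow_natCast]
    congr 1
    push_cast
    norm_num
  have htl : (timeLimit l : ℝ) ≤ s ^ 2 + 1 := by
    rw [timeLimit, hs2]
    exact (Nat.ceil_lt_add_one (by positivity)).le
  have hQs : (Q : ℝ) ≤ s / 2 * (s ^ 2 + 1) := by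
    rw [hQ]
    refine (Nat.floor_le (by positivity)).trans ?_
    exact mul_le_mul (by linarith) htl (by positivity) (by positivity)
  have hu : 4 ≤ s ^ 2 := by nlinarith
  have hQ2 : (Q : ℝ) ^ 2 ≤ s ^ 2 * (s ^ 2 + 1) ^ 2 / 4 := by
    refine (pow_le_pow_left₀ (by positivity) hQs 2).trans (le_of_eq ?_)
    ring
  have hmain : 128 + 64 * (Q : ℝ) ^ 2 ≤ 27 * 2 ^ l := by
    rw [← hs6]
    set u := s ^ 2 with hu'
    have : s ^ 6 = u ^ 3 := by rw [hu']; ring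
    rw [this]
    -- Equality holds for `u = 4`, that is, for `s = 2`.
    have h1 : 0 ≤ (u - 4) * (11 * u ^ 2 + 12 * u + 32) := mul_nonneg (by linarith) (by positivity)
    nlinarith
  have hsum : (∑ i ∈ Finset.range Q, i) * 2 ≤ Q ^ 2 := by
    rw [Finset.sum_range_id_mul_two, sq]
    exact Nat.mul_le_mul_left _ (Nat.sub_le _ _)
  have hnat : 128 + 64 * Q ^ 2 ≤ 27 * 2 ^ l := by exact_mod_cast hmain
  have hfin : (1 + ∑ i ∈ Finset.range Q, i) * 128 ≤ 27 * 2 ^ l := by omega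
  have hcast : ((1 + ∑ i ∈ Finset.Ico 0 Q, (i : ℝ≥0∞)) * 128 : ℝ≥0∞) ≤ 27 * 2 ^ l := by
    rw [← Finset.range_eq_Ico]
    have h := (Nat.cast_le (α := ℝ≥0∞)).2 hfin
    push_cast at h
    exact h
  unfold winBound
  rw [← div_eq_mul_inv]
  refine ENNReal.div_le_of_le_mul ?_
  rw [mul_comm, ← mul_div_assoc, mul_comm _ (27 : ℝ≥0∞)]
  exact (ENNReal.le_div_iff_mul_le (by simp) (by simp)).2 hcast

theorem winBound_add_le {l Q n N : ℕ} (hw : winBound l Q 0 ≤ 27 / 128) (hN : N * 128 ≤ 2 ^ n) :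
    winBound l Q 0 + N * (2 ^ n)⁻¹ ≤ 7 / 32 := by
  have h1 : (N : ℝ≥0∞) * (2 ^ n)⁻¹ ≤ 1 / 128 := by
    rw [← div_eq_mul_inv]
    refine ENNReal.div_le_of_le_mul ?_
    rw [mul_comm, ← mul_div_assoc, mul_one]
    refine (ENNReal.le_div_iff_mul_le (by simp) (by simp)).2 ?_
    exact_mod_cast hN
  refine (add_le_add hw h1).trans (le_of_eq ?_)
  rw [← ENNReal.add_div]
  norm_num
  rw [ENNReal.div_eq_div_iff] <;> norm_num

/-! ### Security of the augmented scheme -/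

/-- Winning a quarter of the rounds of the collision stage has negligible probability. -/
theorem negligible_collisionAccepted (S : IdScheme) (F : Searcher) {α : ℝ} (hα : 1 ≤ α)
    {ℓ r : ℕ → ℕ} (hℓ_eff : PolyTimeComputable ℓ)
    (hℓ_log : ∀ᶠ n : ℕ in Filter.atTop, (ℓ n : ℝ) ≤ Real.logb 2 n)
    (hℓ_alpha : ∀ᶠ n : ℕ in Filter.atTop, 6 * Real.logb 2 (2 * α) ≤ (ℓ n : ℝ))
    (hr : Filter.Tendsto (fun n : ℕ => (r n : ℝ) / Real.log n) Filter.atTop Filter.atTop)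
    (A : Adversary) :
    Negligible fun n => expect (S.keyGen n) fun k =>
      value (lazyHandler (ghostHandler S F α (ℓ n) (r n) n k.1 k.2)) (A.time.eval n)
        (fun s => s.1.collisionAccepted (r n)) (lazyStart S A n (ℓ n) k.2) := by
  obtain ⟨ppk, hpk⟩ := S.pk_poly
  obtain ⟨padv, hadv⟩ := A.advice_poly
  have hpoly : ∀ q : Polynomial ℕ, PolyBounded fun n => q.eval n := fun q => ⟨q, fun n => le_rfl⟩
  set Λ : ℕ → ℕ := fun n => n + (2 * ppk.eval n + 1 + ℓ n) + padv.eval n with hΛdef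
  have hΛ : PolyBounded Λ :=
    (PolyBounded.id.add ((((PolyBounded.const 2).mul (hpoly ppk)).add (.const 1)).add
      hℓ_eff.polyBounded)).add (hpoly padv)
  -- A bound for the number of hash values that are ever sampled.
  set N : ℕ → ℕ := fun n => A.time.eval n * (F.time.eval (Λ n +
    A.prog.size * (Λ n + A.time.eval n + 1)) + 2) + 2 with hNdef
  have hN : PolyBounded N :=
    ((hpoly A.time).mul ((PolyBounded.eval _ (hΛ.add ((PolyBounded.const _).mul
      ((hΛ.add (hpoly A.time)).add (.const 1))))).add (.const 2))).add (.const 2)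
  refine (negligible_pow (q := 2223047 / 2228224) (by norm_num) (by norm_num) hr).mono ?_
  filter_upwards [hℓ_log, hℓ_alpha, (hN.mul (.const 128)).eventually_le_two_pow,
    Filter.eventually_gt_atTop 0] with n h1 h2 h3 hn
  have hq : ENNReal.ofReal (2223047 / 2228224) = 2223047 / 2228224 := by
    rw [ENNReal.ofReal_div_of_pos (by norm_num), ENNReal.ofReal_ofNat, ENNReal.ofReal_ofNat]
  rw [hq]
  have hln : ℓ n ≤ n := by
    rw [Real.le_logb_iff_rpow_le one_lt_two (by exact_mod_cast hn), Real.rpow_natCast] at h1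
    have h4 : 2 ^ ℓ n ≤ n := by exact_mod_cast h1
    exact Nat.lt_two_pow_self.le.trans h4
  refine expect_le fun k hk => ?_
  have hk1 := hpk n k hk
  have hk2 := hadv n
  have hk3 : (pair k.2 (unary (ℓ n))).length = 2 * k.2.length + 1 + ℓ n := by
    rw [length_pair, length_unary]
  have hpk' : n + (pair k.2 (unary (ℓ n))).length ≤ Λ n := by
    simp only [hΛdef]
    omega
  refine value_collisionAccepted_le A hln (by linarith) rfl (L := Λ n) ?_ (N := N n) ?_
    (winBound_add_le (winBound_le_const hα h2 rfl) h3)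
  · simp only [hΛdef]
    omega
  · exact Nat.add_le_add_right (Nat.mul_le_mul_left _ (Nat.add_le_add_right
      (eval_mono _ (Nat.add_le_add_right hpk' _)) 2)) 2

/-- The two halves of the impersonator's chance are negligible, against any kind of adversaries. -/
theorem secureInROM_augment (S : IdScheme) (F : Searcher) {α : ℝ} (hα : 1 ≤ α)
    {ℓ r : ℕ → ℕ} (hℓ_eff : PolyTimeComputable ℓ) (hr_eff : PolyTimeComputable r)
    (hℓ_log : ∀ᶠ n : ℕ in Filter.atTop, (ℓ n : ℝ) ≤ Real.logb 2 n)
    (hℓ_alpha : ∀ᶠ n : ℕ in Filter.atTop, 6 * Real.logb 2 (2 * α) ≤ (ℓ n : ℝ))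
    (hr : Filter.Tendsto (fun n : ℕ => (r n : ℝ) / Real.log n) Filter.atTop Filter.atTop)
    {P : Power} (hS : S.Secure P) : (S.augment F ℓ r).SecureInROM α P := by
  intro A hA
  obtain ⟨A', hpower, hA'⟩ := exists_reduction S F α hℓ_eff hr_eff A
  refine ((hS A' (hpower P hA)).add
    (negligible_collisionAccepted S F hα hℓ_eff hℓ_log hℓ_alpha hr A)).mono ?_
  exact Filter.Eventually.of_forall fun n =>
    (lintegral_advantage_le S F ℓ r n α A).trans (by gcongr; exact hA' n)

end TimedId

end

theorem mainTheorem9 (IS : TimedId.IdScheme) (F : TimedId.Searcher)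
    (α : ℝ) (hα : 1 ≤ α) (ℓ r : ℕ → ℕ)
    (hℓ_eff : TimedId.PolyTimeComputable ℓ) (hr_eff : TimedId.PolyTimeComputable r)
    (hℓ_log : ∀ᶠ n : ℕ in Filter.atTop, (ℓ n : ℝ) ≤ Real.logb 2 n)
    (hℓ_alpha : ∀ᶠ n : ℕ in Filter.atTop, 6 * Real.logb 2 (2 * α) ≤ (ℓ n : ℝ))
    (hr : Filter.Tendsto (fun n : ℕ => (r n : ℝ) / Real.log n) Filter.atTop Filter.atTop) :
    ∀ nonuniform : Bool,
      (IS.Secure { quantum := false, nonuniform := nonuniform } →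
        (IS.augment F ℓ r).SecureInROM α { quantum := false, nonuniform := nonuniform }) ∧
      (IS.Secure { quantum := true, nonuniform := nonuniform } →
        (IS.augment F ℓ r).SecureInROM α { quantum := true, nonuniform := nonuniform }) :=
  fun _ => ⟨TimedId.secureInROM_augment IS F hα hℓ_eff hr_eff hℓ_log hℓ_alpha hr,
    TimedId.secureInROM_augment IS F hα hℓ_eff hr_eff hℓ_log hℓ_alpha hr⟩
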